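/- **Setting.** For each $n$ let $d=d_n$, $r=r_n\le d_n$ and observe $Y_i=m_n(X_i)+\xi_i$, $i=1,\dots,n$, where $X_1,\dots,X_n$ are i.i.d. uniform on the unit cube $[0,1]^d$, $\xi_1,\dots,\xi_n$ are i.i.d. $N(0,\sigma^2)$ and independent of the $X_i$, and $\sigma>0$ is fixed and known. Let $x=x_n$ be interior points of the cube, uniformly in $n$: for some $\delta>0$, $\delta\le x_{n,j}\le 1-\delta$ for all $n$ and $j\le d_n$. Assume: * on $(0,1)^d$, $m_n$ depends only on the first $r$ coordinates (the relevant variables); * on $(0,1)^d$, $m_n$ is three times continuously differentiable with differentiable third derivative, and all its partial derivatives of orders $1,\dots,4$ are bounded by a constant $M$ that does not depend on $n$; * $\liminf_{n\to\infty}\min_{1\le j\le r}\left|\partial^2 m_n/\partial x_j^2(x_n)\right|>0$ (no condition when $r=0$); * $r_n=O(1)$ and $d_n=O(\log n/\log\log n)$. **Kernel and local linear estimate.** Let $K:\mathbb R\to\mathbb R$ be Lipschitz with compact support, $\int K=1$, $\int u^kK(u)\,du=0$ for all odd $k$, and $\nu_2=\int u^2K(u)\,du\ne0$. For a bandwidth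 vector $h=(h_1,\dots,h_d)$ put $K_h(u)=\prod_{j=1}^d h_j^{-1}K(u_j/h_j)$, let $X_x$ be the $n\times(1+d)$ matrix with rows $(1,(X_i-x)^\top)$ and $W_x=\mathrm{diag}(K_h(X_1-x),\dots,K_h(X_n-x))$, and set $$\hat m_h(x)=e_1^\top(X_x^\top W_xX_x)^{-1}X_x^\top W_xY,\qquad G(u,x,h)=e_1^\top(X_x^\top W_xX_x)^{-1}\begin{pmatrix}1\\u-x\end{pmatrix}K_h(u-x),$$ $$Z_j(h)=\frac{\partial\hat m_h(x)}{\partial h_j},\qquad s_j(h)^2=\sigma^2\sum_{i=1}^n\Big(\frac{\partial G}{\partial h_j}(X_i,x,h)\Big)^2,\qquad \lambda_j(h)=s_j(h)\sqrt{2\log n}.$$ **Rodeo (hard thresholding).** Fix constants $0<\beta<1$ and $c_0>0$. Start with $h_j=h_0=c_0/\log\log n$ for all $j$ and the active set $\mathcal A=\{1,\dots,d\}$. While $\mathcal A\ne\emptyset$, make a pass over $j\in\mathcal A$ in increasing order: if $|Z_j(h)|>\lambda_j(h)$, replace $h_j$ by $\beta h_j$; otherwise remove $j$ from $\mathcal A$.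 (The tests of a pass may either all use the bandwidths at the beginning of that pass, or use the bandwidths as already updated within the pass; the result is claimed for both versions.) Let $h^*$ be the bandwidth vector when $\mathcal A$ becomes empty. **Corollary 5.2.** For every $\varepsilon>0$, $$(\hat m_{h^*}(x_n)-m_n(x_n))^2=O_P\big(n^{-4/(4+r)+\varepsilon}\big),$$ that is, for every $\eta>0$ there is $C$ such that, for all sufficiently large $n$, $\mathbb P\big((\hat m_{h^*}(x_n)-m_n(x_n))^2>C\,n^{-4/(4+r_n)+\varepsilon}\big)\le\eta$. -/

import Mathlib

open MeasureTheory ProbabilityTheory Filter Asymptotics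
open scoped NNReal ENNReal Matrix

namespace Rodeo

noncomputable section

/-! ### Local linear regression with a product kernel -/

/-- Assumptions on the univariate factor `K` of the product kernel `u ↦ ∏ j, K (u j)`: it is
Lipschitz (so that derivatives in the bandwidths exist almost surely), compactly supported,
integrates to one, has zero odd moments and a nonzero second moment `ν₂`. -/
structure IsKernel (K : ℝ → ℝ) : Prop where
  lipschitz : ∃ L : ℝ≥0, LipschitzWith L K
  compactSupport : HasCompactSupport K
  integral_eq_one : ∫ u, K u = 1
  odd_moments : ∀ k : ℕ, Odd k → ∫ u, u ^ k * K u = 0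
  second_moment : ∫ u, u ^ 2 * K u ≠ 0

/-- `K_H(u) = |H|^{-1/2} K(H^{-1/2} u)` for the product kernel and `H = diag(h_1^2, …, h_d^2)`. -/
def scaledKernel {d : ℕ} (K : ℝ → ℝ) (h u : Fin d → ℝ) : ℝ :=
  ∏ j, K (u j / h j) / h j

/-- The vector `(1, (u - x)ᵀ)ᵀ` in `ℝ^{1+d}`. -/
def localRow {d : ℕ} (x u : Fin d → ℝ) : Fin (d + 1) → ℝ :=
  Fin.cons 1 (u - x)

/-- The `n × (1 + d)` local design matrix `X_x`, with rows `(1, (X_i - x)ᵀ)`. -/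
def designMatrix {n d : ℕ} (X : Fin n → Fin d → ℝ) (x : Fin d → ℝ) :
    Matrix (Fin n) (Fin (d + 1)) ℝ :=
  Matrix.of fun i => localRow x (X i)

/-- The diagonal weight matrix `W_x`, with `(i, i)` entry `K_H(X_i - x)`. -/
def weightMatrix {n d : ℕ} (K : ℝ → ℝ) (X : Fin n → Fin d → ℝ) (x h : Fin d → ℝ) :
    Matrix (Fin n) (Fin n) ℝ :=
  Matrix.diagonal fun i => scaledKernel K h (X i - x)

/-- The local Gram matrix `X_xᵀ W_x X_x`. -/
def gramMatrix {n d : ℕ} (K : ℝ → ℝ) (X : Fin n → Fin d → ℝ) (x h : Fin d → ℝ) :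
    Matrix (Fin (d + 1)) (Fin (d + 1)) ℝ :=
  (designMatrix X x)ᵀ * weightMatrix K X x h * designMatrix X x

/-- The local linear estimate `m̂_h(x) = e₁ᵀ (X_xᵀ W_x X_x)⁻¹ X_xᵀ W_x Y`. -/
def mHat {n d : ℕ} (K : ℝ → ℝ) (X : Fin n → Fin d → ℝ) (Y : Fin n → ℝ) (x h : Fin d → ℝ) : ℝ :=
  (((gramMatrix K X x h)⁻¹ * (designMatrix X x)ᵀ * weightMatrix K X x h) *ᵥ Y) 0

/-- The effective kernel `G(u, x, h) = e₁ᵀ (X_xᵀ W_x X_x)⁻¹ (1, (u - x)ᵀ)ᵀ K_H(u - x)`. -/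
def effKernel {n d : ℕ} (K : ℝ → ℝ) (X : Fin n → Fin d → ℝ) (u x h : Fin d → ℝ) : ℝ :=
  ((gramMatrix K X x h)⁻¹ *ᵥ localRow x u) 0 * scaledKernel K h (u - x)

/-- The partial derivative `∂F/∂h_j` of a function of the bandwidth vector. -/
def bandwidthDeriv {d : ℕ} (F : (Fin d → ℝ) → ℝ) (h : Fin d → ℝ) (j : Fin d) : ℝ :=
  deriv (fun t => F (Function.update h j t)) (h j)

/-- The statistic `Z_j(h) = ∂ m̂_h(x) / ∂ h_j`. -/
def Z {n d : ℕ} (K : ℝ → ℝ) (X : Fin n → Fin d → ℝ) (Y : Fin n → ℝ) (x h : Fin d → ℝ)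
    (j : Fin d) : ℝ :=
  bandwidthDeriv (fun h' => mHat K X Y x h') h j

/-- The conditional standard deviation of `Z_j(h)` given the covariates:
`s_j(h)² = σ² ∑ᵢ G_j(X_i, x, h)²` with `G_j = ∂G/∂h_j`. -/
def s {n d : ℕ} (K : ℝ → ℝ) (σ : ℝ) (X : Fin n → Fin d → ℝ) (x h : Fin d → ℝ)
    (j : Fin d) : ℝ :=
  √(σ ^ 2 * ∑ i, (bandwidthDeriv (fun h' => effKernel K X (X i) x h') h j) ^ 2)

/-- The threshold `λ_j(h) = s_j(h) √(2 log n)`, where `n` is the sample size. -/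
def threshold {n d : ℕ} (K : ℝ → ℝ) (σ : ℝ) (X : Fin n → Fin d → ℝ) (x h : Fin d → ℝ)
    (j : Fin d) : ℝ :=
  s K σ X x h j * √(2 * Real.log n)

/-! ### The hard thresholding rodeo -/

/-- The state of the algorithm: the current bandwidths and the set of active covariates. -/
structure State (d : ℕ) where
  h : Fin d → ℝ
  active : Finset (Fin d)

/-- How one pass over the active covariates is carried out: in `simultaneous` mode all the tests
of a pass use the bandwidths at the beginning of the pass, in `sequential` mode each test uses the
bandwidths as already updated within the pass. -/
inductive Mode
  | simultaneous
  | sequential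

open Classical in
/-- Treatment of covariate `j` when `large` is the outcome of the test `|Z_j| > λ_j`: if `j` is
active, then `h_j ← β h_j` if the test is positive, and `j` is removed from the active set if not. -/
def visit {d : ℕ} (β : ℝ) (large : Prop) (j : Fin d) (S : State d) : State d :=
  if j ∈ S.active then
    if large then { h := Function.update S.h j (β * S.h j), active := S.active }
    else { h := S.h, active := S.active.erase j }
  else S

/-- One pass of the while loop: the covariates are treated in increasing order. -/
def sweep {d : ℕ} (mode : Mode) (β : ℝ) (large : (Fin d → ℝ) → Fin d → Prop) (S : State d) :
    State d :=
  (List.finRange d).foldl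
    (fun cur j =>
      visit β
        (large (match mode with
          | .simultaneous => S.h
          | .sequential => cur.h) j) j cur) S

/-- The initial bandwidth `h₀ = c₀ / log log n`. -/
def h₀ (c₀ : ℝ) (n : ℕ) : ℝ := c₀ / Real.log (Real.log n)

/-- The state of the rodeo after `t` passes, on the data `(X_i, Y_i)`, `i < n`, at the point `x`. -/
def state {n d : ℕ} (mode : Mode) (K : ℝ → ℝ) (β c₀ σ : ℝ) (X : Fin n → Fin d → ℝ)
    (Y : Fin n → ℝ) (x : Fin d → ℝ) (t : ℕ) : State d :=
  (sweep mode β fun h j => threshold K σ X x h j < |Z K X Y x h j|)^[t]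
    { h := fun _ => h₀ c₀ n, active := Finset.univ }

/-- The number of passes until no covariate is active (`0` if that never happens). -/
def stoppingTime {n d : ℕ} (mode : Mode) (K : ℝ → ℝ) (β c₀ σ : ℝ) (X : Fin n → Fin d → ℝ)
    (Y : Fin n → ℝ) (x : Fin d → ℝ) : ℕ :=
  sInf {t | (state mode K β c₀ σ X Y x t).active = ∅}

/-- The bandwidths `h*` selected by the rodeo. -/
def hStar {n d : ℕ} (mode : Mode) (K : ℝ → ℝ) (β c₀ σ : ℝ) (X : Fin n → Fin d → ℝ)
    (Y : Fin n → ℝ) (x : Fin d → ℝ) : Fin d → ℝ :=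
  (state mode K β c₀ σ X Y x (stoppingTime mode K β c₀ σ X Y x)).h

/-- The rodeo estimate `m̂_{h*}(x)`. -/
def estimate {n d : ℕ} (mode : Mode) (K : ℝ → ℝ) (β c₀ σ : ℝ) (X : Fin n → Fin d → ℝ)
    (Y : Fin n → ℝ) (x : Fin d → ℝ) : ℝ :=
  mHat K X Y x (hStar mode K β c₀ σ X Y x)

/-! ### The regression model -/

/-- The uniform distribution on the unit cube `[0,1]^d`. -/
def uniformCube (d : ℕ) : Measure (Fin d → ℝ) :=
  volume.restrict (Set.univ.pi fun _ => Set.Icc 0 1)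

/-- The open unit cube `(0,1)^d`. -/
def openCube (d : ℕ) : Set (Fin d → ℝ) :=
  Set.univ.pi fun _ => Set.Ioo 0 1

/-- The partial derivative `∂^k m / ∂y_{i_1} ⋯ ∂y_{i_k}` at `y`. -/
def partialDeriv {d k : ℕ} (m : (Fin d → ℝ) → ℝ) (i : Fin k → Fin d) (y : Fin d → ℝ) : ℝ :=
  iteratedFDeriv ℝ k m y fun l => Pi.single (i l) 1

/-- `m` is three times continuously differentiable, its third derivative is differentiable, and
all partial derivatives of orders one to four are bounded by `M`, on the open unit cube. -/
structure HasBoundedDerivs {d : ℕ} (m : (Fin d → ℝ) → ℝ) (M : ℝ) : Prop where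
  contDiffOn : ContDiffOn ℝ 3 m (openCube d)
  differentiableOn : DifferentiableOn ℝ (iteratedFDeriv ℝ 3 m) (openCube d)
  bound : ∀ k : ℕ, 1 ≤ k → k ≤ 4 → ∀ i : Fin k → Fin d, ∀ y ∈ openCube d,
    |partialDeriv m i y| ≤ M

/-- On the open unit cube, `m(y)` depends only on the first `r` coordinates of `y`. -/
def DependsOnFirst {d : ℕ} (r : ℕ) (m : (Fin d → ℝ) → ℝ) : Prop :=
  ∀ y ∈ openCube d, ∀ z ∈ openCube d, (∀ j : Fin d, (j : ℕ) < r → y j = z j) → m y = m z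

/-- `X_1, …, X_n` are i.i.d. uniform on the unit cube, `ξ_1, …, ξ_n` are i.i.d. `N(0, σ²)`, and
the covariates are independent of the noise. -/
structure IsSample {Ω : Type*} [MeasurableSpace Ω] {n d : ℕ} (P : Measure Ω) (σ : ℝ≥0)
    (X : Fin n → Ω → Fin d → ℝ) (ξ : Fin n → Ω → ℝ) : Prop where
  law_X : ∀ i, HasLaw (X i) (uniformCube d) P
  indep_X : iIndepFun X P
  law_noise : ∀ i, HasLaw (ξ i) (gaussianReal 0 (σ ^ 2)) P
  indep_noise : iIndepFun ξ P
  indep : IndepFun (fun ω i => X i ω) (fun ω i => ξ i ω) P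

/-- `U_n = O_P(a_n)`, for random variables `U_n` that may live on different probability spaces. -/
def IsBigOP {Ω : ℕ → Type*} [∀ n, MeasurableSpace (Ω n)] (P : ∀ n, Measure (Ω n))
    (U : ∀ n, Ω n → ℝ) (a : ℕ → ℝ) : Prop :=
  ∀ η : ℝ≥0∞, 0 < η → ∃ C : ℝ, 0 < C ∧ ∀ᶠ n in atTop, P n {ω | C * a n < |U n ω|} ≤ η

end

end Rodeo

/-!
The rodeo test of a covariate compares `Z_j = ∂m̂_h(x)/∂h_j` with a multiple of its conditional
standard deviation. The local linear estimate reproduces affine functions at every bandwidth, so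
`Z_j` does not see the affine part of the regression function at `x`: what remains is the Taylor
remainder, which is small, plus noise. Up to sampling fluctuations, `h_j Z_j` has mean
`ν₂ h_j² ∂²m/∂x_j²(x)` if the covariate `j` is relevant, and `0` if it is not
(`abs_integral_wt_remainder_sub_le`, `abs_integral_vrow_wt_mul_le`); its standard deviation is
`(n ∏ h_i)^{-1/2}` up to factors `C^d`, which are smaller than any power of `n` because
`d = O(log n / log log n)`. For the same reason the initial bandwidths, which irrelevant covariates
keep, contribute a factor `h₀^{-d}` that is smaller than any power of `n`.

*One bandwidth vector.* In rescaled coordinates `(u - x) / h` the population Gram matrix is diagonal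
with entries `1, ν₂, …, ν₂`, so the estimate and its bandwidth derivatives are perturbations of
explicit population quantities as soon as all weighted averages are close to their expectations.
The closeness needed, `GoodAt`, holds outside an event of probability `O(d³ n^{-1/4})`, by
Bernstein's inequality for the design and the Gaussian tail for the noise
(`dataLaw_not_goodAt_le`). On `GoodAt`, the test of an irrelevant covariate is negative
(`GoodAt.abs_Z_le_of_irrelevant`), that of a relevant covariate is positive if `h_j²` exceeds the
standard deviation by a factor (`GoodAt.lt_abs_Z`) and negative if `h_j²` is smaller than it by a
factor (`GoodAt.abs_Z_le_of_small`), and the estimate has the usual bias and variance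
(`GoodAt.abs_mHat_sub_le`). A point that needs care is that the error in the mean of `Z_j` is of
second order: the bias of the estimate times the relative fluctuation of the averages, so that it
remains below the threshold (`abs_effD_mean_sub_le`).

*The path.* While the bandwidth of a relevant covariate is among the smallest ones and larger than
`n^{-(1-θ)/(4+r)}`, its signal `h_j²` dominates the standard deviation, which is of the order
`(n h_j^r)^{-1/2}` up to small powers of `n`, so it keeps shrinking; once all the relevant bandwidths
are below `n^{-(1-θ)/(4+r)}`, one that has reached `n^{-1/(4+r)-θ}` is not shrunk any further. Since
a covariate is tested in each pass until it becomes inactive, an active bandwidth is always among the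
smallest up to one factor `β`, in both versions of a pass, which gives an invariant of the algorithm
(`PassInv`, `exists_config_of_goodTests`). The final relevant bandwidths are therefore
`n^{-1/(4+r)}` up to small powers of `n`, whence the rate.

*Union bound.* The bandwidths that the algorithm can meet are determined by the numbers of
shrinkages of the `r = O(1)` relevant bandwidths, each of order `log n`. There are polynomially many
in `log n`, and a union bound over them avoids any discussion of the dependence between the path and
the data (`IsSample.measure_not_goodAt_le`).
-/

namespace Rodeo

noncomputable section

/-! ### Weighted least squares: perturbation bounds -/

section LinearAlgebra

variable {p : Type*}

/-- The weighted Gram matrix: the average of the outer products `w_i ρ_i ρ_iᵀ` of the design rows. -/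
def wGram {n : ℕ} (ρ : Fin n → p → ℝ) (w : Fin n → ℝ) : Matrix p p ℝ :=
  Matrix.of fun k l => (n : ℝ)⁻¹ * ∑ i, ρ i k * ρ i l * w i

lemma wGram_transpose {n : ℕ} (ρ : Fin n → p → ℝ) (w : Fin n → ℝ) : (wGram ρ w)ᵀ = wGram ρ w := by
  ext k l
  simp only [wGram, Matrix.transpose_apply, Matrix.of_apply]
  congr 1
  exact Finset.sum_congr rfl fun i _ => by ring

variable [Fintype p]

lemma mulVec_dotProduct_of_symm {A : Matrix p p ℝ} (hA : Aᵀ = A) (u v : p → ℝ) :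
    A *ᵥ u ⬝ᵥ v = u ⬝ᵥ A *ᵥ v := by
  rw [Matrix.dotProduct_mulVec, ← Matrix.mulVec_transpose, hA]

/-- A vector with entries at most `s` has a small product with a vector that is `τ`-close to one
supported on `R`: only the coordinates in `R` contribute to the leading order. -/
lemma abs_dotProduct_le_of_support {δ b b₀ : p → ℝ} {s ϱ τ : ℝ} {R : Finset p} (hs : 0 ≤ s)
    (hδ : ∀ k, |δ k| ≤ s) (hb : ∀ k, |b k - b₀ k| ≤ τ) (hb0 : ∀ k, |b₀ k| ≤ ϱ)
    (hR : ∀ k, k ∉ R → b₀ k = 0) :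
    |δ ⬝ᵥ b| ≤ s * (R.card * ϱ + Fintype.card p * τ) := by
  have h1 : δ ⬝ᵥ b = ∑ k ∈ R, δ k * b₀ k + ∑ k, δ k * (b k - b₀ k) := by
    rw [Finset.sum_subset (Finset.subset_univ R) fun k _ hk => by rw [hR k hk, mul_zero],
      ← Finset.sum_add_distrib, dotProduct]
    exact Finset.sum_congr rfl fun k _ => by ring
  have h2 : |∑ k ∈ R, δ k * b₀ k| ≤ R.card * (s * ϱ) := by
    refine (Finset.abs_sum_le_sum_abs _ _).trans ?_
    refine (Finset.sum_le_card_nsmul _ _ (s * ϱ) fun l _ => ?_).trans_eq (by simp)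
    rw [abs_mul]
    exact mul_le_mul (hδ _) (hb0 _) (abs_nonneg _) hs
  have h3 : |∑ k, δ k * (b k - b₀ k)| ≤ Fintype.card p * (s * τ) := by
    refine (Finset.abs_sum_le_sum_abs _ _).trans ?_
    refine (Finset.sum_le_card_nsmul _ _ (s * τ) fun l _ => ?_).trans_eq
      (by simp [Finset.card_univ])
    rw [abs_mul]
    exact mul_le_mul (hδ _) (hb _) (abs_nonneg _) hs
  rw [h1]
  refine (abs_add_le _ _).trans ?_
  linarith

variable [DecidableEq p]

/-- A matrix that is entrywise close to a diagonal matrix bounded away from zero has an inverse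
bounded in the sup norm. The closeness `η` has to beat the dimension, which is why the dimension
appears in the smallness conditions below. -/
lemma abs_le_of_mulVec_near_diagonal {Γ : Matrix p p ℝ} {D : p → ℝ} {ι η t : ℝ} (hι : 0 ≤ ι)
    (hD : ∀ k, 1 ≤ ι * |D k|) (hΓ : ∀ k l, |Γ k l - Matrix.diagonal D k l| ≤ η)
    (hsmall : Fintype.card p * ι * η ≤ 1 / 2) {y : p → ℝ} (hy : ∀ k, |(Γ *ᵥ y) k| ≤ t) (k : p) :
    |y k| ≤ 2 * ι * t := by
  obtain ⟨k0, -, hk0⟩ := Finset.exists_max_image Finset.univ (fun k => |y k|) ⟨k, Finset.mem_univ k⟩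
  have hmax : ∀ l, |y l| ≤ |y k0| := fun l => hk0 l (Finset.mem_univ l)
  refine (hmax k).trans ?_
  have h1 : D k0 * y k0 = (Γ *ᵥ y) k0 - ∑ l, (Γ k0 l - Matrix.diagonal D k0 l) * y l := by
    simp only [Matrix.mulVec, dotProduct, sub_mul, Finset.sum_sub_distrib]
    have : ∑ l, Matrix.diagonal D k0 l * y l = D k0 * y k0 := by
      rw [Finset.sum_eq_single k0] <;> simp +contextual [eq_comm]
    rw [this]; ring
  have h2 : |∑ l, (Γ k0 l - Matrix.diagonal D k0 l) * y l| ≤ Fintype.card p * (η * |y k0|) := by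
    refine (Finset.abs_sum_le_sum_abs _ _).trans ?_
    refine (Finset.sum_le_card_nsmul _ _ (η * |y k0|) fun l _ => ?_).trans_eq ?_
    · rw [abs_mul]
      exact mul_le_mul (hΓ _ _) (hmax l) (abs_nonneg _) ((abs_nonneg _).trans (hΓ k0 l))
    · simp [Finset.card_univ]
  have h3 : |D k0| * |y k0| ≤ t + Fintype.card p * (η * |y k0|) := by
    rw [← abs_mul, h1]
    exact (abs_sub _ _).trans (add_le_add (hy k0) h2)
  have h4 : |y k0| ≤ ι * |D k0| * |y k0| := le_mul_of_one_le_left (abs_nonneg _) (hD k0)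
  have h5 := mul_le_mul_of_nonneg_left h3 hι
  have h6 := mul_le_mul_of_nonneg_right hsmall (abs_nonneg (y k0))
  nlinarith

lemma isUnit_det_of_near_diagonal {Γ : Matrix p p ℝ} {D : p → ℝ} {ι η : ℝ} (hι : 0 ≤ ι)
    (hD : ∀ k, 1 ≤ ι * |D k|) (hΓ : ∀ k l, |Γ k l - Matrix.diagonal D k l| ≤ η)
    (hsmall : Fintype.card p * ι * η ≤ 1 / 2) : IsUnit Γ.det := by
  rw [isUnit_iff_ne_zero]
  intro h0
  obtain ⟨v, hv, hv0⟩ := Matrix.exists_mulVec_eq_zero_iff.mpr h0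
  refine hv (funext fun k => ?_)
  have := abs_le_of_mulVec_near_diagonal hι hD hΓ hsmall (y := v) (t := 0) (by simp [hv0]) k
  simpa using this

/-- The intercept row `e_zᵀ Γ⁻¹` of the inverse of the weighted Gram matrix `Γ`, written as a
column, which is possible since `Γ` is symmetric. -/
def icept {n : ℕ} (z : p) (ρ : Fin n → p → ℝ) (w : Fin n → ℝ) : p → ℝ :=
  (wGram ρ w)⁻¹ *ᵥ Pi.single z 1

/-- The vector `Γ⁻¹ Q Γ⁻¹ e_z`, which gives the derivative of `e_zᵀ Γ⁻¹` when `Q` is the derivative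
of `Γ`. -/
def iceptDeriv {n : ℕ} (z : p) (ρ : Fin n → p → ℝ) (w q : Fin n → ℝ) : p → ℝ :=
  (wGram ρ w)⁻¹ *ᵥ (wGram ρ q *ᵥ icept z ρ w)

/-- The effective kernel of weighted least squares at the `i`-th design point: the coefficient of the
`i`-th response in the estimate of the intercept, which is the coordinate `z`. -/
def effW {n : ℕ} (z : p) (ρ : Fin n → p → ℝ) (w : Fin n → ℝ) (i : Fin n) : ℝ :=
  (n : ℝ)⁻¹ * ((icept z ρ w ⬝ᵥ ρ i) * w i)

/-- The derivative of the effective kernel, up to the factor `n⁻¹`, when the weights `w` move with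
velocity `q`. -/
def effD {n : ℕ} (z : p) (ρ : Fin n → p → ℝ) (w q : Fin n → ℝ) (i : Fin n) : ℝ :=
  (icept z ρ w ⬝ᵥ ρ i) * q i - (iceptDeriv z ρ w q ⬝ᵥ ρ i) * w i

lemma wGram_inv_transpose {n : ℕ} (ρ : Fin n → p → ℝ) (w : Fin n → ℝ) :
    ((wGram ρ w)⁻¹)ᵀ = (wGram ρ w)⁻¹ := by
  rw [Matrix.transpose_nonsing_inv, wGram_transpose]

lemma icept_dotProduct {n : ℕ} (z : p) (ρ : Fin n → p → ℝ) (w : Fin n → ℝ) (v : p → ℝ) :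
    icept z ρ w ⬝ᵥ v = ((wGram ρ w)⁻¹ *ᵥ v) z := by
  rw [icept, mulVec_dotProduct_of_symm (wGram_inv_transpose ρ w)]
  simp

lemma sum_effW_mul {n : ℕ} (z : p) (ρ : Fin n → p → ℝ) (w : Fin n → ℝ) (f : Fin n → ℝ) :
    ∑ i, effW z ρ w i * f i =
      icept z ρ w ⬝ᵥ fun k => (n : ℝ)⁻¹ * ∑ i, ρ i k * w i * f i := by
  simp only [effW, dotProduct, Finset.mul_sum, Finset.sum_mul]
  rw [Finset.sum_comm]
  exact Finset.sum_congr rfl fun i _ => Finset.sum_congr rfl fun k _ => by ring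

lemma sum_effD_mul {n : ℕ} (z : p) (ρ : Fin n → p → ℝ) (w q : Fin n → ℝ) (f : Fin n → ℝ) :
    (n : ℝ)⁻¹ * ∑ i, effD z ρ w q i * f i =
      (icept z ρ w ⬝ᵥ fun k => (n : ℝ)⁻¹ * ∑ i, ρ i k * q i * f i) -
      iceptDeriv z ρ w q ⬝ᵥ fun k => (n : ℝ)⁻¹ * ∑ i, ρ i k * w i * f i := by
  simp only [effD, dotProduct, Finset.mul_sum, Finset.sum_mul, sub_mul, Finset.sum_sub_distrib,
    mul_sub]
  congr 1
  · rw [Finset.sum_comm]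
    exact Finset.sum_congr rfl fun i _ => Finset.sum_congr rfl fun k _ => by ring
  · rw [Finset.sum_comm]
    exact Finset.sum_congr rfl fun i _ => Finset.sum_congr rfl fun k _ => by ring

/-- Weighted least squares reproduces linear functions of the design rows. -/
lemma sum_effW_linear {n : ℕ} (z : p) (ρ : Fin n → p → ℝ) (w : Fin n → ℝ)
    (hdet : IsUnit (wGram ρ w).det) (a : p → ℝ) :
    ∑ i, effW z ρ w i * (ρ i ⬝ᵥ a) = a z := by
  rw [sum_effW_mul]
  have : (fun k => (n : ℝ)⁻¹ * ∑ i, ρ i k * w i * (ρ i ⬝ᵥ a)) = wGram ρ w *ᵥ a := by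
    funext k
    simp only [wGram, Matrix.mulVec, dotProduct, Matrix.of_apply, Finset.mul_sum, Finset.sum_mul]
    rw [Finset.sum_comm]
    exact Finset.sum_congr rfl fun i _ => Finset.sum_congr rfl fun k _ => by ring
  rw [this, icept_dotProduct, Matrix.mulVec_mulVec, Matrix.nonsing_inv_mul _ hdet,
    Matrix.one_mulVec]

/-- The derivative of the effective kernel annihilates linear functions of the design rows. This
is why only the Taylor remainder of the regression function enters the test statistics. -/
lemma sum_effD_linear {n : ℕ} (z : p) (ρ : Fin n → p → ℝ) (w q : Fin n → ℝ)
    (hdet : IsUnit (wGram ρ w).det) (a : p → ℝ) :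
    ∑ i, effD z ρ w q i * (ρ i ⬝ᵥ a) = 0 := by
  rcases Nat.eq_zero_or_pos n with rfl | hn
  · simp
  have hn' : (n : ℝ)⁻¹ ≠ 0 := by positivity
  have key : ∀ w : Fin n → ℝ,
      (fun k => (n : ℝ)⁻¹ * ∑ i, ρ i k * w i * (ρ i ⬝ᵥ a)) = wGram ρ w *ᵥ a := by
    intro w
    funext k
    simp only [wGram, Matrix.mulVec, dotProduct, Matrix.of_apply, Finset.mul_sum, Finset.sum_mul]
    rw [Finset.sum_comm]
    exact Finset.sum_congr rfl fun i _ => Finset.sum_congr rfl fun k _ => by ring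
  refine (mul_eq_zero.mp ?_).resolve_left hn'
  rw [sum_effD_mul, key, key, iceptDeriv, sub_eq_zero,
    mulVec_dotProduct_of_symm (wGram_inv_transpose ρ w), Matrix.mulVec_mulVec _ _ (wGram ρ w),
    Matrix.nonsing_inv_mul _ hdet, Matrix.one_mulVec,
    mulVec_dotProduct_of_symm (wGram_transpose ρ q)]

/-- Differentiation of the effective kernel along a curve of weights. -/
lemma hasDerivAt_effW {n : ℕ} (z : p) (ρ : Fin n → p → ℝ) (w : ℝ → Fin n → ℝ) (q : Fin n → ℝ)
    (t : ℝ) (hw : ∀ i, HasDerivAt (fun s => w s i) (q i) t) (hdet : IsUnit (wGram ρ (w t)).det)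
    (i : Fin n) :
    HasDerivAt (fun s => effW z ρ (w s) i) ((n : ℝ)⁻¹ * effD z ρ (w t) q i) t := by
  let _ : NormedRing (Matrix p p ℝ) := Matrix.linftyOpNormedRing
  let _ : NormedAlgebra ℝ (Matrix p p ℝ) := Matrix.linftyOpNormedAlgebra
  have hG : HasDerivAt (fun s => wGram ρ (w s)) (wGram ρ q) t := by
    have : HasDerivAt (fun s => (fun k l => wGram ρ (w s) k l : p → p → ℝ))
        (fun k l => wGram ρ q k l) t := by
      refine hasDerivAt_pi.mpr fun k => hasDerivAt_pi.mpr fun l => ?_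
      simp only [wGram, Matrix.of_apply]
      exact (HasDerivAt.fun_sum fun i _ => (hw i).const_mul _).const_mul _
    exact this
  obtain ⟨u, hu⟩ := (Matrix.isUnit_iff_isUnit_det _).mpr hdet
  have hinv : HasDerivAt (fun s => (wGram ρ (w s))⁻¹)
      (-((wGram ρ (w t))⁻¹ * wGram ρ q * (wGram ρ (w t))⁻¹)) t := by
    have h1 : HasFDerivAt Ring.inverse _ (wGram ρ (w t)) :=
      hu ▸ hasFDerivAt_ringInverse (𝕜 := ℝ) u
    have h2 := h1.comp_hasDerivAt t hG
    have h3 : ((u⁻¹ : (Matrix p p ℝ)ˣ) : Matrix p p ℝ) = (wGram ρ (w t))⁻¹ := by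
      rw [← hu, Matrix.coe_units_inv]
    have h4 : (fun s => (wGram ρ (w s))⁻¹) = Ring.inverse ∘ fun s => wGram ρ (w s) :=
      funext fun s => Matrix.nonsing_inv_eq_ringInverse _
    rw [h4]
    refine h2.congr_deriv ?_
    rw [neg_apply, ContinuousLinearMap.mulLeftRight_apply, h3]
  have hent : ∀ k l, HasDerivAt (fun s => (wGram ρ (w s))⁻¹ k l)
      ((-((wGram ρ (w t))⁻¹ * wGram ρ q * (wGram ρ (w t))⁻¹)) k l) t := by
    intro k l
    have h1 : HasDerivAt (fun s => (fun k l => (wGram ρ (w s))⁻¹ k l : p → p → ℝ))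
        (fun k l => (-((wGram ρ (w t))⁻¹ * wGram ρ q * (wGram ρ (w t))⁻¹)) k l) t := hinv
    exact hasDerivAt_pi.mp (hasDerivAt_pi.mp h1 k) l
  have hvec : HasDerivAt (fun s => ((wGram ρ (w s))⁻¹ *ᵥ ρ i) z)
      (((-((wGram ρ (w t))⁻¹ * wGram ρ q * (wGram ρ (w t))⁻¹)) *ᵥ ρ i) z) t := by
    simp only [Matrix.mulVec, dotProduct]
    exact HasDerivAt.fun_sum fun l _ => (hent z l).mul_const _
  have hD : iceptDeriv z ρ (w t) q ⬝ᵥ ρ i =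
      (((wGram ρ (w t))⁻¹ * wGram ρ q * (wGram ρ (w t))⁻¹) *ᵥ ρ i) z := by
    rw [iceptDeriv, mulVec_dotProduct_of_symm (wGram_inv_transpose ρ _),
      mulVec_dotProduct_of_symm (wGram_transpose ρ q), icept_dotProduct]
    simp only [Matrix.mulVec_mulVec, Matrix.mul_assoc]
  simp only [effW, effD, icept_dotProduct, hD]
  refine ((hvec.mul (hw i)).const_mul ((n : ℝ)⁻¹)).congr_deriv ?_
  rw [Matrix.neg_mulVec, Pi.neg_apply]
  ring

/-! ### Perturbation of the intercept weights around the population -/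

section Perturbation

variable {n : ℕ} {z : p} {ρ : Fin n → p → ℝ} {w q : Fin n → ℝ} {D : p → ℝ} {ι η : ℝ}

/-- If the Gram matrix is close to a diagonal matrix with entry one at the intercept, then the
intercept row of its inverse is close to the unit vector. -/
lemma abs_icept_sub_single_le (hι : 0 ≤ ι) (hD : ∀ k, 1 ≤ ι * |D k|) (hDz : D z = 1)
    (hΓ : ∀ k l, |wGram ρ w k l - Matrix.diagonal D k l| ≤ η)
    (hsmall : Fintype.card p * ι * η ≤ 1 / 2) (k : p) :
    |icept z ρ w k - (Pi.single z 1 : p → ℝ) k| ≤ 2 * ι * η := by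
  have hdet := isUnit_det_of_near_diagonal hι hD hΓ hsmall
  refine abs_le_of_mulVec_near_diagonal (y := icept z ρ w - Pi.single z 1) hι hD hΓ hsmall ?_ k
  intro l
  have h1 : wGram ρ w *ᵥ (icept z ρ w - Pi.single z 1) = Pi.single z 1 - (wGram ρ w).col z := by
    rw [Matrix.mulVec_sub, icept, Matrix.mulVec_mulVec, Matrix.mul_nonsing_inv _ hdet,
      Matrix.one_mulVec, Matrix.mulVec_single_one]
  have h2 : (Pi.single z 1 : p → ℝ) l = Matrix.diagonal D l z := by
    rcases eq_or_ne l z with rfl | h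
    · simp [hDz]
    · simp [h]
  rw [h1, Pi.sub_apply, h2, abs_sub_comm]
  exact hΓ l z

/-- The derivative of the intercept row is small, since the derivative of the Gram matrix is close to
a matrix that does not touch the intercept. -/
lemma abs_iceptDeriv_le {j : p} (hj : j ≠ z) {q₀ C : ℝ} (hι : 1 ≤ ι) (hη : 0 ≤ η)
    (hD : ∀ k, 1 ≤ ι * |D k|) (hDz : D z = 1) (hq : |q₀| ≤ C)
    (hΓ : ∀ k l, |wGram ρ w k l - Matrix.diagonal D k l| ≤ η)
    (hQ : ∀ k l, |wGram ρ q k l - Matrix.single j j q₀ k l| ≤ η)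
    (hsmall : Fintype.card p * ι * η ≤ 1 / 2) (k : p) :
    |iceptDeriv z ρ w q k| ≤ 4 * ι * (ι * C + 1) * η := by
  have hι0 : 0 ≤ ι := by linarith
  have hC : 0 ≤ C := (abs_nonneg _).trans hq
  have hdet := isUnit_det_of_near_diagonal hι0 hD hΓ hsmall
  have hγ := abs_icept_sub_single_le hι0 hD hDz hΓ hsmall
  have hmain : ∀ k, |(wGram ρ w *ᵥ iceptDeriv z ρ w q) k| ≤ (2 * ι * C + 2) * η := by
    intro k
    have h1 : wGram ρ w *ᵥ iceptDeriv z ρ w q = wGram ρ q *ᵥ icept z ρ w := by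
      rw [iceptDeriv, Matrix.mulVec_mulVec, Matrix.mul_nonsing_inv _ hdet, Matrix.one_mulVec]
    have h2 : (wGram ρ q *ᵥ icept z ρ w) k =
        (Matrix.single j j q₀ *ᵥ icept z ρ w) k + (wGram ρ q k z - Matrix.single j j q₀ k z) +
        ∑ l, (wGram ρ q k l - Matrix.single j j q₀ k l) *
          (icept z ρ w l - (Pi.single z 1 : p → ℝ) l) := by
      have : wGram ρ q k z - Matrix.single j j q₀ k z = ∑ l,
          (wGram ρ q k l - Matrix.single j j q₀ k l) * (Pi.single z 1 : p → ℝ) l := by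
        simp [Pi.single_apply]
      rw [this, Matrix.mulVec, Matrix.mulVec, dotProduct, dotProduct, ← Finset.sum_add_distrib,
        ← Finset.sum_add_distrib]
      exact Finset.sum_congr rfl fun l _ => by ring
    have h3 : |(Matrix.single j j q₀ *ᵥ icept z ρ w) k| ≤ C * (2 * ι * η) := by
      rw [Matrix.single_mulVec]
      rcases eq_or_ne k j with rfl | h
      · have := hγ k
        rw [Pi.single_eq_of_ne hj, sub_zero] at this
        simp only [Function.update_self, abs_mul]
        exact mul_le_mul hq this (abs_nonneg _) hC
      · simp only [Function.update_of_ne h, Pi.zero_apply, abs_zero]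
        positivity
    have h4 : |∑ l, (wGram ρ q k l - Matrix.single j j q₀ k l) *
          (icept z ρ w l - (Pi.single z 1 : p → ℝ) l)| ≤ Fintype.card p * (η * (2 * ι * η)) := by
      refine (Finset.abs_sum_le_sum_abs _ _).trans ?_
      refine (Finset.sum_le_card_nsmul _ _ (η * (2 * ι * η)) fun l _ => ?_).trans_eq ?_
      · rw [abs_mul]
        exact mul_le_mul (hQ _ _) (hγ l) (abs_nonneg _) hη
      · simp [Finset.card_univ]
    rw [h1, h2]
    refine (abs_add_three _ _ _).trans ?_
    have h5 := mul_le_mul_of_nonneg_right hsmall hη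
    nlinarith [hQ k z]
  refine (abs_le_of_mulVec_near_diagonal hι0 hD hΓ hsmall hmain k).trans_eq ?_
  ring

/-- First-order expansion of the conditional mean of the local linear fit: `b` is the weighted average
of `ρ f` for the function `f` to be smoothed, and `b₀` its expectation, supported on `R`. -/
lemma abs_icept_dotProduct_sub_le {b b₀ : p → ℝ} {ϱ : ℝ} {R : Finset p} (hι : 1 ≤ ι)
    (hη : 0 ≤ η) (hϱ : 0 ≤ ϱ) (hD : ∀ k, 1 ≤ ι * |D k|) (hDz : D z = 1)
    (hΓ : ∀ k l, |wGram ρ w k l - Matrix.diagonal D k l| ≤ η)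
    (hsmall : Fintype.card p * ι * η ≤ 1 / 2)
    (hb : ∀ k, |b k - b₀ k| ≤ ϱ * η) (hb0 : ∀ k, |b₀ k| ≤ ϱ) (hR : ∀ k, k ∉ R → b₀ k = 0) :
    |icept z ρ w ⬝ᵥ b - b₀ z| ≤ 2 * (ι * R.card + 1) * (ϱ * η) := by
  have hγ := abs_icept_sub_single_le (by linarith) hD hDz hΓ hsmall
  have h1 : icept z ρ w ⬝ᵥ b - b₀ z =
      (b z - b₀ z) + (fun k => icept z ρ w k - (Pi.single z 1 : p → ℝ) k) ⬝ᵥ b := by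
    have : (fun k => icept z ρ w k - (Pi.single z 1 : p → ℝ) k) = icept z ρ w - Pi.single z 1 := rfl
    rw [this, sub_dotProduct, single_dotProduct]
    ring
  have h2 := abs_dotProduct_le_of_support (by positivity) hγ hb hb0 hR
  rw [h1]
  refine (abs_add_le _ _).trans ?_
  have h3 := mul_le_mul_of_nonneg_right hsmall (mul_nonneg hϱ hη)
  nlinarith [hb z]

/-- First-order expansion of the conditional mean of the derivative of the local linear fit. The
error is of second order: it is the product of the size `ϱ` of the function and of the fluctuation
`η`, with a constant that depends on the number of relevant coordinates only. -/
lemma abs_effD_mean_sub_le {j : p} (hj : j ≠ z) {q₀ C : ℝ} {b b₀ c c₀ : p → ℝ} {ϱ : ℝ}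
    {R : Finset p} (hι : 1 ≤ ι) (hη : 0 ≤ η) (hϱ : 0 ≤ ϱ) (hD : ∀ k, 1 ≤ ι * |D k|)
    (hDz : D z = 1) (hq : |q₀| ≤ C)
    (hΓ : ∀ k l, |wGram ρ w k l - Matrix.diagonal D k l| ≤ η)
    (hQ : ∀ k l, |wGram ρ q k l - Matrix.single j j q₀ k l| ≤ η)
    (hsmall : Fintype.card p * ι * η ≤ 1 / 2)
    (hb : ∀ k, |b k - b₀ k| ≤ ϱ * η) (hb0 : ∀ k, |b₀ k| ≤ ϱ) (hbR : ∀ k, k ∉ R → b₀ k = 0)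
    (hc : ∀ k, |c k - c₀ k| ≤ ϱ * η) (hc0 : ∀ k, |c₀ k| ≤ ϱ) (hcR : ∀ k, k ∉ R → c₀ k = 0) :
    |icept z ρ w ⬝ᵥ c - iceptDeriv z ρ w q ⬝ᵥ b - c₀ z| ≤
      8 * ι * (ι * C + 1) * (R.card + 1) * (ϱ * η) := by
  have hC : 0 ≤ C := (abs_nonneg _).trans hq
  have hθ := abs_iceptDeriv_le hj hι hη hD hDz hq hΓ hQ hsmall
  have h1 := abs_icept_dotProduct_sub_le hι hη hϱ hD hDz hΓ hsmall hc hc0 hcR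
  have h2 := abs_dotProduct_le_of_support (by positivity) hθ hb hb0 hbR
  have h3 : icept z ρ w ⬝ᵥ c - iceptDeriv z ρ w q ⬝ᵥ b - c₀ z =
    (icept z ρ w ⬝ᵥ c - c₀ z) - iceptDeriv z ρ w q ⬝ᵥ b := by ring
  rw [h3]
  refine (abs_sub _ _).trans ((add_le_add h1 h2).trans ?_)
  have hN : Fintype.card p * η ≤ 1 / 2 := by
    refine le_trans ?_ hsmall
    have : (0 : ℝ) ≤ Fintype.card p * η := by positivity
    nlinarith
  have h4 : 4 * ι * (ι * C + 1) * η * (R.card * ϱ + Fintype.card p * (ϱ * η)) ≤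
      4 * ι * (ι * C + 1) * (R.card + 1 / 2) * (ϱ * η) := by
    have : Fintype.card p * (ϱ * η) ≤ 1 / 2 * ϱ := by nlinarith
    calc _ ≤ 4 * ι * (ι * C + 1) * η * (R.card * ϱ + 1 / 2 * ϱ) := by gcongr
      _ = _ := by ring
  have h5 : 2 * (ι * R.card + 1) * (ϱ * η) ≤
      4 * ι * (ι * C + 1) * (R.card + 1) * (ϱ * η) := by
    refine mul_le_mul_of_nonneg_right ?_ (mul_nonneg hϱ hη)
    have ha : (0 : ℝ) ≤ R.card := by positivity
    have hb : 0 ≤ ι * C := by positivity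
    nlinarith [mul_nonneg (mul_nonneg (by linarith : 0 ≤ ι) hb) (by linarith : 0 ≤ (R.card : ℝ) + 1),
      mul_nonneg (by linarith : 0 ≤ ι) ha]
  have h6 : 4 * ι * (ι * C + 1) * (R.card + 1 / 2) * (ϱ * η) ≤
      4 * ι * (ι * C + 1) * (R.card + 1) * (ϱ * η) := by gcongr; norm_num
  linarith

lemma abs_icept_dotProduct_row_le {S : ℝ} (hι : 1 ≤ ι) (hη : 0 ≤ η)
    (hD : ∀ k, 1 ≤ ι * |D k|) (hDz : D z = 1)
    (hΓ : ∀ k l, |wGram ρ w k l - Matrix.diagonal D k l| ≤ η)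
    (hsmall : Fintype.card p * ι * η ≤ 1 / 2) {v : p → ℝ} (hvz : v z = 1)
    (hv : ∀ k, |v k| ≤ S) :
    |icept z ρ w ⬝ᵥ v - 1| ≤ Fintype.card p * (2 * ι * η * S) := by
  have hγ := abs_icept_sub_single_le (by linarith) hD hDz hΓ hsmall
  have h1 : icept z ρ w ⬝ᵥ v - 1 =
      ∑ k, (icept z ρ w k - (Pi.single z 1 : p → ℝ) k) * v k := by
    simp [sub_mul, Finset.sum_sub_distrib, dotProduct, Pi.single_apply, hvz]
  rw [h1]
  refine (Finset.abs_sum_le_sum_abs _ _).trans ?_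
  refine (Finset.sum_le_card_nsmul _ _ (2 * ι * η * S) fun l _ => ?_).trans_eq
    (by simp [Finset.card_univ])
  rw [abs_mul]
  exact mul_le_mul (hγ _) (hv _) (abs_nonneg _) (by positivity)

/-- The derivative of the effective kernel is close to the derivative of the kernel. -/
lemma abs_effD_sub_le {j : p} (hj : j ≠ z) {q₀ C S : ℝ} (hS : 1 ≤ S) (hι : 1 ≤ ι) (hη : 0 ≤ η)
    (hD : ∀ k, 1 ≤ ι * |D k|) (hDz : D z = 1) (hq : |q₀| ≤ C) (hC : 1 ≤ C)
    (hΓ : ∀ k l, |wGram ρ w k l - Matrix.diagonal D k l| ≤ η)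
    (hQ : ∀ k l, |wGram ρ q k l - Matrix.single j j q₀ k l| ≤ η)
    (hsmall : Fintype.card p * ι * η ≤ 1 / 2) (i : Fin n) (hz : ρ i z = 1)
    (hi : w i ≠ 0 ∨ q i ≠ 0 → ∀ k, |ρ i k| ≤ S) :
    |effD z ρ w q i - q i| ≤
      Fintype.card p * (4 * ι * (ι * C + 1) * η * S) * (|q i| + |w i|) := by
  by_cases h0 : w i ≠ 0 ∨ q i ≠ 0
  swap
  · push Not at h0
    simp [effD, h0.1, h0.2]
  have hθ := abs_iceptDeriv_le hj hι hη hD hDz hq hΓ hQ hsmall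
  have hι0 : 0 ≤ ι := by linarith
  have h1 := abs_icept_dotProduct_row_le hι hη hD hDz hΓ hsmall hz (hi h0)
  have h2 : |iceptDeriv z ρ w q ⬝ᵥ ρ i| ≤ Fintype.card p * (4 * ι * (ι * C + 1) * η * S) := by
    refine (Finset.abs_sum_le_sum_abs _ _).trans ?_
    refine (Finset.sum_le_card_nsmul _ _ (4 * ι * (ι * C + 1) * η * S) fun l _ => ?_).trans_eq
      (by simp [Finset.card_univ])
    rw [abs_mul]
    exact mul_le_mul (hθ _) (hi h0 _) (abs_nonneg _) (by positivity)
  have h3 : 2 * ι * η * S ≤ 4 * ι * (ι * C + 1) * η * S := by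
    have : 2 * ι * 1 ≤ 4 * ι * (ι * C + 1) := by
      have : 0 ≤ ι * (ι * C) := by positivity
      nlinarith
    have h0 : 0 ≤ η * S := by positivity
    nlinarith
  have h4 : |icept z ρ w ⬝ᵥ ρ i - 1| ≤ Fintype.card p * (4 * ι * (ι * C + 1) * η * S) :=
    h1.trans (mul_le_mul_of_nonneg_left h3 (by positivity))
  have h5 : effD z ρ w q i - q i =
    (icept z ρ w ⬝ᵥ ρ i - 1) * q i - (iceptDeriv z ρ w q ⬝ᵥ ρ i) * w i := by
    rw [effD]; ring
  rw [h5, mul_add]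
  refine (abs_sub _ _).trans (add_le_add ?_ ?_)
  · rw [abs_mul]; gcongr
  · rw [abs_mul]; gcongr

/-- Comparison of the sum of squares of `A` with that of `q` when `A` is a small perturbation
of `q`. -/
lemma sum_sq_perturb {m : ℕ} {A q w : Fin m → ℝ} {ζ : ℝ}
    (h : ∀ i, |A i - q i| ≤ ζ * (|q i| + |w i|)) :
    (∑ i, q i ^ 2) / 2 - 2 * ζ ^ 2 * (∑ i, q i ^ 2 + ∑ i, w i ^ 2) ≤ ∑ i, A i ^ 2 ∧
      ∑ i, A i ^ 2 ≤ 2 * ∑ i, q i ^ 2 + 4 * ζ ^ 2 * (∑ i, q i ^ 2 + ∑ i, w i ^ 2) := by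
  have key : ∀ i, (A i - q i) ^ 2 ≤ 2 * ζ ^ 2 * (q i ^ 2 + w i ^ 2) := by
    intro i
    have h1 := h i
    have h2 := sq_le_sq' (by linarith [abs_nonneg (A i - q i)]) h1
    rw [sq_abs] at h2
    have h3 : (|q i| + |w i|) ^ 2 ≤ 2 * (q i ^ 2 + w i ^ 2) := by
      rw [← sq_abs (q i), ← sq_abs (w i)]
      nlinarith [sq_nonneg (|q i| - |w i|)]
    nlinarith [mul_le_mul_of_nonneg_left h3 (sq_nonneg ζ)]
  constructor
  · rw [← Finset.sum_add_distrib, Finset.sum_div, Finset.mul_sum, ← Finset.sum_sub_distrib]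
    refine Finset.sum_le_sum fun i _ => ?_
    nlinarith [key i, sq_nonneg (2 * A i - q i)]
  · rw [← Finset.sum_add_distrib, Finset.mul_sum, Finset.mul_sum, ← Finset.sum_add_distrib]
    refine Finset.sum_le_sum fun i _ => ?_
    nlinarith [key i, sq_nonneg (A i - 2 * q i)]

end Perturbation

end LinearAlgebra

/-! ### The path of the algorithm -/

section Algorithm

variable {d : ℕ}

/-- The bandwidth vector whose `j`-th entry has been shrunk `k j` times. -/
def bw (β b₀ : ℝ) (k : Fin d → ℕ) : Fin d → ℝ := fun j => β ^ k j * b₀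

/-- Shrinkage counts that vanish off the first `r` coordinates and are at most `T`. -/
def IsConfig (r T : ℕ) (k : Fin d → ℕ) : Prop :=
  ∀ j : Fin d, k j ≤ T ∧ (r ≤ (j : ℕ) → k j = 0)

/-- The state of the algorithm in the `t`-th pass, when the covariates in `done` have been visited:
active relevant bandwidths have been shrunk in every pass, the others have been shrunk between `A`
and `T` times, and the irrelevant covariates are discarded in the first pass. -/
def PassInv (r A T : ℕ) (β b₀ : ℝ) (t : ℕ) (done : Finset (Fin d)) (S : State d) : Prop :=
  ∃ k : Fin d → ℕ, S.h = bw β b₀ k ∧ IsConfig r T k ∧ ∀ j : Fin d,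
    ((j : ℕ) < r → j ∈ S.active → j ∉ done → k j = t) ∧
    ((j : ℕ) < r → j ∈ S.active → j ∈ done → k j = t + 1) ∧
    ((j : ℕ) < r → j ∉ S.active → A ≤ k j ∧ k j ≤ t) ∧
    (r ≤ (j : ℕ) → j ∈ S.active → j ∉ done ∧ t = 0)

/-- The outcome of the tests at the bandwidths that the algorithm can visit: those of irrelevant
covariates are negative, those of relevant covariates are positive if the bandwidth has been shrunk
fewer than `A` times and, up to one shrinkage, no bandwidth is smaller, and negative if it has been
shrunk `T` times and all the relevant bandwidths have been shrunk at least `A` times. -/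
structure GoodTests (r A T : ℕ) (β b₀ : ℝ) (large : (Fin d → ℝ) → Fin d → Prop) : Prop where
  irrelevant : ∀ k : Fin d → ℕ, IsConfig r T k → ∀ j : Fin d, r ≤ (j : ℕ) → ¬ large (bw β b₀ k) j
  shrink : ∀ k : Fin d → ℕ, IsConfig r T k → ∀ j : Fin d, (j : ℕ) < r → k j < A →
    (∀ i, k i ≤ k j + 1) → large (bw β b₀ k) j
  halt : ∀ k : Fin d → ℕ, IsConfig r T k → ∀ j : Fin d, (j : ℕ) < r → k j = T →
    (∀ i : Fin d, (i : ℕ) < r → A ≤ k i) → ¬ large (bw β b₀ k) j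

variable {r A T : ℕ} {β b₀ : ℝ} {large : (Fin d → ℝ) → Fin d → Prop}

lemma PassInv.count_le {t : ℕ} {done : Finset (Fin d)} {S : State d} {k : Fin d → ℕ}
    (hk : IsConfig r T k) (h : ∀ j : Fin d,
    ((j : ℕ) < r → j ∈ S.active → j ∉ done → k j = t) ∧
    ((j : ℕ) < r → j ∈ S.active → j ∈ done → k j = t + 1) ∧
    ((j : ℕ) < r → j ∉ S.active → A ≤ k j ∧ k j ≤ t) ∧
    (r ≤ (j : ℕ) → j ∈ S.active → j ∉ done ∧ t = 0)) (i : Fin d) : k i ≤ t + 1 := by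
  rcases lt_or_ge (i : ℕ) r with hi | hi
  · by_cases ha : i ∈ S.active
    · by_cases hd : i ∈ done
      · exact ((h i).2.1 hi ha hd).le
      · have := (h i).1 hi ha hd; omega
    · have := (h i).2.2.1 hi ha; omega
  · have := (hk i).2 hi; omega

/-- A visit preserves the invariant, provided the test is carried out at bandwidths `bw β b₀ k'` of
the current pass. The test uses the bandwidths of `S'`, which is the state at the beginning of the
pass in simultaneous mode and the current state in sequential mode. -/
lemma PassInv.visit (hAT : A ≤ T) (hg : GoodTests r A T β b₀ large) {t : ℕ} (htT : t ≤ T)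
    {done : Finset (Fin d)} {S : State d} (hS : PassInv r A T β b₀ t done S) (j : Fin d)
    (hj : j ∉ done) (h' : Fin d → ℝ)
    (hh : ∃ done' S', PassInv r A T β b₀ t done' S' ∧ S'.h = h' ∧ j ∉ done' ∧
      (j ∈ S.active → j ∈ S'.active)) :
    PassInv r A T β b₀ t (insert j done) (visit β (large h' j) j S) := by
  classical
  obtain ⟨k, hSk, hk, hinv⟩ := hS
  obtain ⟨done', S', ⟨k', hSk', hk', hinv'⟩, rfl, hjd', hact⟩ := hh
  by_cases ha : j ∈ S.active
  swap
  · rw [Rodeo.visit, if_neg ha]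
    refine ⟨k, hSk, hk, fun i => ?_⟩
    obtain ⟨h1, h2, h3, h4⟩ := hinv i
    have hij : i ∈ S.active → i ≠ j := fun hi hij => ha (hij ▸ hi)
    refine ⟨fun a b c => h1 a b fun hd => c (Finset.mem_insert_of_mem hd),
      fun a b c => h2 a b ((Finset.mem_insert.mp c).resolve_left (hij b)), h3, fun a b => ?_⟩
    refine ⟨fun c => ?_, (h4 a b).2⟩
    exact (h4 a b).1 ((Finset.mem_insert.mp c).resolve_left (hij b))
  have hle := PassInv.count_le hk' hinv'
  rw [Rodeo.visit, if_pos ha]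
  by_cases hlarge : large S'.h j
  · rw [if_pos hlarge]
    -- a positive test: `j` is relevant and has been shrunk fewer than `T` times
    have hjr : (j : ℕ) < r := by
      by_contra hjr
      rw [hSk'] at hlarge
      exact hg.irrelevant k' hk' j (not_lt.mp hjr) hlarge
    have hkj : k j = t := (hinv j).1 hjr ha hj
    have hkj' : k' j = t := (hinv' j).1 hjr (hact ha) hjd'
    have htlt : t < T := by
      by_contra hcon
      have htT' : t = T := by omega
      rw [hSk'] at hlarge
      refine hg.halt k' hk' j hjr (by omega) (fun i hi => ?_) hlarge
      by_cases hia : i ∈ S'.active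
      · by_cases hid : i ∈ done'
        · have := (hinv' i).2.1 hi hia hid; omega
        · have := (hinv' i).1 hi hia hid; omega
      · exact ((hinv' i).2.2.1 hi hia).1
    refine ⟨Function.update k j (t + 1), ?_, ?_, fun i => ?_⟩
    · funext i
      rcases eq_or_ne i j with rfl | hij
      · simp only [Function.update_self, bw, hSk, hkj]; ring
      · simp [Function.update_of_ne hij, bw, hSk]
    · intro i
      rcases eq_or_ne i j with rfl | hij
      · simp only [Function.update_self]
        exact ⟨by omega, fun h => by omega⟩
      · simpa [Function.update_of_ne hij] using hk i
    · rcases eq_or_ne i j with rfl | hij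
      · simp only [Function.update_self, Finset.mem_insert_self, not_true_eq_false]
        exact ⟨fun _ _ h => h.elim, fun _ _ _ => trivial, fun _ h => (h ha).elim,
          fun h => by omega⟩
      · simpa [Function.update_of_ne hij, Finset.mem_insert, hij] using hinv i
  · rw [if_neg hlarge]
    refine ⟨k, hSk, hk, fun i => ?_⟩
    rcases eq_or_ne i j with rfl | hij
    · have hA : (i : ℕ) < r → A ≤ k i ∧ k i ≤ t := by
        intro hir
        have hkj : k i = t := (hinv i).1 hir ha hj
        have hkj' : k' i = t := (hinv' i).1 hir (hact ha) hjd'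
        refine ⟨?_, hkj.le⟩
        by_contra hcon
        refine hlarge ?_
        rw [hSk']
        exact hg.shrink k' hk' i hir (by omega) (fun l => by rw [hkj']; exact hle l)
      simp only [Finset.mem_erase, ne_eq, not_true_eq_false, false_and, not_false_eq_true,
        forall_true_left]
      exact ⟨fun _ h => h.elim, fun _ h => h.elim, hA, fun _ h => h.elim⟩
    · simpa [Finset.mem_insert, hij] using hinv i

/-- A whole pass preserves the invariant. -/
lemma PassInv.sweep (hAT : A ≤ T) (hg : GoodTests r A T β b₀ large) {t : ℕ} (htT : t ≤ T)
    (mode : Mode) {S : State d} (hS : PassInv r A T β b₀ t ∅ S) :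
    PassInv r A T β b₀ t Finset.univ (sweep mode β large S) := by
  classical
  have key : ∀ (l : List (Fin d)) (done : Finset (Fin d)) (cur : State d), l.Nodup →
      (∀ j ∈ l, j ∉ done) → (∀ j ∉ done, j ∈ cur.active → j ∈ S.active) →
      PassInv r A T β b₀ t done cur →
      PassInv r A T β b₀ t (done ∪ l.toFinset) (l.foldl (fun cur j =>
        Rodeo.visit β (large (match mode with
          | .simultaneous => S.h
          | .sequential => cur.h) j) j cur) cur) := by
    intro l
    induction l with
    | nil => intro done cur _ _ _ h; simpa using h
    | cons j l ih =>
      intro done cur hnd hdone hact hcur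
      rw [List.foldl_cons]
      have hjl : j ∉ l := (List.nodup_cons.mp hnd).1
      have hset : done ∪ (j :: l).toFinset = insert j done ∪ l.toFinset := by
        ext i; simp
      rw [hset]
      have hjd : j ∉ done := hdone j (by simp)
      refine ih _ _ (List.nodup_cons.mp hnd).2 ?_ ?_ ?_
      · intro i hi hid
        rcases Finset.mem_insert.mp hid with rfl | h
        · exact hjl hi
        · exact hdone i (List.mem_cons_of_mem _ hi) h
      · intro i hi hia
        have hi' : i ∉ done := fun h => hi (Finset.mem_insert_of_mem h)
        refine hact i hi' ?_
        revert hia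
        unfold Rodeo.visit
        split_ifs
        · exact id
        · exact fun h => Finset.mem_of_mem_erase h
        · exact id
      · cases mode with
        | simultaneous =>
          exact PassInv.visit hAT hg htT hcur j hjd _
            ⟨∅, S, hS, rfl, Finset.notMem_empty _, hact j hjd⟩
        | sequential =>
          exact PassInv.visit hAT hg htT hcur j hjd _ ⟨done, cur, hcur, rfl, hjd, id⟩
  have := key (List.finRange d) ∅ S (List.nodup_finRange d) (by simp) (fun _ _ h => h) hS
  rw [Finset.empty_union, List.toFinset_finRange] at this
  exact this

lemma PassInv.next {t : ℕ} {S : State d} (hS : PassInv r A T β b₀ t Finset.univ S) :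
    PassInv r A T β b₀ (t + 1) ∅ S := by
  obtain ⟨k, hSk, hk, hinv⟩ := hS
  refine ⟨k, hSk, hk, fun i => ?_⟩
  obtain ⟨h1, h2, h3, h4⟩ := hinv i
  refine ⟨fun a b _ => h2 a b (Finset.mem_univ _), fun _ _ h => by simp at h, fun a b => ?_,
    fun a b => ((h4 a b).1 (Finset.mem_univ _)).elim⟩
  have := h3 a b
  omega

/-- If all tests behave as expected, then the selected bandwidths have been shrunk between `A` and
`T` times in the relevant coordinates, and never in the others. -/
lemma exists_config_of_goodTests (hAT : A ≤ T) (hg : GoodTests r A T β b₀ large) (mode : Mode) :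
    ∃ k : Fin d → ℕ, IsConfig r T k ∧ (∀ j : Fin d, (j : ℕ) < r → A ≤ k j) ∧
      ((sweep mode β large)^[sInf {t | ((sweep mode β large)^[t]
        { h := fun _ => b₀, active := Finset.univ }).active = ∅}]
          { h := fun _ => b₀, active := Finset.univ }).h = bw β b₀ k := by
  set S₀ : State d := { h := fun _ => b₀, active := Finset.univ } with hS₀
  have h0 : PassInv r A T β b₀ 0 ∅ S₀ := by
    refine ⟨fun _ => 0, ?_, fun j => ⟨Nat.zero_le _, fun _ => rfl⟩, fun j => ?_⟩
    · funext j; simp [bw, hS₀]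
    · simp [hS₀]
  have hpass : ∀ t, t ≤ T → PassInv r A T β b₀ t Finset.univ ((sweep mode β large)^[t + 1] S₀) ∧
      PassInv r A T β b₀ t ∅ ((sweep mode β large)^[t] S₀) := by
    intro t
    induction t with
    | zero => exact fun _ => ⟨h0.sweep hAT hg (Nat.zero_le _) mode, h0⟩
    | succ t ih =>
      intro ht
      have h1 := (ih (by omega)).1.next
      refine ⟨?_, h1⟩
      rw [Function.iterate_succ_apply']
      exact h1.sweep hAT hg ht mode
  have hend : ((sweep mode β large)^[T + 1] S₀).active = ∅ := by
    obtain ⟨k, -, hk, hinv⟩ := (hpass T le_rfl).1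
    refine Finset.eq_empty_of_forall_notMem fun j hj => ?_
    rcases lt_or_ge (j : ℕ) r with hr | hr
    · have h1 := (hinv j).2.1 hr hj (Finset.mem_univ _)
      have h2 := (hk j).1
      omega
    · exact ((hinv j).2.2.2 hr hj).1 (Finset.mem_univ _)
  set t₀ := sInf {t | ((sweep mode β large)^[t] S₀).active = ∅}
  have ht₀ : ((sweep mode β large)^[t₀] S₀).active = ∅ :=
    Nat.sInf_mem (s := {t | ((sweep mode β large)^[t] S₀).active = ∅}) ⟨T + 1, hend⟩
  have ht₀T : t₀ ≤ T + 1 := Nat.sInf_le hend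
  have hfin : ∃ t, PassInv r A T β b₀ t ∅ ((sweep mode β large)^[t₀] S₀) := by
    rcases Nat.lt_or_ge t₀ (T + 1) with h | h
    · exact ⟨t₀, (hpass t₀ (by omega)).2⟩
    · rw [le_antisymm ht₀T h]
      exact ⟨T + 1, (hpass T le_rfl).1.next⟩
  obtain ⟨t, k, hSk, hk, hinv⟩ := hfin
  exact ⟨k, hk, fun j hj => ((hinv j).2.2.1 hj (by simp [ht₀])).1, hSk⟩

end Algorithm

/-! ### The kernel and its bandwidth derivative -/

section Kernel

/-- The function `D(v) = -(v K'(v) + K(v))`, for which `∂/∂h (K(u/h)/h) = D(u/h)/h²`. -/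
def kerD (K : ℝ → ℝ) (v : ℝ) : ℝ := -(v * deriv K v + K v)

lemma hasDerivAt_scaled {K : ℝ → ℝ} {u h : ℝ} (hh : h ≠ 0) (hK : DifferentiableAt ℝ K (u / h)) :
    HasDerivAt (fun t => K (u / t) / t) (kerD K (u / h) / h / h) h := by
  have h1 : HasDerivAt (fun t : ℝ => u / t) (-u / h ^ 2) h := by
    have : HasDerivAt (fun t : ℝ => u / t) ((0 * id h - u * 1) / id h ^ 2) h :=
      (hasDerivAt_const h u).div (hasDerivAt_id h) hh
    exact this.congr_deriv (by simp)
  have h2 : HasDerivAt (fun t => K (u / t)) (deriv K (u / h) * (-u / h ^ 2)) h :=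
    HasDerivAt.comp h hK.hasDerivAt h1
  refine (h2.div (hasDerivAt_id h) hh).congr_deriv ?_
  simp only [id, kerD]
  field_simp
  ring

/-- Quantitative form of the conditions on the kernel: `S` bounds the support and `B` the size of
`K` and of `D = kerD K`. -/
structure KernelBounds (K : ℝ → ℝ) (S B : ℝ) : Prop where
  one_le_S : 1 ≤ S
  one_le_B : 1 ≤ B
  continuous : Continuous K
  K_zero : ∀ v, S ≤ |v| → K v = 0
  D_zero : ∀ v, S ≤ |v| → kerD K v = 0
  K_le : ∀ v, |K v| ≤ B
  D_le : ∀ v, |kerD K v| ≤ B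

lemma measurable_kerD {K : ℝ → ℝ} (hK : Continuous K) : Measurable (kerD K) :=
  ((measurable_id.mul (measurable_deriv K)).add hK.measurable).neg

lemma IsKernel.exists_bounds {K : ℝ → ℝ} (hK : IsKernel K) : ∃ S B, KernelBounds K S B := by
  obtain ⟨L, hL⟩ := hK.lipschitz
  have hc : Continuous K := hL.continuous
  obtain ⟨S₀, hS₀⟩ := hK.compactSupport.isBounded.exists_norm_le
  obtain ⟨B₀, hB₀⟩ := hc.bounded_above_of_compact_support hK.compactSupport
  set S := |S₀| + 1
  have hzero : ∀ v, S ≤ |v| → v ∉ tsupport K := fun v hv hmem => by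
    have h1 := hS₀ v hmem
    rw [Real.norm_eq_abs] at h1
    have h2 := le_abs_self S₀
    simp only [S] at hv
    linarith
  have hK0 : ∀ v, S ≤ |v| → K v = 0 := fun v hv => image_eq_zero_of_notMem_tsupport (hzero v hv)
  have hdK0 : ∀ v, S ≤ |v| → deriv K v = 0 := fun v hv => by
    have := (notMem_tsupport_iff_eventuallyEq.mp (hzero v hv)).deriv_eq
    rw [this]; simp
  have hD : ∀ v, S ≤ |v| → kerD K v = 0 := fun v hv => by simp [kerD, hK0 v hv, hdK0 v hv]
  have hS1 : 1 ≤ S := by simp [S]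
  refine ⟨S, |B₀| + S * L + 1, hS1, ?_, hc, hK0, hD, fun v => ?_, fun v => ?_⟩
  · have : 0 ≤ S * L := by positivity
    linarith [abs_nonneg B₀]
  · have h1 := hB₀ v
    rw [Real.norm_eq_abs] at h1
    have : 0 ≤ S * L := by positivity
    linarith [le_abs_self B₀]
  · rcases le_or_gt S |v| with h | h
    · rw [hD v h]
      have : 0 ≤ S * L := by positivity
      rw [abs_zero]; positivity
    · have h1 := hB₀ v
      rw [Real.norm_eq_abs] at h1
      have h2 : |deriv K v| ≤ L := by
        rw [← Real.norm_eq_abs]; exact norm_deriv_le_of_lipschitz hL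
      rw [kerD, abs_neg]
      refine (abs_add_le _ _).trans ?_
      rw [abs_mul]
      have h3 : |v| * |deriv K v| ≤ S * L := mul_le_mul h.le h2 (abs_nonneg _) (by linarith)
      linarith [le_abs_self B₀]

lemma integrable_of_bounded_support {a : ℝ → ℝ} {S B : ℝ} (ha : Measurable a)
    (h0 : ∀ v, S ≤ |v| → a v = 0) (hB : ∀ v, |a v| ≤ B) : Integrable a := by
  have h1 : Integrable ((Set.Icc (-S) S).indicator fun _ => B) := by
    rw [integrable_indicator_iff measurableSet_Icc]
    exact integrableOn_const (by simp)
  refine h1.mono' ha.aestronglyMeasurable (Eventually.of_forall fun v => ?_)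
  rw [Real.norm_eq_abs]
  by_cases hv : v ∈ Set.Icc (-S) S
  · rw [Set.indicator_of_mem hv]; exact hB v
  · rw [Set.indicator_of_notMem hv, h0 v, abs_zero]
    by_contra hcon
    exact hv (abs_le.mp (not_le.mp hcon).le)

/-- The moments of `D` are obtained from those of `K` by differentiating
`h ↦ ∫ u ^ α K(u / h) / h du = h ^ α ∫ u ^ α K(u) du` at `h = 1`. -/
lemma integral_pow_mul_kerD {K : ℝ → ℝ} {S B : ℝ} (hb : KernelBounds K S B) {L : ℝ≥0}
    (hL : LipschitzWith L K) (α : ℕ) :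
    ∫ v, v ^ α * kerD K v = α * ∫ v, v ^ α * K v := by
  have hS0 : 0 < S := lt_of_lt_of_le one_pos hb.one_le_S
  have hB0 : 0 < B := lt_of_lt_of_le one_pos hb.one_le_B
  have hF : ∀ h : ℝ, 0 < h → ∫ u, u ^ α * (K (u / h) / h) = h ^ α * ∫ v, v ^ α * K v := by
    intro h hh
    have h1 := Measure.integral_comp_div (fun v => h ^ α * (v ^ α * K v) / h) h
    have h2 : ∀ u : ℝ, h ^ α * ((u / h) ^ α * K (u / h)) / h = u ^ α * (K (u / h) / h) := by
      intro u
      rw [div_pow]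
      have : h ^ α ≠ 0 := (pow_pos hh α).ne'
      field_simp
    simp only [h2] at h1
    rw [h1, abs_of_pos hh, integral_div, integral_const_mul, smul_eq_mul]
    field_simp
  have hd := hasDerivAt_integral_of_dominated_loc_of_lip (μ := (volume : Measure ℝ))
    (F := fun h u => u ^ α * (K (u / h) / h)) (F' := fun u => u ^ α * kerD K u) (x₀ := (1 : ℝ))
    (s := Metric.ball 1 (1 / 2))
    (bound := (Set.Icc (-(2 * S)) (2 * S)).indicator fun _ =>
      (2 * S) ^ α * (4 * B + 16 * L * S))
    (Metric.ball_mem_nhds _ (by norm_num)) ?_ ?_ ?_ ?_ ?_ ?_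
  · have h1 : HasDerivAt (fun h : ℝ => h ^ α * ∫ v, v ^ α * K v) (α * ∫ v, v ^ α * K v) 1 := by
      have := (hasDerivAt_pow α (1 : ℝ)).mul_const (∫ v, v ^ α * K v)
      simpa using this
    have h2 : (fun h : ℝ => h ^ α * ∫ v, v ^ α * K v) =ᶠ[nhds 1]
        fun h => ∫ u, u ^ α * (K (u / h) / h) := by
      filter_upwards [lt_mem_nhds (zero_lt_one' ℝ)] with h hh using (hF h hh).symm
    exact (hd.2.congr_of_eventuallyEq h2).unique h1
  · filter_upwards with h
    have := hb.continuous
    exact (by fun_prop : Measurable fun u => u ^ α * (K (u / h) / h)).aestronglyMeasurable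
  · refine integrable_of_bounded_support (S := S) (B := S ^ α * B) ?_ ?_ ?_
    · have := hb.continuous
      fun_prop
    · intro v hv; simp [hb.K_zero v hv]
    · intro v
      rcases le_or_gt S |v| with h | h
      · simp only [div_one, hb.K_zero v h, mul_zero, abs_zero]; positivity
      · rw [div_one, div_one, abs_mul, abs_pow]
        exact mul_le_mul (pow_le_pow_left₀ (abs_nonneg _) h.le _) (hb.K_le v) (abs_nonneg _)
          (by positivity)
  · exact ((measurable_id.pow_const α).mul (measurable_kerD hb.continuous)).aestronglyMeasurable
  · filter_upwards with u
    have hball : ∀ h ∈ Metric.ball (1 : ℝ) (1 / 2), 1 / 2 < h ∧ h < 3 / 2 := by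
      intro h hh
      rw [Metric.mem_ball, Real.dist_eq, abs_lt] at hh
      constructor <;> linarith [hh.1, hh.2]
    by_cases hu : u ∈ Set.Icc (-(2 * S)) (2 * S)
    · rw [Set.indicator_of_mem hu]
      have hu' : |u| ≤ 2 * S := abs_le.mpr hu
      have hC : 0 ≤ (2 * S) ^ α * (4 * B + 16 * L * S) := by positivity
      refine LipschitzOnWith.of_dist_le_mul fun h hh h' hh' => ?_
      obtain ⟨h1, -⟩ := hball h hh
      obtain ⟨h2, -⟩ := hball h' hh'
      rw [Real.dist_eq, Real.dist_eq, Real.coe_nnabs, abs_of_nonneg hC, ← mul_sub, abs_mul,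
        abs_pow, mul_assoc]
      refine mul_le_mul (pow_le_pow_left₀ (abs_nonneg _) hu' _) ?_ (abs_nonneg _) (by positivity)
      have hi : |1 / h - 1 / h'| ≤ 4 * |h - h'| := by
        rw [div_sub_div _ _ (by linarith) (by linarith), abs_div, one_mul, mul_one, abs_sub_comm h' h,
          abs_of_pos (by nlinarith : 0 < h * h'), div_le_iff₀ (by nlinarith)]
        have : 1 ≤ 4 * (h * h') := by nlinarith
        nlinarith [mul_le_mul_of_nonneg_left this (abs_nonneg (h - h'))]
      have e1 : K (u / h) / h - K (u / h') / h' =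
          K (u / h) * (1 / h - 1 / h') + (K (u / h) - K (u / h')) * (1 / h') := by ring
      have e2 : |K (u / h) - K (u / h')| ≤ L * (2 * S * (4 * |h - h'|)) := by
        have := hL.dist_le_mul (u / h) (u / h')
        rw [Real.dist_eq, Real.dist_eq] at this
        refine this.trans (mul_le_mul_of_nonneg_left ?_ L.coe_nonneg)
        have : u / h - u / h' = u * (1 / h - 1 / h') := by ring
        rw [this, abs_mul]
        exact mul_le_mul hu' hi (abs_nonneg _) (by positivity)
      have e3 : |1 / h'| ≤ 2 := by
        rw [abs_of_pos (by positivity), div_le_iff₀ (by linarith)]; linarith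
      rw [e1]
      refine (abs_add_le _ _).trans ?_
      rw [abs_mul, abs_mul]
      have e4 := mul_le_mul (hb.K_le (u / h)) hi (abs_nonneg _) hB0.le
      have e5 := mul_le_mul e2 e3 (abs_nonneg _) (by positivity)
      linarith
    · rw [Set.indicator_of_notMem hu]
      refine LipschitzOnWith.of_dist_le_mul fun h hh h' hh' => ?_
      have hz : ∀ h ∈ Metric.ball (1 : ℝ) (1 / 2), K (u / h) = 0 := by
        intro h hh
        obtain ⟨h1, h2⟩ := hball h hh
        refine hb.K_zero _ ?_
        have hu' : 2 * S < |u| := by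
          by_contra hcon
          exact hu (abs_le.mp (not_lt.mp hcon))
        rw [abs_div, abs_of_pos (by linarith : 0 < h), le_div_iff₀ (by linarith)]
        nlinarith
      simp [hz h hh, hz h' hh']
  · rw [integrable_indicator_iff measurableSet_Icc]
    exact integrableOn_const (by simp)
  · filter_upwards [hL.ae_differentiableAt] with u hu
    have := (hasDerivAt_scaled (K := K) (u := u) one_ne_zero (by simpa using hu)).const_mul (u ^ α)
    simpa using this

/-- The constants of the kernel that the analysis uses: the moments of `K` and `D` of order up to
two, and their squared `L²` norms `κ`, `κ'`. -/
structure KernelMoments (K : ℝ → ℝ) (ν κ κ' : ℝ) : Prop where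
  K0 : ∫ v, K v = 1
  K1 : ∫ v, v * K v = 0
  K2 : ∫ v, v ^ 2 * K v = ν
  D0 : ∫ v, kerD K v = 0
  D1 : ∫ v, v * kerD K v = 0
  D2 : ∫ v, v ^ 2 * kerD K v = 2 * ν
  ν_ne : ν ≠ 0
  Ksq : ∫ v, K v ^ 2 = κ
  Dsq : ∫ v, kerD K v ^ 2 = κ'
  κ_pos : 0 < κ
  κ'_pos : 0 < κ'

/-- A function with a nonzero weighted integral has a positive squared norm. -/
lemma integral_sq_pos {a : ℝ → ℝ} {S B : ℝ} (ha : Measurable a) (h0 : ∀ v, S ≤ |v| → a v = 0)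
    (hB : ∀ v, |a v| ≤ B) (b : ℝ → ℝ) (hne : ∫ v, b v * a v ≠ 0) : 0 < ∫ v, a v ^ 2 := by
  have hB0 : 0 ≤ B := (abs_nonneg _).trans (hB 0)
  have hi : Integrable fun v => a v ^ 2 := by
    refine integrable_of_bounded_support (S := S) (B := B ^ 2) (ha.pow_const 2)
      (fun v hv => by simp [h0 v hv]) fun v => ?_
    rw [abs_pow]
    exact pow_le_pow_left₀ (abs_nonneg _) (hB v) 2
  refine lt_of_le_of_ne (integral_nonneg fun v => sq_nonneg _) fun h => hne ?_
  have h1 := (integral_eq_zero_iff_of_nonneg (fun v => sq_nonneg (a v)) hi).mp h.symm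
  have h2 : (fun v => b v * a v) =ᵐ[volume] 0 := by
    filter_upwards [h1] with v hv
    have : a v = 0 := by simpa using hv
    simp [this]
  rw [integral_congr_ae h2]; simp

lemma IsKernel.exists_moments {K : ℝ → ℝ} (hK : IsKernel K) :
    ∃ ν κ κ', KernelMoments K ν κ κ' := by
  obtain ⟨L, hL⟩ := hK.lipschitz
  obtain ⟨S, B, hb⟩ := hK.exists_bounds
  have hm := integral_pow_mul_kerD hb hL
  have hK1 : ∫ v, v * K v = 0 := by simpa using hK.odd_moments 1 (by decide)
  have hD0 : ∫ v, kerD K v = 0 := by simpa using hm 0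
  have hD1 : ∫ v, v * kerD K v = 0 := by simpa [hK1] using hm 1
  have hD2 : ∫ v, v ^ 2 * kerD K v = 2 * ∫ v, v ^ 2 * K v := by simpa using hm 2
  refine ⟨∫ v, v ^ 2 * K v, _, _, hK.integral_eq_one, hK1, rfl, hD0, hD1, hD2, hK.second_moment,
    rfl, rfl, ?_, ?_⟩
  · exact integral_sq_pos hb.continuous.measurable hb.K_zero hb.K_le (fun v => v ^ 2)
      hK.second_moment
  · refine integral_sq_pos (measurable_kerD hb.continuous) hb.D_zero hb.D_le (fun v => v ^ 2) ?_
    rw [hD2]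
    exact mul_ne_zero two_ne_zero hK.second_moment

end Kernel

/-! ### Expectations of kernel products under the uniform design -/

section Expectation

/-- The uniform distribution on `[0, 1]`. -/
def unitMeasure : Measure ℝ := volume.restrict (Set.Icc 0 1)

instance : IsProbabilityMeasure unitMeasure :=
  ⟨by simp [unitMeasure]⟩

lemma uniformCube_eq_pi (d : ℕ) : uniformCube d = Measure.pi fun _ => unitMeasure := by
  rw [uniformCube, volume_pi, Measure.restrict_pi_pi]
  rfl

instance (d : ℕ) : IsProbabilityMeasure (uniformCube d) := by
  rw [uniformCube_eq_pi]; infer_instance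

lemma integral_unitMeasure_scaled {a : ℝ → ℝ} {S x h : ℝ} (hh : 0 < h)
    (h0 : ∀ v, S ≤ |v| → a v = 0) (hl : 0 ≤ x - S * h) (hr : x + S * h ≤ 1) :
    ∫ u, a ((u - x) / h) / h ∂unitMeasure = ∫ v, a v := by
  rw [unitMeasure, setIntegral_eq_integral_of_forall_compl_eq_zero]
  · rw [integral_sub_right_eq_self (fun u => a (u / h) / h) x, integral_div,
      Measure.integral_comp_div, abs_of_pos hh, smul_eq_mul]
    field_simp
  · intro u hu
    rw [h0, zero_div]
    rw [abs_div, abs_of_pos hh, le_div_iff₀ hh]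
    by_contra hcon
    rw [not_le, abs_lt] at hcon
    exact hu ⟨by linarith [hcon.1], by linarith [hcon.2]⟩

/-- Integrating out the coordinates on which `φ` does not depend: they contribute the product of the
integrals of their factors. -/
lemma exists_integral_prod_mul {ι : Type*} [Fintype ι] (μ : ι → Measure ℝ)
    [∀ i, IsProbabilityMeasure (μ i)] (p : ι → Prop) [DecidablePred p] (g : ι → ℝ → ℝ)
    (hg : ∀ i, Integrable (g i) (μ i)) (φ : (ι → ℝ) → ℝ)
    (hφ : ∀ u v, (∀ i, p i → u i = v i) → φ u = φ v) {C : ℝ} (hC : ∀ u, |φ u| ≤ C) :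
    ∃ I, ∫ u, (∏ i, g i (u i)) * φ u ∂Measure.pi μ = (∏ i : {i // ¬ p i}, ∫ v, g i v ∂μ i) * I ∧
      |I| ≤ C * ∏ i : {i // p i}, ∫ v, |g i v| ∂μ i := by
  classical
  set e := MeasurableEquiv.piEquivPiSubtypeProd (fun _ : ι => ℝ) p with he
  have hmp := measurePreserving_piEquivPiSubtypeProd μ p
  set ψ : ({i // p i} → ℝ) → ℝ := fun y => (∏ i : {i // p i}, g i (y i)) * φ (e.symm (y, 0)) with hψ
  have h1 : ∀ u : ι → ℝ, (∏ i, g i (u i)) * φ u =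
      (fun y : ({i // p i} → ℝ) × ({i // ¬ p i} → ℝ) => ψ y.1 * ∏ i : {i // ¬ p i}, g i (y.2 i)) (e u) := by
    intro u
    have hs : φ (e.symm ((e u).1, 0)) = φ u := by
      refine hφ _ _ fun i hi => ?_
      simp [he, MeasurableEquiv.piEquivPiSubtypeProd, Equiv.piEquivPiSubtypeProd, hi]
    have hp : ∏ i, g i (u i) = (∏ i : {i // p i}, g i (u i)) * ∏ i : {i // ¬ p i}, g i (u i) :=
      (Fintype.prod_subtype_mul_prod_subtype p fun i => g i (u i)).symm
    simp only [hψ, hs, hp]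
    have e1 : ∀ i : {i // p i}, (e u).1 i = u i := fun i => rfl
    have e2 : ∀ i : {i // ¬ p i}, (e u).2 i = u i := fun i => rfl
    simp only [e1, e2]
    ring
  refine ⟨∫ y, ψ y ∂Measure.pi fun i : {i // p i} => μ i, ?_, ?_⟩
  · rw [integral_congr_ae (Eventually.of_forall h1)]
    refine (hmp.integral_comp' (fun y : ({i // p i} → ℝ) × ({i // ¬ p i} → ℝ) =>
      ψ y.1 * ∏ i : {i // ¬ p i}, g i (y.2 i))).trans ?_
    rw [integral_prod_mul ψ fun z : {i // ¬ p i} → ℝ => ∏ i : {i // ¬ p i}, g i (z i),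
      integral_fintype_prod_eq_prod (fun i : {i // ¬ p i} => g i), mul_comm]
  · have h2 : C * ∏ i : {i // p i}, ∫ v, |g i v| ∂μ i =
        ∫ y, C * ∏ i : {i // p i}, |g i (y i)| ∂Measure.pi fun i : {i // p i} => μ i := by
      rw [integral_const_mul, integral_fintype_prod_eq_prod (fun (i : {i // p i}) v => |g i v|)]
    rw [h2, ← Real.norm_eq_abs]
    refine norm_integral_le_of_norm_le ?_ (Eventually.of_forall fun y => ?_)
    · exact (Integrable.fintype_prod fun i : {i // p i} => (hg i).abs).const_mul C
    · simp only [hψ]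
      rw [Real.norm_eq_abs, abs_mul, Finset.abs_prod, mul_comm]
      exact mul_le_mul_of_nonneg_right (hC _) (Finset.prod_nonneg fun _ _ => abs_nonneg _)

variable {d : ℕ}

/-- The one-dimensional factors of the product kernel (`J = none`) and of its derivative in the
`j`-th bandwidth (`J = some j`). -/
def kfac (K : ℝ → ℝ) (J : Option (Fin d)) (i : Fin d) : ℝ → ℝ :=
  if J = some i then kerD K else K

/-- The product kernel, with the `j`-th factor `K` replaced by `D` if `J = some j`. -/
def wt (K : ℝ → ℝ) (J : Option (Fin d)) (x h u : Fin d → ℝ) : ℝ :=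
  ∏ i, kfac K J i ((u i - x i) / h i) / h i

/-- The rescaled design row `(1, (u - x) / h)`. -/
def vrow (x h u : Fin d → ℝ) : Fin (d + 1) → ℝ :=
  Fin.cons 1 fun i => (u i - x i) / h i

/-- The exponent vector of the monomial `vrow · k`. -/
def expo (k : Fin (d + 1)) : Fin d → ℕ :=
  (Fin.cons 0 (fun i => Pi.single i 1) : Fin (d + 1) → Fin d → ℕ) k

/-- The box around `x` with half-widths `S h_j` lies in the open unit cube. -/
def InWindow (S : ℝ) (x h : Fin d → ℝ) : Prop :=
  ∀ i, 0 < h i ∧ 0 < x i - S * h i ∧ x i + S * h i < 1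

variable {K : ℝ → ℝ} {S B : ℝ} {x h : Fin d → ℝ}

lemma kfac_zero (hb : KernelBounds K S B) (J : Option (Fin d)) (i : Fin d) {v : ℝ}
    (hv : S ≤ |v|) : kfac K J i v = 0 := by
  unfold kfac; split_ifs
  exacts [hb.D_zero v hv, hb.K_zero v hv]

lemma kfac_le (hb : KernelBounds K S B) (J : Option (Fin d)) (i : Fin d) (v : ℝ) :
    |kfac K J i v| ≤ B := by
  unfold kfac; split_ifs
  exacts [hb.D_le v, hb.K_le v]

lemma measurable_kfac (hb : KernelBounds K S B) (J : Option (Fin d)) (i : Fin d) :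
    Measurable (kfac K J i) := by
  unfold kfac; split_ifs
  exacts [measurable_kerD hb.continuous, hb.continuous.measurable]

lemma measurable_wt (hb : KernelBounds K S B) (J : Option (Fin d)) (x h : Fin d → ℝ) :
    Measurable (wt K J x h) := by
  refine Finset.measurable_prod _ fun i _ => ?_
  exact ((measurable_kfac hb J i).comp (by fun_prop)).div_const _

lemma measurable_vrow (x h : Fin d → ℝ) (k : Fin (d + 1)) :
    Measurable fun u => vrow x h u k := by
  unfold vrow
  refine Fin.cases ?_ (fun i => ?_) k
  · simp
  · simp only [Fin.cons_succ]; fun_prop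

lemma abs_wt_le (hb : KernelBounds K S B) (hw : InWindow S x h) (J : Option (Fin d))
    (u : Fin d → ℝ) : |wt K J x h u| ≤ B ^ d / ∏ i, h i := by
  rw [wt, Finset.abs_prod]
  calc ∏ i, |kfac K J i ((u i - x i) / h i) / h i| ≤ ∏ i, B / h i := by
        refine Finset.prod_le_prod (fun _ _ => abs_nonneg _) fun i _ => ?_
        rw [abs_div, abs_of_pos (hw i).1]
        exact div_le_div_of_nonneg_right (kfac_le hb J i _) (hw i).1.le
    _ = _ := by rw [Finset.prod_div_distrib]; simp

lemma abs_lt_of_wt_ne_zero (hb : KernelBounds K S B) (hw : InWindow S x h)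
    {J : Option (Fin d)} {u : Fin d → ℝ} (hu : wt K J x h u ≠ 0) (i : Fin d) :
    |u i - x i| < S * h i := by
  by_contra hcon
  refine hu (Finset.prod_eq_zero (Finset.mem_univ i) ?_)
  rw [kfac_zero hb, zero_div]
  rw [abs_div, abs_of_pos (hw i).1, le_div_iff₀ (hw i).1]
  exact not_lt.mp hcon

lemma abs_vrow_le (hb : KernelBounds K S B) (hw : InWindow S x h)
    {J : Option (Fin d)} {u : Fin d → ℝ} (hu : wt K J x h u ≠ 0) (k : Fin (d + 1)) :
    |vrow x h u k| ≤ S := by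
  refine Fin.cases ?_ (fun i => ?_) k
  · simpa [vrow] using hb.one_le_S
  · simp only [vrow, Fin.cons_succ]
    rw [abs_div, abs_of_pos (hw i).1, div_le_iff₀ (hw i).1]
    exact (abs_lt_of_wt_ne_zero hb hw hu i).le

lemma vrow_eq_prod (u : Fin d → ℝ) (k : Fin (d + 1)) :
    vrow x h u k = ∏ i, ((u i - x i) / h i) ^ expo k i := by
  refine Fin.cases ?_ (fun j => ?_) k
  · simp [vrow, expo]
  · simp only [vrow, expo, Fin.cons_succ]
    rw [Finset.prod_eq_single j]
    · simp
    · intro i _ hij; simp [Pi.single_eq_of_ne hij]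
    · simp

/-- The one-dimensional moments of the factors. -/
def kmom (K : ℝ → ℝ) (J : Option (Fin d)) (α : ℕ) (i : Fin d) : ℝ :=
  ∫ v, v ^ α * kfac K J i v

lemma integrable_unitMeasure_of_bounded {f : ℝ → ℝ} {C : ℝ} (hf : Measurable f)
    (hC : ∀ v, |f v| ≤ C) : Integrable f unitMeasure :=
  Integrable.of_bound hf.aestronglyMeasurable C (Eventually.of_forall hC)

lemma abs_pow_mul_kfac_le (hb : KernelBounds K S B) (J : Option (Fin d)) (α : ℕ) (i : Fin d)
    (v : ℝ) : |v ^ α * kfac K J i v| ≤ S ^ α * B := by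
  have hS := hb.one_le_S
  have hB := hb.one_le_B
  rcases le_or_gt S |v| with hv | hv
  · rw [kfac_zero hb J i hv, mul_zero, abs_zero]; positivity
  · rw [abs_mul, abs_pow]
    exact mul_le_mul (pow_le_pow_left₀ (abs_nonneg _) hv.le _) (kfac_le hb J i v) (abs_nonneg _)
      (by positivity)

lemma integrable_factor (hb : KernelBounds K S B) (hw : InWindow S x h) (J : Option (Fin d))
    (α : ℕ) (i : Fin d) :
    Integrable (fun v => ((v - x i) / h i) ^ α * kfac K J i ((v - x i) / h i) / h i)
      unitMeasure := by
  have hm : Measurable fun v => ((v - x i) / h i) ^ α * kfac K J i ((v - x i) / h i) / h i := by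
    have := (measurable_kfac hb J i).comp (by fun_prop : Measurable fun v => (v - x i) / h i)
    exact ((by fun_prop : Measurable fun v => ((v - x i) / h i) ^ α).mul this).div_const _
  refine integrable_unitMeasure_of_bounded (C := S ^ α * B / h i) hm fun v => ?_
  rw [abs_div, abs_of_pos (hw i).1]
  exact div_le_div_of_nonneg_right (abs_pow_mul_kfac_le hb J α i _) (hw i).1.le

lemma integral_factor (hb : KernelBounds K S B) (hw : InWindow S x h) (J : Option (Fin d))
    (α : ℕ) (i : Fin d) :
    ∫ v, ((v - x i) / h i) ^ α * kfac K J i ((v - x i) / h i) / h i ∂unitMeasure =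
      kmom K J α i :=
  integral_unitMeasure_scaled (a := fun v => v ^ α * kfac K J i v) (S := S) (hw i).1
    (fun v hv => by simp [kfac_zero hb J i hv]) (hw i).2.1.le (hw i).2.2.le

lemma integral_abs_factor_le (hb : KernelBounds K S B) (hw : InWindow S x h)
    (J : Option (Fin d)) {α : ℕ} (hα : α ≤ 1) (i : Fin d) :
    ∫ v, |((v - x i) / h i) ^ α * kfac K J i ((v - x i) / h i) / h i| ∂unitMeasure ≤
      2 * S ^ 2 * B := by
  have hS := hb.one_le_S
  have hB := hb.one_le_B
  have h1 := integral_unitMeasure_scaled (a := fun v => |v ^ α * kfac K J i v|) (S := S) (hw i).1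
    (fun v hv => by simp [kfac_zero hb J i hv]) (hw i).2.1.le (hw i).2.2.le
  have h2 : ∀ v : ℝ, |((v - x i) / h i) ^ α * kfac K J i ((v - x i) / h i) / h i| =
      |((v - x i) / h i) ^ α * kfac K J i ((v - x i) / h i)| / h i := fun v => by
    rw [abs_div, abs_of_pos (hw i).1]
  simp_rw [h2]
  rw [h1, ← setIntegral_eq_integral_of_forall_compl_eq_zero (s := Set.Icc (-S) S)]
  · have h3 := norm_setIntegral_le_of_norm_le_const (μ := volume) (s := Set.Icc (-S) S)
      (f := fun v => |v ^ α * kfac K J i v|) (C := S * B) (by simp) (fun v _ => by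
        rw [Real.norm_eq_abs, abs_abs]
        refine (abs_pow_mul_kfac_le hb J α i v).trans ?_
        have : S ^ α ≤ S := (pow_le_pow_right₀ hS hα).trans_eq (pow_one S)
        gcongr)
    refine (le_abs_self _).trans (h3.trans_eq ?_)
    rw [Measure.real, Real.volume_Icc, ENNReal.toReal_ofReal (by linarith)]
    ring
  · intro v hv
    rw [kfac_zero hb J i, mul_zero, abs_zero]
    by_contra hcon
    exact hv (abs_le.mp (not_le.mp hcon).le)

lemma prod_factor_eq (J : Option (Fin d)) (α : Fin d → ℕ) (u : Fin d → ℝ) :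
    ∏ i, ((u i - x i) / h i) ^ α i * kfac K J i ((u i - x i) / h i) / h i =
      (∏ i, ((u i - x i) / h i) ^ α i) * wt K J x h u := by
  rw [wt, ← Finset.prod_mul_distrib]
  exact Finset.prod_congr rfl fun i _ => by ring

lemma integral_monomial_mul_wt (hb : KernelBounds K S B) (hw : InWindow S x h)
    (J : Option (Fin d)) (α : Fin d → ℕ) :
    ∫ u, (∏ i, ((u i - x i) / h i) ^ α i) * wt K J x h u ∂uniformCube d =
      ∏ i, kmom K J (α i) i := by
  simp_rw [← prod_factor_eq]
  rw [uniformCube_eq_pi, integral_fintype_prod_eq_prod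
    (fun i v => ((v - x i) / h i) ^ α i * kfac K J i ((v - x i) / h i) / h i)]
  exact Finset.prod_congr rfl fun i _ => integral_factor hb hw J (α i) i

/-- The expectation of the local Gram matrix (`J = none`) and of its rescaled derivative in the
`j`-th bandwidth (`J = some j`). -/
def popGram (ν : ℝ) (J : Option (Fin d)) : Matrix (Fin (d + 1)) (Fin (d + 1)) ℝ :=
  match J with
  | none => Matrix.diagonal (Fin.cons 1 fun _ => ν)
  | some j => Matrix.single j.succ j.succ (2 * ν)

variable {ν κ κ' : ℝ}

lemma kmom_none (hm : KernelMoments K ν κ κ') (i : Fin d) :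
    kmom K none 0 i = 1 ∧ kmom K none 1 i = 0 ∧ kmom K none 2 i = ν := by
  simp [kmom, kfac, hm.K0, hm.K1, hm.K2]

lemma kmom_some_self (hm : KernelMoments K ν κ κ') (i : Fin d) :
    kmom K (some i) 0 i = 0 ∧ kmom K (some i) 1 i = 0 ∧ kmom K (some i) 2 i = 2 * ν := by
  simp [kmom, kfac, hm.D0, hm.D1, hm.D2]

lemma kmom_some_of_ne (hm : KernelMoments K ν κ κ') {i j : Fin d} (hij : j ≠ i) :
    kmom K (some j) 0 i = 1 ∧ kmom K (some j) 1 i = 0 ∧ kmom K (some j) 2 i = ν := by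
  simp [kmom, kfac, hm.K0, hm.K1, hm.K2, hij]

lemma kmom_one (hm : KernelMoments K ν κ κ') (J : Option (Fin d)) (i : Fin d) :
    kmom K J 1 i = 0 := by
  rcases J with _ | j
  · exact (kmom_none hm i).2.1
  · rcases eq_or_ne j i with rfl | hij
    · exact (kmom_some_self hm j).2.1
    · exact (kmom_some_of_ne hm hij).2.1

lemma expo_succ (j i : Fin d) : expo j.succ i = if i = j then 1 else 0 := by
  simp [expo, Pi.single_apply]

lemma expo_le_one (k : Fin (d + 1)) (i : Fin d) : expo k i ≤ 1 := by
  refine Fin.cases ?_ (fun j => ?_) k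
  · simp [expo]
  · rw [expo_succ]; split_ifs <;> simp

lemma integral_vrow_vrow_wt (hb : KernelBounds K S B) (hm : KernelMoments K ν κ κ')
    (hw : InWindow S x h) (J : Option (Fin d)) (k l : Fin (d + 1)) :
    ∫ u, vrow x h u k * vrow x h u l * wt K J x h u ∂uniformCube d = popGram ν J k l := by
  have h1 : ∀ u, vrow x h u k * vrow x h u l * wt K J x h u =
      (∏ i, ((u i - x i) / h i) ^ (expo k i + expo l i)) * wt K J x h u := by
    intro u
    rw [vrow_eq_prod, vrow_eq_prod, ← Finset.prod_mul_distrib]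
    simp_rw [pow_add]
  simp_rw [h1]
  rw [integral_monomial_mul_wt hb hw J fun i => expo k i + expo l i]
  by_cases hkl : k = l
  · subst hkl
    refine Fin.cases ?_ (fun a => ?_) k
    · -- both exponents vanish
      rcases J with _ | j
      · simp [popGram, expo, (kmom_none hm _).1]
      · rw [Finset.prod_eq_zero (Finset.mem_univ j)
          (by simpa [expo] using (kmom_some_self hm j).1)]
        simp [popGram, Fin.succ_ne_zero]
    · rcases J with _ | j
      · rw [Finset.prod_eq_single a]
        · simp [popGram, expo_succ, (kmom_none hm a).2.2]
        · intro i _ hia; simp [expo_succ, hia, (kmom_none hm i).1]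
        · simp
      · rcases eq_or_ne a j with rfl | haj
        · rw [Finset.prod_eq_single a]
          · simp [popGram, expo_succ, (kmom_some_self hm a).2.2]
          · intro i _ hia; simp [expo_succ, hia, (kmom_some_of_ne hm hia.symm).1]
          · simp
        · rw [Finset.prod_eq_zero (Finset.mem_univ j)
            (by simpa [expo_succ, haj.symm] using (kmom_some_self hm j).1)]
          simp [popGram, haj.symm]
  · -- some exponent equals one
    have hex : ∃ a, expo k a + expo l a = 1 := by
      by_cases hk : k = 0
      · obtain ⟨a, rfl⟩ := Fin.exists_succ_eq.mpr (fun hl : l = 0 => hkl (hk.trans hl.symm))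
        exact ⟨a, by simp [hk, expo]⟩
      · obtain ⟨a, rfl⟩ := Fin.exists_succ_eq.mpr hk
        refine ⟨a, ?_⟩
        by_cases hl : l = 0
        · simp [hl, expo]
        · obtain ⟨b, rfl⟩ := Fin.exists_succ_eq.mpr hl
          have hab : a ≠ b := fun h => hkl (by rw [h])
          simp [expo_succ, hab]
    obtain ⟨a, ha⟩ := hex
    rw [Finset.prod_eq_zero (Finset.mem_univ a) (by rw [ha]; exact kmom_one hm J a)]
    rcases J with _ | j
    · simp [popGram, hkl]
    · rw [popGram, Matrix.single_apply_of_ne]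
      rintro ⟨rfl, rfl⟩
      exact hkl rfl

/-- The second moment of the weights. Replacing one factor `K` by `D` changes it by the ratio
`κ' / κ` of the squared norms. -/
lemma integral_wt_sq (hb : KernelBounds K S B) (hm : KernelMoments K ν κ κ')
    (hw : InWindow S x h) (J : Option (Fin d)) :
    min 1 (κ' / κ) * (κ ^ d / ∏ i, h i) ≤ ∫ u, wt K J x h u ^ 2 ∂uniformCube d ∧
      ∫ u, wt K J x h u ^ 2 ∂uniformCube d ≤ max 1 (κ' / κ) * (κ ^ d / ∏ i, h i) := by
  have hp : 0 < ∏ i, h i := Finset.prod_pos fun i _ => (hw i).1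
  have hκ := hm.κ_pos
  have hval : ∫ u, wt K J x h u ^ 2 ∂uniformCube d =
      (∏ i, ∫ v, kfac K J i v ^ 2) / ∏ i, h i := by
    have h1 : ∀ u, wt K J x h u ^ 2 =
        ∏ i, (kfac K J i ((u i - x i) / h i) ^ 2 / h i) / h i := by
      intro u
      rw [wt, ← Finset.prod_pow]
      refine Finset.prod_congr rfl fun i _ => ?_
      rw [div_pow, sq (h i), div_div]
    simp_rw [h1]
    rw [uniformCube_eq_pi, integral_fintype_prod_eq_prod
      (fun i v => (kfac K J i ((v - x i) / h i) ^ 2 / h i) / h i), ← Finset.prod_div_distrib]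
    refine Finset.prod_congr rfl fun i _ => ?_
    rw [integral_div, integral_unitMeasure_scaled (a := fun v => kfac K J i v ^ 2) (S := S) (hw i).1
      (fun v hv => by simp [kfac_zero hb J i hv]) (hw i).2.1.le (hw i).2.2.le]
  rw [hval]
  rcases J with _ | j
  · have h2 : ∏ i : Fin d, ∫ v, kfac K none i v ^ 2 = κ ^ d := by
      simp [kfac, hm.Ksq]
    rw [h2]
    have h3 : 0 < κ ^ d / ∏ i, h i := div_pos (pow_pos hκ d) hp
    exact ⟨mul_le_of_le_one_left h3.le (min_le_left _ _), le_mul_of_one_le_left h3.le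
      (le_max_left _ _)⟩
  · have h2 : ∏ i : Fin d, ∫ v, kfac K (some j) i v ^ 2 = κ' / κ * κ ^ d := by
      have : ∀ i : Fin d, ∫ v, kfac K (some j) i v ^ 2 = (if j = i then κ' / κ else 1) * κ := by
        intro i
        by_cases hij : j = i
        · subst hij
          simp only [kfac, if_true, hm.Dsq]
          field_simp
        · simp [kfac, hij, hm.Ksq]
      simp_rw [this]
      rw [Finset.prod_mul_distrib]
      simp
    rw [h2, mul_div_assoc]
    have h3 : 0 < κ ^ d / ∏ i, h i := div_pos (pow_pos hκ d) hp
    exact ⟨mul_le_mul_of_nonneg_right (min_le_right _ _) h3.le,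
      mul_le_mul_of_nonneg_right (le_max_right _ _) h3.le⟩

/-- `φ` is a bounded measurable function of the first `r` coordinates. -/
structure IsFirstCoords (r : ℕ) (φ : (Fin d → ℝ) → ℝ) (C : ℝ) : Prop where
  measurable : Measurable φ
  depends : ∀ u v : Fin d → ℝ, (∀ i : Fin d, (i : ℕ) < r → u i = v i) → φ u = φ v
  bound : ∀ u, |φ u| ≤ C

lemma integral_vrow_wt_mul_eq (u : Fin d → ℝ) (J : Option (Fin d)) (k : Fin (d + 1)) (y : ℝ) :
    vrow x h u k * wt K J x h u * y = (∏ i, (fun v => ((v - x i) / h i) ^ expo k i *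
      kfac K J i ((v - x i) / h i) / h i) (u i)) * y := by
  simp only
  rw [prod_factor_eq (x := x) (h := h) J (expo k) u, vrow_eq_prod]

/-- The expectation of a weighted function of the first `r` coordinates. It vanishes if the monomial
`vrow · k` or the bandwidth derivative `J` refers to another coordinate, since the factor of that
coordinate integrates to zero. The bound depends on `r` and not on `d`. -/
lemma abs_integral_vrow_wt_mul_le (hb : KernelBounds K S B) (hm : KernelMoments K ν κ κ')
    (hw : InWindow S x h) {r : ℕ} {φ : (Fin d → ℝ) → ℝ} {C : ℝ} (hφ : IsFirstCoords r φ C)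
    (J : Option (Fin d)) (k : Fin (d + 1)) :
    |∫ u, vrow x h u k * wt K J x h u * φ u ∂uniformCube d| ≤ C * (2 * S ^ 2 * B) ^ r ∧
      (((∃ i : Fin d, r ≤ (i : ℕ) ∧ k = i.succ) ∨ (∃ j : Fin d, r ≤ (j : ℕ) ∧ J = some j)) →
        ∫ u, vrow x h u k * wt K J x h u * φ u ∂uniformCube d = 0) := by
  have hC0 : 0 ≤ C := (abs_nonneg _).trans (hφ.bound 0)
  have hS := hb.one_le_S
  have hB := hb.one_le_B
  have hG : 1 ≤ 2 * S ^ 2 * B := by nlinarith [one_le_pow₀ (n := 2) hS]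
  obtain ⟨I, hI, hIle⟩ := exists_integral_prod_mul (fun _ : Fin d => unitMeasure)
    (fun i : Fin d => (i : ℕ) < r)
    (fun i v => ((v - x i) / h i) ^ expo k i * kfac K J i ((v - x i) / h i) / h i)
    (fun i => integrable_factor hb hw J _ i) φ hφ.depends hφ.bound
  simp_rw [integral_vrow_wt_mul_eq]
  rw [uniformCube_eq_pi, hI]
  simp_rw [integral_factor hb hw]
  have hI' : |I| ≤ C * (2 * S ^ 2 * B) ^ r := by
    refine hIle.trans (mul_le_mul_of_nonneg_left ?_ hC0)
    refine (Finset.prod_le_prod (fun _ _ => integral_nonneg fun _ => abs_nonneg _) fun i _ =>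
      integral_abs_factor_le hb hw J (expo_le_one k i.1) i.1).trans ?_
    rw [Finset.prod_const]
    refine pow_le_pow_right₀ hG ?_
    rw [Finset.card_univ]
    have := Fintype.card_le_of_injective (fun i : {i : Fin d // (i : ℕ) < r} =>
      (⟨i.1, i.2⟩ : Fin r)) (fun a b hab => by
        have : (a.1 : ℕ) = b.1 := by simpa using hab
        exact Subtype.ext (Fin.ext this))
    simpa using this
  have hzero : ((∃ i : Fin d, r ≤ (i : ℕ) ∧ k = i.succ) ∨
      (∃ j : Fin d, r ≤ (j : ℕ) ∧ J = some j)) →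
      ∏ i : {i : Fin d // ¬ (i : ℕ) < r}, kmom K J (expo k i.1) i.1 = 0 := by
    rintro (⟨i, hi, rfl⟩ | ⟨j, hj, rfl⟩)
    · refine Finset.prod_eq_zero (Finset.mem_univ ⟨i, not_lt.mpr hi⟩) ?_
      simpa [expo_succ] using kmom_one hm J i
    · refine Finset.prod_eq_zero (Finset.mem_univ ⟨j, not_lt.mpr hj⟩) ?_
      have h1 := expo_le_one k j
      interval_cases he : expo k j
      · exact (kmom_some_self hm j).1
      · exact (kmom_some_self hm j).2.1
  refine ⟨?_, fun hc => by rw [hzero hc, zero_mul]⟩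
  by_cases hc : (∃ i : Fin d, r ≤ (i : ℕ) ∧ k = i.succ) ∨ (∃ j : Fin d, r ≤ (j : ℕ) ∧ J = some j)
  · rw [hzero hc, zero_mul, abs_zero]; positivity
  · push Not at hc
    have h1 : ∏ i : {i : Fin d // ¬ (i : ℕ) < r}, kmom K J (expo k i.1) i.1 = 1 := by
      refine Finset.prod_eq_one fun i _ => ?_
      have hir := not_lt.mp i.2
      have he : expo k i.1 = 0 := by
        revert hc
        refine Fin.cases (fun _ => rfl) (fun a hc => ?_) k
        have hai : i.1 ≠ a := fun hia => hc.1 i.1 hir (by rw [hia])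
        simp [expo_succ, hai]
      rw [he]
      rcases J with _ | j
      · exact (kmom_none hm _).1
      · refine (kmom_some_of_ne hm fun hji => hc.2 i.1 hir ?_).1
        rw [hji]
    rw [h1, one_mul]; exact hI'

/-- The moments of `D` of orders zero and one vanish, so the derivative in the bandwidth `j` does not
see functions that are affine in the coordinate `j`. -/
lemma integral_pow_mul_wt_mul_eq_zero (hb : KernelBounds K S B) (hm : KernelMoments K ν κ κ')
    (hw : InWindow S x h) (j : Fin d) {α : ℕ} (hα : α ≤ 1) {A : (Fin d → ℝ) → ℝ} {C : ℝ}
    (hA : ∀ u v : Fin d → ℝ, (∀ i, i ≠ j → u i = v i) → A u = A v) (hC : ∀ u, |A u| ≤ C) :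
    ∫ u, wt K (some j) x h u * (((u j - x j) / h j) ^ α * A u) ∂uniformCube d = 0 := by
  obtain ⟨I, hI, -⟩ := exists_integral_prod_mul (fun _ : Fin d => unitMeasure)
    (fun i : Fin d => i ≠ j)
    (fun i v => ((v - x i) / h i) ^ (if i = j then α else 0) *
      kfac K (some j) i ((v - x i) / h i) / h i)
    (fun i => integrable_factor hb hw (some j) _ i) A hA hC
  have h1 : ∀ u : Fin d → ℝ, wt K (some j) x h u * (((u j - x j) / h j) ^ α * A u) =
      (∏ i, (fun v => ((v - x i) / h i) ^ (if i = j then α else 0) *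
        kfac K (some j) i ((v - x i) / h i) / h i) (u i)) * A u := by
    intro u
    simp only
    rw [prod_factor_eq (x := x) (h := h) (some j) (fun i => if i = j then α else 0) u,
      Finset.prod_eq_single j]
    · simp only [if_true]; ring
    · intro i _ hij; simp [hij]
    · simp
  simp_rw [h1]
  rw [uniformCube_eq_pi, hI, Finset.prod_eq_zero (Finset.mem_univ ⟨j, not_not.mpr rfl⟩), zero_mul]
  rw [integral_factor hb hw]
  simp only [if_true]
  interval_cases α
  · exact (kmom_some_self hm j).1
  · exact (kmom_some_self hm j).2.1

lemma integrable_wt_mul (hb : KernelBounds K S B) (hw : InWindow S x h) (J : Option (Fin d))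
    {f : (Fin d → ℝ) → ℝ} {C : ℝ} (hf : Measurable f)
    (hC : ∀ u, wt K J x h u ≠ 0 → |f u| ≤ C) :
    Integrable (fun u => wt K J x h u * f u) (uniformCube d) := by
  refine Integrable.of_bound ((measurable_wt hb J x h).mul hf).aestronglyMeasurable
    (B ^ d / (∏ i, h i) * |C|) (Eventually.of_forall fun u => ?_)
  have hp : 0 < ∏ i, h i := Finset.prod_pos fun i _ => (hw i).1
  have hB := hb.one_le_B
  by_cases hu : wt K J x h u = 0
  · rw [hu, zero_mul, norm_zero]; positivity
  · rw [Real.norm_eq_abs, abs_mul]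
    exact mul_le_mul (abs_wt_le hb hw J u) ((hC u hu).trans (le_abs_self C)) (abs_nonneg _)
      (by positivity)

/-- The expected derivative of the weighted average in the bandwidth `j` picks out the second-order term of
`φ` in the coordinate `j`. -/
lemma abs_integral_wt_some_sub_le (hb : KernelBounds K S B) (hm : KernelMoments K ν κ κ')
    (hw : InWindow S x h) {r : ℕ} (j : Fin d) {φ A₀ A₁ E : (Fin d → ℝ) → ℝ} {a C₀ C₁ C₂ : ℝ}
    (hA₀m : Measurable A₀) (hA₁m : Measurable A₁)
    (hA₀ : ∀ u v : Fin d → ℝ, (∀ i, i ≠ j → u i = v i) → A₀ u = A₀ v) (hC₀ : ∀ u, |A₀ u| ≤ C₀)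
    (hA₁ : ∀ u v : Fin d → ℝ, (∀ i, i ≠ j → u i = v i) → A₁ u = A₁ v) (hC₁ : ∀ u, |A₁ u| ≤ C₁)
    (hE : IsFirstCoords r E C₂)
    (hφ : ∀ u, wt K (some j) x h u ≠ 0 → φ u =
      A₀ u + (u j - x j) / h j * A₁ u + ((u j - x j) / h j) ^ 2 * a + E u) :
    |∫ u, wt K (some j) x h u * φ u ∂uniformCube d - 2 * ν * a| ≤ C₂ * (2 * S ^ 2 * B) ^ r := by
  have h1 : ∀ u, wt K (some j) x h u * φ u =
      wt K (some j) x h u * (((u j - x j) / h j) ^ 0 * A₀ u) +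
      wt K (some j) x h u * (((u j - x j) / h j) ^ 1 * A₁ u) +
      wt K (some j) x h u * ((vrow x h u j.succ * vrow x h u j.succ) * a) +
      wt K (some j) x h u * E u := by
    intro u
    by_cases hu : wt K (some j) x h u = 0
    · simp [hu]
    · rw [hφ u hu]; simp only [vrow, Fin.cons_succ]; ring
  have hS := hb.one_le_S
  have hv : ∀ u, wt K (some j) x h u ≠ 0 → |(u j - x j) / h j| ≤ S := fun u hu => by
    simpa [vrow] using abs_vrow_le hb hw hu j.succ
  have hvm : Measurable fun u : Fin d → ℝ => (u j - x j) / h j := by fun_prop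
  have i0 : Integrable (fun u => wt K (some j) x h u * (((u j - x j) / h j) ^ 0 * A₀ u))
      (uniformCube d) :=
    integrable_wt_mul hb hw _ (C := C₀) ((hvm.pow_const 0).mul hA₀m)
      (fun u _ => by simpa using hC₀ u)
  have i1 : Integrable (fun u => wt K (some j) x h u * (((u j - x j) / h j) ^ 1 * A₁ u))
      (uniformCube d) :=
    integrable_wt_mul hb hw _ (C := S * C₁) ((hvm.pow_const 1).mul hA₁m) (fun u hu => by
      rw [pow_one, abs_mul]
      exact mul_le_mul (hv u hu) (hC₁ u) (abs_nonneg _) (by linarith))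
  have i2 : Integrable (fun u => wt K (some j) x h u *
      ((vrow x h u j.succ * vrow x h u j.succ) * a)) (uniformCube d) :=
    integrable_wt_mul hb hw _ (C := S * S * |a|)
      (((measurable_vrow x h j.succ).mul (measurable_vrow x h j.succ)).mul_const a)
      (fun u hu => by
        rw [abs_mul, abs_mul]
        have := abs_vrow_le hb hw hu j.succ
        gcongr)
  have i3 : Integrable (fun u => wt K (some j) x h u * E u) (uniformCube d) :=
    integrable_wt_mul hb hw _ hE.measurable (fun u _ => hE.bound u)
  have e2 : ∫ u, wt K (some j) x h u * ((vrow x h u j.succ * vrow x h u j.succ) * a)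
      ∂uniformCube d = 2 * ν * a := by
    have := integral_vrow_vrow_wt hb hm hw (some j) j.succ j.succ
    simp only [popGram, Matrix.single_apply_same] at this
    rw [← this, ← integral_mul_const]
    exact integral_congr_ae (Eventually.of_forall fun u => by ring)
  have e3 := (abs_integral_vrow_wt_mul_le hb hm hw hE (some j) 0).1
  have e4 : ∀ u, vrow x h u 0 * wt K (some j) x h u * E u = wt K (some j) x h u * E u := by
    intro u; simp [vrow]
  simp_rw [e4] at e3
  simp_rw [h1]
  rw [integral_add ((i0.fun_add i1).fun_add i2) i3, integral_add (i0.fun_add i1) i2, integral_add i0 i1,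
    integral_pow_mul_wt_mul_eq_zero hb hm hw j (Nat.zero_le 1) hA₀ hC₀,
    integral_pow_mul_wt_mul_eq_zero hb hm hw j le_rfl hA₁ hC₁, e2]
  simpa using e3

end Expectation

/-! ### Deviation inequalities -/

section Deviation

/-- The Chernoff bound behind Bernstein's inequality. -/
lemma measurePi_sum_ge_le {E : Type*} [MeasurableSpace E] (μ : Measure E) [IsProbabilityMeasure μ]
    {f : E → ℝ} {F V : ℝ} (hf : Measurable f) (hF : ∀ u, |f u| ≤ F)
    (hV : ∫ u, f u ^ 2 ∂μ ≤ V) (n : ℕ) {l s : ℝ} (hl : 0 ≤ l) (hlF : l * (2 * F) ≤ 1) :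
    (Measure.pi fun _ : Fin n => μ).real {X | s ≤ ∑ i, (f (X i) - ∫ u, f u ∂μ)} ≤
      Real.exp (-l * s + n * (l ^ 2 * V)) := by
  set e := ∫ u, f u ∂μ with he
  have hfi : Integrable f μ := Integrable.of_bound hf.aestronglyMeasurable F (Eventually.of_forall hF)
  have heF : |e| ≤ F := by
    have := norm_integral_le_of_norm_le_const (μ := μ) (f := f) (Eventually.of_forall hF)
    simpa using this
  have hy : ∀ u, |l * (f u - e)| ≤ 1 := fun u => by
    rw [abs_mul, abs_of_nonneg hl]
    refine le_trans (mul_le_mul_of_nonneg_left ?_ hl) hlF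
    exact (abs_sub _ _).trans (by linarith [hF u])
  have hym : Measurable fun u => l * (f u - e) := (hf.sub_const e).const_mul l
  have hexpi : Integrable (fun u => Real.exp (l * (f u - e))) μ := by
    refine Integrable.of_bound (Real.measurable_exp.comp hym).aestronglyMeasurable (Real.exp 1)
      (Eventually.of_forall fun u => ?_)
    rw [Real.norm_eq_abs, Real.abs_exp]
    exact Real.exp_le_exp.mpr ((le_abs_self _).trans (hy u))
  have hfsq : Integrable (fun u => f u ^ 2) μ := by
    refine Integrable.of_bound (hf.pow_const 2).aestronglyMeasurable (F ^ 2)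
      (Eventually.of_forall fun u => ?_)
    rw [Real.norm_eq_abs, abs_pow]
    exact pow_le_pow_left₀ (abs_nonneg _) (hF u) 2
  have hmgf : ∫ u, Real.exp (l * (f u - e)) ∂μ ≤ Real.exp (l ^ 2 * V) := by
    have h1 : ∀ u, Real.exp (l * (f u - e)) ≤
        (1 - l * e + l ^ 2 * e ^ 2) + (l - 2 * l ^ 2 * e) * f u + l ^ 2 * f u ^ 2 := fun u => by
      have := (abs_le.mp (Real.abs_exp_sub_one_sub_id_le (hy u))).2
      nlinarith
    have h2 := integral_mono hexpi
      (((integrable_const _).fun_add (hfi.const_mul _)).fun_add (hfsq.const_mul _)) h1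
    rw [integral_add ((integrable_const _).fun_add (hfi.const_mul _)) (hfsq.const_mul _),
      integral_add (integrable_const _) (hfi.const_mul _), integral_const_mul, integral_const_mul,
      integral_const, ← he] at h2
    simp only [probReal_univ, one_smul] at h2
    refine h2.trans ?_
    have h3 := Real.add_one_le_exp (l ^ 2 * V)
    have h4 := mul_le_mul_of_nonneg_left hV (sq_nonneg l)
    nlinarith [sq_nonneg (l * e)]
  have hprod : ∀ X : Fin n → E, Real.exp (l * ∑ i, (f (X i) - e)) =
      ∏ i, Real.exp (l * (f (X i) - e)) := fun X => by
    rw [Finset.mul_sum, Real.exp_sum]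
  have h5 := measure_ge_le_exp_mul_mgf (μ := Measure.pi fun _ : Fin n => μ)
    (X := fun X => ∑ i, (f (X i) - e)) s hl (by
      simp_rw [hprod]
      exact Integrable.fintype_prod fun _ => hexpi)
  refine h5.trans ?_
  rw [Real.exp_add]
  refine mul_le_mul_of_nonneg_left ?_ (Real.exp_pos _).le
  rw [mgf]
  simp_rw [hprod]
  rw [integral_fintype_prod_eq_prod (fun (_ : Fin n) u => Real.exp (l * (f u - e))),
    Finset.prod_const, Finset.card_univ, Fintype.card_fin, Real.exp_nat_mul]
  exact pow_le_pow_left₀ (integral_nonneg fun _ => (Real.exp_pos _).le) hmgf n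

/-- Bernstein's inequality for the average of a bounded function over an i.i.d. sample, in the range
of deviations in which the tail is Gaussian. -/
lemma measurePi_abs_avg_sub_gt_le {E : Type*} [MeasurableSpace E] (μ : Measure E)
    [IsProbabilityMeasure μ] {f : E → ℝ} {F V : ℝ} (hf : Measurable f) (hF : ∀ u, |f u| ≤ F)
    (hV : ∫ u, f u ^ 2 ∂μ ≤ V) {n : ℕ} (hn : 2 ≤ n)
    (hFV : 4 * F ^ 2 * Real.log n ≤ n * V) :
    (Measure.pi fun _ : Fin n => μ)
      {X | 2 * √(V * Real.log n / n) < |(n : ℝ)⁻¹ * ∑ i, f (X i) - ∫ u, f u ∂μ|} ≤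
      ENNReal.ofReal (2 / n) := by
  have hn0 : (0 : ℝ) < n := by positivity
  have hlog : 0 < Real.log n := Real.log_pos (by exact_mod_cast (by omega : 1 < n))
  have hE : Nonempty E := (inferInstance : NeZero μ).out |> fun h => by
    by_contra hne
    rw [not_nonempty_iff] at hne
    exact h (Measure.eq_zero_of_isEmpty μ)
  have hF0 : 0 ≤ F := (abs_nonneg _).trans (hF hE.some)
  have hV0 : 0 ≤ V := (integral_nonneg fun u => sq_nonneg (f u)).trans hV
  rcases hV0.eq_or_lt with hV0 | hV0
  · -- degenerate case: `f = 0`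
    subst hV0
    have hF' : F = 0 := by
      have : F ^ 2 ≤ 0 := by
        by_contra hcon
        nlinarith [mul_pos (not_le.mp hcon) hlog]
      nlinarith
    have hf0 : ∀ u, f u = 0 := fun u => by
      have := hF u
      rw [hF'] at this
      exact abs_nonpos_iff.mp this
    simp [hf0]
  set t := 2 * √(V * Real.log n / n) with ht
  have ht0 : 0 ≤ t := by positivity
  have htsq : t ^ 2 = 4 * (V * Real.log n / n) := by
    rw [ht, mul_pow, Real.sq_sqrt (by positivity)]; ring
  set l := t / (2 * V) with hl
  have hl0 : 0 ≤ l := by positivity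
  have hlF : l * (2 * F) ≤ 1 := by
    have h1 : l * (2 * F) = t * F / V := by rw [hl]; field_simp
    rw [h1, div_le_one hV0]
    refine abs_le_of_sq_le_sq' ?_ hV0.le |>.2
    rw [mul_pow, htsq]
    calc 4 * (V * Real.log n / n) * F ^ 2 = (4 * F ^ 2 * Real.log n) * (V / n) := by ring
      _ ≤ (n * V) * (V / n) := by gcongr
      _ = V ^ 2 := by field_simp
  have hexp : Real.exp (-l * (n * t) + n * (l ^ 2 * V)) = 1 / n := by
    have : -l * (n * t) + n * (l ^ 2 * V) = -Real.log n := by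
      have : -l * (n * t) + n * (l ^ 2 * V) = -(n * t ^ 2 / (4 * V)) := by
        rw [hl]; field_simp; ring
      rw [this, htsq]; field_simp
    rw [this, Real.exp_neg, Real.exp_log hn0, one_div]
  have h1 := measurePi_sum_ge_le μ hf hF hV n (s := n * t) hl0 hlF
  have h2 := measurePi_sum_ge_le μ (f := fun u => -f u) (s := n * t) hf.neg
    (by simpa using hF) (by simpa using hV) n hl0 hlF
  rw [hexp] at h1 h2
  set e := ∫ u, f u ∂μ with he
  have hsub : {X : Fin n → E | t < |(n : ℝ)⁻¹ * ∑ i, f (X i) - e|} ⊆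
      {X | n * t ≤ ∑ i, (f (X i) - e)} ∪ {X | n * t ≤ ∑ i, (-f (X i) - ∫ u, -f u ∂μ)} := by
    intro X hX
    rw [Set.mem_ofPred_eq] at hX
    have hs : ∑ i, (f (X i) - e) = n * ((n : ℝ)⁻¹ * ∑ i, f (X i) - e) := by
      rw [Finset.sum_sub_distrib]; simp [mul_sub, hn0.ne']
    have hs' : ∑ i, (-f (X i) - ∫ u, -f u ∂μ) = -∑ i, (f (X i) - e) := by
      rw [integral_neg, ← he, ← Finset.sum_neg_distrib]
      exact Finset.sum_congr rfl fun i _ => by ring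
    simp only [Set.mem_union, Set.mem_ofPred_eq, hs', hs]
    rcases lt_abs.mp hX with h | h
    · exact Or.inl (mul_le_mul_of_nonneg_left h.le hn0.le)
    · right; nlinarith
  refine (measure_mono hsub).trans ((measure_union_le _ _).trans ?_)
  rw [← ofReal_measureReal (by finiteness), ← ofReal_measureReal (by finiteness),
    ← ENNReal.ofReal_add measureReal_nonneg measureReal_nonneg]
  refine ENNReal.ofReal_le_ofReal ((add_le_add h1 h2).trans_eq ?_)
  ring

lemma measurePi_gaussian_ge_le (σ : ℝ≥0) (n : ℕ) (a : Fin n → ℝ) {l s : ℝ} (hl : 0 ≤ l) :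
    (Measure.pi fun _ : Fin n => gaussianReal 0 (σ ^ 2)).real {ξ | s ≤ ∑ i, a i * ξ i} ≤
      Real.exp (-l * s + (σ : ℝ) ^ 2 * (∑ i, a i ^ 2) * l ^ 2 / 2) := by
  have hprod : ∀ ξ : Fin n → ℝ, Real.exp (l * ∑ i, a i * ξ i) =
      ∏ i, Real.exp ((l * a i) * ξ i) := fun ξ => by
    rw [Finset.mul_sum, Real.exp_sum]
    exact Finset.prod_congr rfl fun i _ => by rw [mul_assoc]
  have h5 := measure_ge_le_exp_mul_mgf (μ := Measure.pi fun _ : Fin n => gaussianReal 0 (σ ^ 2))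
    (X := fun ξ => ∑ i, a i * ξ i) s hl (by
      simp_rw [hprod]
      exact Integrable.fintype_prod (f := fun i v => Real.exp ((l * a i) * v))
        fun i => integrable_exp_mul_gaussianReal _)
  refine h5.trans_eq ?_
  rw [Real.exp_add, mgf]
  simp_rw [hprod]
  rw [integral_fintype_prod_eq_prod (fun (i : Fin n) v => Real.exp ((l * a i) * v))]
  have h6 : ∀ i, ∫ v, Real.exp ((l * a i) * v) ∂gaussianReal 0 (σ ^ 2) =
      Real.exp ((σ : ℝ) ^ 2 * (l * a i) ^ 2 / 2) := fun i => by
    have := congrFun (mgf_fun_id_gaussianReal (μ := 0) (v := σ ^ 2)) (l * a i)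
    rw [mgf] at this
    simpa using this
  simp_rw [h6]
  rw [← Real.exp_sum]
  congr 2
  rw [Finset.mul_sum, Finset.sum_mul, Finset.sum_div]
  exact Finset.sum_congr rfl fun i _ => by ring

lemma measurePi_gaussian_abs_gt_le (σ : ℝ≥0) (hσ : 0 < σ) (n : ℕ) (a : Fin n → ℝ) {t : ℝ}
    (ht : 0 ≤ t) :
    (Measure.pi fun _ : Fin n => gaussianReal 0 (σ ^ 2))
      {ξ | t * √((σ : ℝ) ^ 2 * ∑ i, a i ^ 2) < |∑ i, a i * ξ i|} ≤
      ENNReal.ofReal (2 * Real.exp (-t ^ 2 / 2)) := by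
  have hσ' : (0 : ℝ) < σ := hσ
  have hs0 : 0 ≤ ∑ i, a i ^ 2 := Finset.sum_nonneg fun i _ => sq_nonneg _
  rcases hs0.eq_or_lt with h0 | h0
  · have ha : ∀ i, a i = 0 := fun i => by
      have := (Finset.sum_eq_zero_iff_of_nonneg fun i _ => sq_nonneg (a i)).mp h0.symm i
        (Finset.mem_univ i)
      simpa using this
    simp [ha]
  set v := (σ : ℝ) ^ 2 * ∑ i, a i ^ 2 with hv
  have hv0 : 0 < v := by positivity
  have hsv : 0 < √v := Real.sqrt_pos.mpr hv0
  have hsq : √v ^ 2 = v := Real.sq_sqrt hv0.le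
  have hexp : Real.exp (-(t / √v) * (t * √v) + v * (t / √v) ^ 2 / 2) = Real.exp (-t ^ 2 / 2) := by
    congr 1
    rw [div_pow, hsq]; field_simp; ring
  have h1 := measurePi_gaussian_ge_le σ n a (s := t * √v) (l := t / √v) (by positivity)
  have h2 := measurePi_gaussian_ge_le σ n (fun i => -a i) (s := t * √v) (l := t / √v)
    (by positivity)
  simp only [even_two.neg_pow] at h2
  rw [← hv, hexp] at h1 h2
  have hsub : {ξ : Fin n → ℝ | t * √v < |∑ i, a i * ξ i|} ⊆
      {ξ | t * √v ≤ ∑ i, a i * ξ i} ∪ {ξ | t * √v ≤ ∑ i, -a i * ξ i} := by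
    intro ξ hξ
    simp only [Set.mem_union, Set.mem_ofPred_eq, neg_mul, Finset.sum_neg_distrib]
    rcases lt_abs.mp (show t * √v < |∑ i, a i * ξ i| from hξ) with h | h
    · exact Or.inl h.le
    · exact Or.inr h.le
  refine (measure_mono hsub).trans ((measure_union_le _ _).trans ?_)
  rw [← ofReal_measureReal (by finiteness), ← ofReal_measureReal (by finiteness),
    ← ENNReal.ofReal_add measureReal_nonneg measureReal_nonneg]
  refine ENNReal.ofReal_le_ofReal ((add_le_add h1 h2).trans_eq ?_)
  ring

/-- A linear statistic of the noise with coefficients that depend on the design is at most half of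
the threshold: conditionally on the design it is Gaussian. -/
lemma measure_prod_noise_gt_le {E : Type*} [MeasurableSpace E] (μ : Measure E)
    [IsProbabilityMeasure μ] (σ : ℝ≥0) (hσ : 0 < σ) {n : ℕ} (hn : 1 ≤ n) {a : E → Fin n → ℝ}
    (ha : ∀ i, Measurable fun u => a u i) :
    (μ.prod (Measure.pi fun _ : Fin n => gaussianReal 0 (σ ^ 2)))
      {ω | √(2 * Real.log n) / 2 * √((σ : ℝ) ^ 2 * ∑ i, a ω.1 i ^ 2) <
        |∑ i, a ω.1 i * ω.2 i|} ≤ ENNReal.ofReal (2 * (n : ℝ) ^ (-(1 / 4) : ℝ)) := by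
  have hn0 : (0 : ℝ) < n := by exact_mod_cast hn
  have hlog : 0 ≤ Real.log n := Real.log_nonneg (by exact_mod_cast hn)
  have hm : ∀ i, Measurable fun ω : E × (Fin n → ℝ) => a ω.1 i := fun i =>
    (ha i).comp measurable_fst
  have hm2 : ∀ i, Measurable fun ω : E × (Fin n → ℝ) => ω.2 i := fun i =>
    (measurable_pi_apply i).comp measurable_snd
  rw [Measure.prod_apply]
  · have hb : ∀ u, (Measure.pi fun _ : Fin n => gaussianReal 0 (σ ^ 2))
        (Prod.mk u ⁻¹' {ω : E × (Fin n → ℝ) | √(2 * Real.log n) / 2 *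
          √((σ : ℝ) ^ 2 * ∑ i, a ω.1 i ^ 2) < |∑ i, a ω.1 i * ω.2 i|}) ≤
        ENNReal.ofReal (2 * (n : ℝ) ^ (-(1 / 4) : ℝ)) := fun u => by
      refine (measurePi_gaussian_abs_gt_le σ hσ n (a u)
        (t := √(2 * Real.log n) / 2) (by positivity)).trans_eq ?_
      rw [div_pow, Real.sq_sqrt (by positivity), Real.rpow_def_of_pos hn0]
      congr 3
      ring
    refine (lintegral_mono hb).trans ?_
    simp
  · refine measurableSet_lt ?_ ?_
    · exact ((Finset.measurable_sum _ fun i _ => (hm i).pow_const 2).const_mul _).sqrt.const_mul _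
    · exact (Finset.measurable_sum _ fun i _ => (hm i).mul (hm2 i)).abs

end Deviation

/-! ### Taylor expansion of the regression function -/

section Taylor

variable {d : ℕ}

/-- Mean value inequality in terms of partial derivatives. -/
lemma abs_sub_le_of_partial_le {g : (Fin d → ℝ) → ℝ} {a b : Fin d → ℝ} {L : ℝ}
    (hg : ∀ y ∈ segment ℝ a b, DifferentiableAt ℝ g y)
    (hL : ∀ y ∈ segment ℝ a b, ∀ l, b l ≠ a l → |fderiv ℝ g y (Pi.single l 1)| ≤ L) :
    |g b - g a| ≤ L * ∑ l, |b l - a l| := by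
  have hmem : ∀ t ∈ Set.Icc (0 : ℝ) 1, a + t • (b - a) ∈ segment ℝ a b := fun t ht => by
    rw [segment_eq_image']
    exact ⟨t, ht, rfl⟩
  have hd : ∀ t ∈ Set.Icc (0 : ℝ) 1, HasDerivWithinAt (fun t : ℝ => g (a + t • (b - a)))
      (fderiv ℝ g (a + t • (b - a)) (b - a)) (Set.Icc 0 1) t := fun t ht => by
    have h1 : HasDerivAt (fun t : ℝ => a + t • (b - a)) (b - a) t := by
      simpa using ((hasDerivAt_id t).smul_const (b - a)).const_add a
    exact ((hg _ (hmem t ht)).hasFDerivAt.comp_hasDerivAt t h1).hasDerivWithinAt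
  have hb : ∀ t ∈ Set.Ico (0 : ℝ) 1,
      ‖fderiv ℝ g (a + t • (b - a)) (b - a)‖ ≤ L * ∑ l, |b l - a l| := fun t ht => by
    have h1 : b - a = ∑ l, (b l - a l) • (Pi.single l 1 : Fin d → ℝ) := by
      funext k
      simp [Finset.sum_apply, Pi.single_apply]
    rw [h1, map_sum, Finset.mul_sum, Real.norm_eq_abs]
    refine (Finset.abs_sum_le_sum_abs _ _).trans (Finset.sum_le_sum fun l _ => ?_)
    rw [map_smul, smul_eq_mul, abs_mul, mul_comm]
    by_cases hl : b l = a l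
    · simp [hl]
    · rw [← h1]
      exact mul_le_mul_of_nonneg_right (hL _ (hmem t (Set.Ico_subset_Icc_self ht)) l hl)
        (abs_nonneg _)
  have := norm_image_sub_le_of_norm_deriv_le_segment_01' hd hb
  simpa using this

lemma isOpen_openCube (d : ℕ) : IsOpen (openCube d) :=
  isOpen_set_pi Set.finite_univ fun _ _ => isOpen_Ioo

variable {m : (Fin d → ℝ) → ℝ} {M : ℝ}

lemma HasBoundedDerivs.differentiableAt_partialDeriv (hm : HasBoundedDerivs m M) {k : ℕ}
    (hk : k < 3) (i : Fin k → Fin d) {y : Fin d → ℝ} (hy : y ∈ openCube d) :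
    DifferentiableAt ℝ (partialDeriv m i) y ∧ ∀ l : Fin d,
      fderiv ℝ (partialDeriv m i) y (Pi.single l 1) = partialDeriv m (Fin.cons l i : Fin (k + 1) → Fin d) y := by
  have hc : ContDiffAt ℝ 3 m y := hm.contDiffOn.contDiffAt ((isOpen_openCube d).mem_nhds hy)
  have hd : DifferentiableAt ℝ (iteratedFDeriv ℝ k m) y :=
    hc.differentiableAt_iteratedFDeriv (by exact_mod_cast hk)
  have hd' : HasFDerivAt (partialDeriv m i)
      ((ContinuousMultilinearMap.apply ℝ (fun _ : Fin k => Fin d → ℝ) ℝ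
        (fun l => Pi.single (i l) 1)).comp (fderiv ℝ (iteratedFDeriv ℝ k m) y)) y :=
    (ContinuousMultilinearMap.apply ℝ (fun _ : Fin k => Fin d → ℝ) ℝ
        (fun l => Pi.single (i l) 1)).hasFDerivAt.comp y hd.hasFDerivAt
  refine ⟨hd'.differentiableAt, fun l => ?_⟩
  rw [hd'.fderiv, partialDeriv, iteratedFDeriv_succ_apply_left]
  simp only [ContinuousLinearMap.comp_apply, ContinuousMultilinearMap.apply_apply, Fin.cons_zero]
  rfl

lemma partialDeriv_zero (i : Fin 0 → Fin d) : partialDeriv m i = m := by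
  funext y; simp [partialDeriv]

lemma HasBoundedDerivs.differentiableAt (hm : HasBoundedDerivs m M) {y : Fin d → ℝ}
    (hy : y ∈ openCube d) : DifferentiableAt ℝ m y := by
  simpa [partialDeriv_zero] using (hm.differentiableAt_partialDeriv (k := 0) (by norm_num)
    (fun i => i.elim0) hy).1

lemma HasBoundedDerivs.fderiv_single (hm : HasBoundedDerivs m M) {y : Fin d → ℝ}
    (hy : y ∈ openCube d) (l : Fin d) : fderiv ℝ m y (Pi.single l 1) = partialDeriv m ![l] y := by
  have := (hm.differentiableAt_partialDeriv (k := 0) (by norm_num) (fun i => i.elim0) hy).2 l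
  rw [partialDeriv_zero] at this
  rw [this]
  congr 1

lemma HasBoundedDerivs.continuousOn_partialDeriv (hm : HasBoundedDerivs m M) {k : ℕ}
    (hk : k < 3) (i : Fin k → Fin d) : ContinuousOn (partialDeriv m i) (openCube d) :=
  fun _ hy => (hm.differentiableAt_partialDeriv hk i hy).1.continuousAt.continuousWithinAt

/-- The projection of `u` to the slice through `x` of the box around `x` with half-widths `S h_j`,
in the directions of the first `r` coordinates. -/
def clampBox (r : ℕ) (S : ℝ) (x h u : Fin d → ℝ) : Fin d → ℝ := fun j =>
  if (j : ℕ) < r then max (x j - S * h j) (min (u j) (x j + S * h j)) else x j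

/-- The remainder of the first-order Taylor expansion of `m` at `x`, as a function of the first `r`
coordinates, extended continuously from the box. -/
def remainder (m : (Fin d → ℝ) → ℝ) (r : ℕ) (S : ℝ) (x h u : Fin d → ℝ) : ℝ :=
  m (clampBox r S x h u) - m x - ∑ j, partialDeriv m ![j] x * (clampBox r S x h u j - x j)

/-- The total half-width of the box in the first `r` directions. -/
def relSum (r : ℕ) (h : Fin d → ℝ) : ℝ := ∑ j : Fin d, if (j : ℕ) < r then h j else 0

variable {r : ℕ} {S : ℝ} {x h : Fin d → ℝ}

lemma relSum_nonneg (hh : ∀ j, 0 ≤ h j) : 0 ≤ relSum r h :=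
  Finset.sum_nonneg fun j _ => by
    split_ifs
    exacts [hh j, le_rfl]

/-- The slice through `x` of the box around `x` with half-widths `S h_j`, in the directions of the
first `r` coordinates. -/
def boxSlice (r : ℕ) (S : ℝ) (x h : Fin d → ℝ) : Set (Fin d → ℝ) :=
  {y | ∀ j : Fin d, y j ∈ Set.Icc (x j - if (j : ℕ) < r then S * h j else 0)
    (x j + if (j : ℕ) < r then S * h j else 0)}

lemma convex_boxSlice : Convex ℝ (boxSlice r S x h) := by
  intro a ha b hb s t hs ht hst j
  exact (convex_Icc _ _) (ha j) (hb j) hs ht hst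

lemma boxSlice_subset (hS : 1 ≤ S) (hw : InWindow S x h) : boxSlice r S x h ⊆ openCube d := by
  intro y hy j _
  have h1 := hy j
  have h2 := hw j
  have h3 : 0 < S * h j := mul_pos (by linarith) h2.1
  split_ifs at h1
  · exact ⟨by linarith [h1.1], by linarith [h1.2]⟩
  · exact ⟨by linarith [h1.1], by linarith [h1.2]⟩

lemma self_mem_boxSlice (hS : 1 ≤ S) (hw : InWindow S x h) : x ∈ boxSlice r S x h := by
  intro j
  have h3 : 0 < S * h j := mul_pos (by linarith) (hw j).1
  split_ifs
  · exact ⟨by linarith, by linarith⟩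
  · exact ⟨by linarith, by linarith⟩

lemma clampBox_mem (hS : 1 ≤ S) (hw : InWindow S x h) (u : Fin d → ℝ) :
    clampBox r S x h u ∈ boxSlice r S x h := by
  intro j
  have h3 : 0 < S * h j := mul_pos (by linarith) (hw j).1
  unfold clampBox
  split_ifs
  · exact ⟨le_max_left _ _, max_le (by linarith) (min_le_right _ _)⟩
  · simp

lemma abs_sub_of_mem_boxSlice {y : Fin d → ℝ} (hy : y ∈ boxSlice r S x h) (j : Fin d) :
    |y j - x j| ≤ if (j : ℕ) < r then S * h j else 0 := by
  have h1 := hy j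
  exact abs_le.mpr ⟨by linarith [h1.1], by linarith [h1.2]⟩

lemma sum_abs_sub_of_mem_boxSlice {y : Fin d → ℝ} (hy : y ∈ boxSlice r S x h) :
    ∑ j, |y j - x j| ≤ S * relSum r h := by
  refine (Finset.sum_le_sum fun j _ => abs_sub_of_mem_boxSlice hy j).trans_eq ?_
  rw [relSum, Finset.mul_sum]
  exact Finset.sum_congr rfl fun j _ => by split_ifs <;> simp

lemma continuous_clampBox : Continuous (clampBox r S x h) := by
  refine continuous_pi fun j => ?_
  unfold clampBox
  split_ifs
  · fun_prop
  · fun_prop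

lemma clampBox_of_abs_lt {u : Fin d → ℝ} {j : Fin d} (hj : (j : ℕ) < r)
    (hu : |u j - x j| < S * h j) : clampBox r S x h u j = u j := by
  rw [abs_lt] at hu
  rw [clampBox, if_pos hj, min_eq_left (by linarith), max_eq_right (by linarith)]

lemma clampBox_update (u : Fin d → ℝ) (j : Fin d) (hS : 1 ≤ S) (hw : InWindow S x h) :
    clampBox r S x h (Function.update u j (x j)) =
      Function.update (clampBox r S x h u) j (x j) := by
  funext i
  have h3 : 0 < S * h j := mul_pos (by linarith) (hw j).1
  rcases eq_or_ne i j with rfl | hij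
  · simp only [clampBox, Function.update_self]
    split_ifs
    · rw [min_eq_left (by linarith), max_eq_right (by linarith)]
    · rfl
  · simp [clampBox, Function.update_of_ne hij]

lemma clampBox_congr {u v : Fin d → ℝ} (huv : ∀ i : Fin d, (i : ℕ) < r → u i = v i) :
    clampBox r S x h u = clampBox r S x h v := by
  funext i
  unfold clampBox
  split_ifs with hi
  · rw [huv i hi]
  · rfl

/-- On the box, `m` is affine up to the remainder. -/
lemma eq_affine_add_remainder (hS : 1 ≤ S) (hw : InWindow S x h) (hdep : DependsOnFirst r m)
    {u : Fin d → ℝ} (hu : ∀ j, |u j - x j| < S * h j) :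
    m u = m x + (∑ j : Fin d, if (j : ℕ) < r then partialDeriv m ![j] x * (u j - x j) else 0) +
      remainder m r S x h u := by
  have h1 : m u = m (clampBox r S x h u) := by
    refine hdep u (fun j _ => ?_) _ (boxSlice_subset hS hw (clampBox_mem hS hw u))
      fun j hj => (clampBox_of_abs_lt hj (hu j)).symm
    have := abs_lt.mp (hu j)
    exact ⟨by linarith [(hw j).2.1], by linarith [(hw j).2.2]⟩
  have h2 : ∑ j, partialDeriv m ![j] x * (clampBox r S x h u j - x j) =
      ∑ j : Fin d, if (j : ℕ) < r then partialDeriv m ![j] x * (u j - x j) else 0 := by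
    refine Finset.sum_congr rfl fun j _ => ?_
    by_cases hj : (j : ℕ) < r
    · rw [if_pos hj, clampBox_of_abs_lt hj (hu j)]
    · rw [if_neg hj, clampBox, if_neg hj]; ring
  rw [remainder, h2, h1]; ring

lemma HasBoundedDerivs.abs_partialDeriv_sub_le (hm : HasBoundedDerivs m M) (hM : 0 ≤ M)
    (hS : 1 ≤ S) (hw : InWindow S x h) {k : ℕ} (hk : k < 3) (i : Fin k → Fin d) {y : Fin d → ℝ}
    (hy : y ∈ boxSlice r S x h) :
    |partialDeriv m i y - partialDeriv m i x| ≤ M * (S * relSum r h) := by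
  have hseg : segment ℝ x y ⊆ openCube d := fun z hz =>
    boxSlice_subset hS hw (convex_boxSlice.segment_subset (self_mem_boxSlice hS hw) hy hz)
  refine (abs_sub_le_of_partial_le (L := M)
    (fun z hz => (hm.differentiableAt_partialDeriv hk i (hseg hz)).1) fun z hz l _ => ?_).trans
    (mul_le_mul_of_nonneg_left (sum_abs_sub_of_mem_boxSlice hy) hM)
  rw [(hm.differentiableAt_partialDeriv hk i (hseg hz)).2 l]
  exact hm.bound (k + 1) (by omega) (by omega) _ z (hseg hz)

lemma HasBoundedDerivs.abs_remainder_le (hm : HasBoundedDerivs m M) (hM : 0 ≤ M)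
    (hS : 1 ≤ S) (hw : InWindow S x h) (u : Fin d → ℝ) :
    |remainder m r S x h u| ≤ M * (S * relSum r h) ^ 2 := by
  set y := clampBox r S x h u with hy
  have hmem : y ∈ boxSlice r S x h := clampBox_mem hS hw u
  have hbox : segment ℝ x y ⊆ boxSlice r S x h :=
    convex_boxSlice.segment_subset (self_mem_boxSlice hS hw) hmem
  have hseg : segment ℝ x y ⊆ openCube d := hbox.trans (boxSlice_subset hS hw)
  have hlin : ∀ z : Fin d → ℝ, HasFDerivAt (fun z : Fin d → ℝ => ∑ j, partialDeriv m ![j] x * z j)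
      (∑ j, partialDeriv m ![j] x • ContinuousLinearMap.proj (R := ℝ) (φ := fun _ : Fin d => ℝ) j) z := fun z =>
    HasFDerivAt.fun_sum fun j _ => ((ContinuousLinearMap.proj (R := ℝ) (φ := fun _ : Fin d => ℝ) j).hasFDerivAt).const_mul _
  have hg : ∀ z ∈ segment ℝ x y, HasFDerivAt (fun z => m z - ∑ j, partialDeriv m ![j] x * z j) _ z :=
    fun z hz => (hm.differentiableAt (hseg hz)).hasFDerivAt.sub (hlin z)
  have h1 := abs_sub_le_of_partial_le (g := fun z => m z - ∑ j, partialDeriv m ![j] x * z j)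
    (L := M * (S * relSum r h)) (fun z hz => (hg z hz).differentiableAt) fun z hz l _ => by
      rw [(hg z hz).fderiv, sub_apply, hm.fderiv_single (hseg hz)]
      have : (∑ j, partialDeriv m ![j] x • ContinuousLinearMap.proj (R := ℝ) (φ := fun _ : Fin d => ℝ) j)
          (Pi.single l 1) = partialDeriv m ![l] x := by
        simp [Pi.single_apply]
      rw [this]
      exact hm.abs_partialDeriv_sub_le hM hS hw (by norm_num) _ (hbox hz)
  have h2 : remainder m r S x h u = (m y - ∑ j, partialDeriv m ![j] x * y j) -
      (m x - ∑ j, partialDeriv m ![j] x * x j) := by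
    rw [remainder, ← hy]
    simp only [mul_sub, Finset.sum_sub_distrib]; ring
  have hR : 0 ≤ relSum r h := relSum_nonneg fun j => (hw j).1.le
  rw [h2]
  refine h1.trans ?_
  exact (mul_le_mul_of_nonneg_left (sum_abs_sub_of_mem_boxSlice hmem) (by positivity)).trans_eq
    (by ring)

lemma HasBoundedDerivs.isFirstCoords_remainder (hm : HasBoundedDerivs m M) (hM : 0 ≤ M)
    (hS : 1 ≤ S) (hw : InWindow S x h) :
    IsFirstCoords r (remainder m r S x h) (M * (S * relSum r h) ^ 2) where
  measurable := by
    have h1 : Continuous fun u => m (clampBox r S x h u) :=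
      ContinuousOn.comp_continuous (f := clampBox r S x h) (g := m) (s := openCube d)
        (fun y hy => (hm.differentiableAt hy).continuousAt.continuousWithinAt)
        continuous_clampBox fun u => boxSlice_subset hS hw (clampBox_mem hS hw u)
    have h2 : ∀ j, Continuous fun u => clampBox r S x h u j := fun j =>
      (continuous_apply j).comp continuous_clampBox
    have h3 : Continuous (remainder m r S x h) := by
      unfold remainder
      exact (h1.sub continuous_const).sub
        (continuous_finsetSum _ fun j _ => ((h2 j).sub continuous_const).const_mul _)
    exact h3.measurable
  depends := fun u v huv => by rw [remainder, remainder, clampBox_congr huv]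
  bound := hm.abs_remainder_le hM hS hw

/-- The error of the second-order expansion of the remainder in the direction `j`, around the
hyperplane `u_j = x_j`, with the second derivative taken at `x`. -/
def cubicPart (m : (Fin d → ℝ) → ℝ) (r : ℕ) (S : ℝ) (x h : Fin d → ℝ) (j : Fin d)
    (u : Fin d → ℝ) : ℝ :=
  remainder m r S x h u - remainder m r S x h (Function.update u j (x j)) -
    (clampBox r S x h u j - x j) *
      (partialDeriv m ![j] (clampBox r S x h (Function.update u j (x j))) -
        partialDeriv m ![j] x) -
    (clampBox r S x h u j - x j) ^ 2 / 2 * partialDeriv m ![j, j] x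

/-- The error is of third order. The mean value inequality is applied along the `j`-th coordinate
twice, first to the first derivative and then to `m`. -/
lemma HasBoundedDerivs.abs_cubicPart_le (hm : HasBoundedDerivs m M) (hM : 0 ≤ M)
    (hS : 1 ≤ S) (hw : InWindow S x h) {j : Fin d} (hj : (j : ℕ) < r) (u : Fin d → ℝ) :
    |cubicPart m r S x h j u| ≤ M * (S * relSum r h) * (S * h j) ^ 2 := by
  set y := clampBox r S x h u with hy
  set y₀ := Function.update y j (x j) with hy₀
  have hy₀' : clampBox r S x h (Function.update u j (x j)) = y₀ := clampBox_update u j hS hw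
  have hmem : y ∈ boxSlice r S x h := clampBox_mem hS hw u
  have hmem₀ : y₀ ∈ boxSlice r S x h := hy₀' ▸ clampBox_mem hS hw _
  have hR : 0 ≤ relSum r h := relSum_nonneg fun j => (hw j).1.le
  have hSh : 0 ≤ S * h j := mul_nonneg (by linarith) (hw j).1.le
  have hoff : ∀ l, l ≠ j → y l = y₀ l := fun l hl => by rw [hy₀, Function.update_of_ne hl]
  have hy₀j : y₀ j = x j := by rw [hy₀, Function.update_self]
  have hsum : ∀ z : Fin d → ℝ, z ∈ boxSlice r S x h → (∀ l, l ≠ j → z l = y₀ l) →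
      ∑ l, |z l - y₀ l| ≤ S * h j := fun z hz hzo => by
    rw [Finset.sum_eq_single j]
    · rw [hy₀j]
      simpa [hj] using abs_sub_of_mem_boxSlice hz j
    · intro l _ hl; rw [hzo l hl, sub_self, abs_zero]
    · simp
  have hsegbox : ∀ z, z ∈ boxSlice r S x h → segment ℝ y₀ z ⊆ boxSlice r S x h := fun z hz =>
    convex_boxSlice.segment_subset hmem₀ hz
  have hsub := boxSlice_subset (r := r) hS hw
  have hproj : ∀ z : Fin d → ℝ, HasFDerivAt (fun z : Fin d → ℝ => z j)
      (ContinuousLinearMap.proj (R := ℝ) (φ := fun _ : Fin d => ℝ) j) z := fun z =>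
    (ContinuousLinearMap.proj (R := ℝ) (φ := fun _ : Fin d => ℝ) j).hasFDerivAt
  have hstep1 : ∀ z, z ∈ boxSlice r S x h → (∀ l, l ≠ j → z l = y₀ l) →
      |partialDeriv m ![j] z - z j * partialDeriv m ![j, j] x -
        (partialDeriv m ![j] y₀ - y₀ j * partialDeriv m ![j, j] x)| ≤
      M * (S * relSum r h) * (S * h j) := by
    intro z hz hzo
    have hg : ∀ w ∈ segment ℝ y₀ z, HasFDerivAt
        (fun w => partialDeriv m ![j] w - w j * partialDeriv m ![j, j] x) _ w := fun w hw' =>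
      (hm.differentiableAt_partialDeriv (by norm_num) ![j]
        (hsub (hsegbox z hz hw'))).1.hasFDerivAt.sub ((hproj w).mul_const _)
    refine (abs_sub_le_of_partial_le (L := M * (S * relSum r h))
      (fun w hw' => (hg w hw').differentiableAt) fun w hw' l hl => ?_).trans
      (mul_le_mul_of_nonneg_left (hsum z hz hzo) (by positivity))
    have hlj : l = j := by
      by_contra hlj
      exact hl (hzo l hlj)
    subst hlj
    rw [(hg w hw').fderiv, sub_apply,
      (hm.differentiableAt_partialDeriv (by norm_num) ![l] (hsub (hsegbox z hz hw'))).2 l]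
    have : (Fin.cons l ![l] : Fin 2 → Fin d) = ![l, l] := rfl
    rw [this]
    simpa using hm.abs_partialDeriv_sub_le hM hS hw (by norm_num) ![l, l] (hsegbox z hz hw')
  have hg : ∀ w ∈ segment ℝ y₀ y, HasFDerivAt (fun w => m w - w j * partialDeriv m ![j] y₀ -
      (w j - x j) ^ 2 * (partialDeriv m ![j, j] x / 2)) _ w := fun w hw' =>
    ((hm.differentiableAt (hsub (hsegbox y hmem hw'))).hasFDerivAt.sub
      ((hproj w).mul_const _)).sub ((((hproj w).sub_const (x j)).pow 2).mul_const _)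
  have h1 := abs_sub_le_of_partial_le (L := M * (S * relSum r h) * (S * h j))
      (fun w hw' => (hg w hw').differentiableAt) fun w hw' l hl => by
    have hlj : l = j := by
      by_contra hlj
      exact hl (hoff l hlj)
    subst hlj
    have hwo : ∀ i, i ≠ l → w i = y₀ i := fun i hi => by
      obtain ⟨s, t, hs, ht, hst, rfl⟩ := hw'
      simp only [Pi.add_apply, Pi.smul_apply, smul_eq_mul, hoff i hi]
      rw [← add_mul, hst, one_mul]
    have := hstep1 w (hsegbox y hmem hw') hwo
    rw [hy₀j] at this
    rw [(hg w hw').fderiv, sub_apply, sub_apply,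
      hm.fderiv_single (hsub (hsegbox y hmem hw'))]
    refine le_of_eq_of_le (congrArg _ ?_) this
    simp
    ring
  have h2 : cubicPart m r S x h j u =
      (m y - y j * partialDeriv m ![j] y₀ - (y j - x j) ^ 2 * (partialDeriv m ![j, j] x / 2)) -
      (m y₀ - y₀ j * partialDeriv m ![j] y₀ -
        (y₀ j - x j) ^ 2 * (partialDeriv m ![j, j] x / 2)) := by
    have h3 : ∑ l, partialDeriv m ![l] x * (y l - x l) =
        ∑ l, partialDeriv m ![l] x * (y₀ l - x l) + partialDeriv m ![j] x * (y j - x j) := by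
      have : ∑ l, partialDeriv m ![l] x * (y l - x l) -
          ∑ l, partialDeriv m ![l] x * (y₀ l - x l) = partialDeriv m ![j] x * (y j - x j) := by
        rw [← Finset.sum_sub_distrib, Finset.sum_eq_single j]
        · rw [hy₀j]; ring
        · intro l _ hl; rw [hoff l hl]; ring
        · simp
      linarith
    rw [cubicPart, remainder, remainder, hy₀', ← hy, h3, hy₀j]
    ring
  rw [h2]
  refine h1.trans ?_
  calc M * (S * relSum r h) * (S * h j) * ∑ l, |y l - y₀ l|
      ≤ M * (S * relSum r h) * (S * h j) * (S * h j) :=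
        mul_le_mul_of_nonneg_left (hsum y hmem hoff) (by positivity)
    _ = _ := by ring

lemma HasBoundedDerivs.continuous_partialDeriv_clampBox (hm : HasBoundedDerivs m M)
    (hS : 1 ≤ S) (hw : InWindow S x h) {k : ℕ} (hk : k < 3) (i : Fin k → Fin d) :
    Continuous fun u => partialDeriv m i (clampBox r S x h u) :=
  ContinuousOn.comp_continuous (f := clampBox r S x h) (s := openCube d)
    (hm.continuousOn_partialDeriv hk i)
    continuous_clampBox fun u => boxSlice_subset hS hw (clampBox_mem hS hw u)

lemma update_congr_of_lt {u v : Fin d → ℝ} (huv : ∀ i : Fin d, (i : ℕ) < r → u i = v i)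
    (j : Fin d) (a : ℝ) (i : Fin d) (hi : (i : ℕ) < r) :
    Function.update u j a i = Function.update v j a i := by
  rcases eq_or_ne i j with rfl | hij
  · simp
  · simp [Function.update_of_ne hij, huv i hi]

/-- The expected derivative of the estimate in a relevant bandwidth is, to leading order,
`ν ∂²m/∂x_j² h_j²`. -/
lemma HasBoundedDerivs.abs_integral_wt_remainder_sub_le {K : ℝ → ℝ} {B ν κ κ' : ℝ}
    (hm : HasBoundedDerivs m M) (hM : 0 ≤ M) (hb : KernelBounds K S B)
    (hmom : KernelMoments K ν κ κ') (hw : InWindow S x h) {j : Fin d} (hj : (j : ℕ) < r) :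
    |∫ u, wt K (some j) x h u * remainder m r S x h u ∂uniformCube d -
        ν * (h j ^ 2 * partialDeriv m ![j, j] x)| ≤
      M * (S * relSum r h) * (S * h j) ^ 2 * (2 * S ^ 2 * B) ^ r := by
  have hS := hb.one_le_S
  have hh := (hw j).1
  have hfc := hm.isFirstCoords_remainder (r := r) hM hS hw
  have hup : Measurable fun u : Fin d → ℝ => Function.update u j (x j) :=
    (by fun_prop : Continuous fun u : Fin d → ℝ => Function.update u j (x j)).measurable
  have hp1 : Measurable fun u => partialDeriv m ![j] (clampBox r S x h u) :=
    (hm.continuous_partialDeriv_clampBox hS hw (by norm_num) ![j]).measurable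
  have hcl : Measurable fun u => clampBox r S x h u j :=
    ((continuous_apply j).comp continuous_clampBox).measurable
  have hupd : ∀ u v : Fin d → ℝ, (∀ i, i ≠ j → u i = v i) →
      Function.update u j (x j) = Function.update v j (x j) := fun u v huv => by
    funext i
    rcases eq_or_ne i j with rfl | hij
    · simp
    · simp [Function.update_of_ne hij, huv i hij]
  have key := abs_integral_wt_some_sub_le hb hmom hw (r := r) j (φ := remainder m r S x h)
    (A₀ := fun u => remainder m r S x h (Function.update u j (x j)))
    (A₁ := fun u => h j * (partialDeriv m ![j] (clampBox r S x h (Function.update u j (x j))) -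
        partialDeriv m ![j] x))
    (E := cubicPart m r S x h j) (a := h j ^ 2 / 2 * partialDeriv m ![j, j] x)
    (C₀ := M * (S * relSum r h) ^ 2) (C₁ := h j * (M * (S * relSum r h)))
    (C₂ := M * (S * relSum r h) * (S * h j) ^ 2)
    (hfc.measurable.comp hup) (((hp1.comp hup).sub_const _).const_mul _)
    (fun u v huv => by simp only [hupd u v huv]) (fun u => hfc.bound _)
    (fun u v huv => by simp only [hupd u v huv])
    (fun u => by
      rw [abs_mul, abs_of_pos hh]
      exact mul_le_mul_of_nonneg_left (hm.abs_partialDeriv_sub_le hM hS hw (by norm_num) _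
        (clampBox_mem hS hw _)) hh.le)
    { measurable := by
        unfold cubicPart
        exact ((hfc.measurable.sub (hfc.measurable.comp hup)).sub
          ((hcl.sub_const _).mul ((hp1.comp hup).sub_const _))).sub
          ((((hcl.sub_const _).pow_const 2).div_const 2).mul_const _)
      depends := fun u v huv => by
        unfold cubicPart
        rw [hfc.depends u v huv, hfc.depends _ _ (update_congr_of_lt huv j (x j)),
          clampBox_congr huv, clampBox_congr (update_congr_of_lt huv j (x j))]
      bound := hm.abs_cubicPart_le hM hS hw hj }
    (fun u hu => by
      have h1 := clampBox_of_abs_lt (r := r) hj (abs_lt_of_wt_ne_zero hb hw hu j)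
      rw [cubicPart, h1]
      field_simp
      ring)
  refine le_of_eq_of_le (congrArg _ ?_) key
  ring

end Taylor

/-! ### The local linear estimate in rescaled coordinates -/

section Rescaling

variable {n d : ℕ} {K : ℝ → ℝ} {X : Fin n → Fin d → ℝ} {x h : Fin d → ℝ}

lemma scaledKernel_eq_wt (K : ℝ → ℝ) (x h u : Fin d → ℝ) :
    scaledKernel K h (u - x) = wt K none x h u := by
  simp [scaledKernel, wt, kfac]

lemma gramMatrix_eq (K : ℝ → ℝ) (X : Fin n → Fin d → ℝ) (x h : Fin d → ℝ) :
    gramMatrix K X x h =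
      (n : ℝ) • wGram (fun i => localRow x (X i)) fun i => wt K none x h (X i) := by
  ext k l
  rcases Nat.eq_zero_or_pos n with rfl | hn
  · simp [gramMatrix, Matrix.mul_apply]
  have hn' : (n : ℝ) ≠ 0 := by positivity
  rw [gramMatrix, weightMatrix, Matrix.mul_apply]
  simp only [Matrix.mul_diagonal, Matrix.transpose_apply, designMatrix, Matrix.of_apply,
    Matrix.smul_apply, wGram, smul_eq_mul, scaledKernel_eq_wt]
  rw [mul_inv_cancel_left₀ hn']
  exact Finset.sum_congr rfl fun i _ => by ring

lemma effW_smul_rows {p : Type*} [Fintype p] [DecidableEq p] {z : p} {c : p → ℝ}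
    (hc : ∀ k, c k ≠ 0) (hz : c z = 1) (ρ : Fin n → p → ℝ) (w : Fin n → ℝ) (i : Fin n) :
    effW z (fun i k => c k * ρ i k) w i = effW z ρ w i := by
  have h1 : wGram (fun i k => c k * ρ i k) w =
      Matrix.diagonal c * wGram ρ w * Matrix.diagonal c := by
    ext k l
    simp only [wGram, Matrix.of_apply, Matrix.diagonal_mul, Matrix.mul_diagonal, Finset.mul_sum,
      Finset.sum_mul]
    exact Finset.sum_congr rfl fun i _ => by ring
  have h2 : (Matrix.diagonal c)⁻¹ = Matrix.diagonal fun k => (c k)⁻¹ := by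
    refine Matrix.inv_eq_left_inv ?_
    rw [Matrix.diagonal_mul_diagonal]
    simp [inv_mul_cancel₀ (hc _)]
  have h3 : (fun k => c k * ρ i k) = Matrix.diagonal c *ᵥ ρ i := by
    funext k; rw [Matrix.mulVec_diagonal]
  have hu : IsUnit (Matrix.diagonal c).det := by
    rw [Matrix.det_diagonal, isUnit_iff_ne_zero]
    exact Finset.prod_ne_zero_iff.mpr fun k _ => hc k
  simp only [effW, icept_dotProduct]
  rw [h1, h3, Matrix.mul_inv_rev, Matrix.mul_inv_rev, Matrix.mulVec_mulVec, Matrix.mul_assoc,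
    Matrix.mul_assoc, Matrix.nonsing_inv_mul _ hu, Matrix.mul_one, h2, ← Matrix.mulVec_mulVec,
    Matrix.mulVec_diagonal, hz, inv_one, one_mul]

lemma localRow_eq (hh : ∀ i, h i ≠ 0) (u : Fin d → ℝ) :
    localRow x u = fun k => (Fin.cons 1 h : Fin (d + 1) → ℝ) k * vrow x h u k := by
  funext k
  refine Fin.cases ?_ (fun i => ?_) k
  · simp [localRow, vrow]
  · simp only [localRow, vrow, Fin.cons_succ, Pi.sub_apply]
    field_simp [hh i]

/-- The effective kernel in coordinates rescaled by a fixed bandwidth vector `h`. -/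
lemma effKernel_eq_effW (hh : ∀ i, h i ≠ 0) (h' : Fin d → ℝ) (i : Fin n) :
    effKernel K X (X i) x h' =
      effW 0 (fun i => vrow x h (X i)) (fun i => wt K none x h' (X i)) i := by
  have hn' : (n : ℝ) ≠ 0 := by
    have := i.pos
    positivity
  rw [← effW_smul_rows (z := (0 : Fin (d + 1))) (c := Fin.cons 1 h)
    (fun k => by refine Fin.cases ?_ (fun i => ?_) k <;> simp [hh]) rfl]
  rw [show (fun (i : Fin n) k => (Fin.cons 1 h : Fin (d + 1) → ℝ) k * vrow x h (X i) k) =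
    fun i => localRow x (X i) from funext fun i => (localRow_eq hh (X i)).symm]
  rw [effKernel, effW, icept_dotProduct, gramMatrix_eq, scaledKernel_eq_wt]
  have : ((n : ℝ) • wGram (fun i => localRow x (X i)) fun i => wt K none x h' (X i))⁻¹ =
      (n : ℝ)⁻¹ • (wGram (fun i => localRow x (X i)) fun i => wt K none x h' (X i))⁻¹ := by
    by_cases hdet : IsUnit (wGram (fun i => localRow x (X i)) fun i => wt K none x h' (X i)).det
    · have := invertibleOfNonzero hn'
      rw [Matrix.inv_smul _ _ hdet, invOf_eq_inv]
    · rw [Matrix.nonsing_inv_apply_not_isUnit _ hdet, Matrix.nonsing_inv_apply_not_isUnit, smul_zero]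
      rw [Matrix.det_smul]
      intro hcon
      exact hdet (isUnit_of_mul_isUnit_right hcon)
  rw [this, Matrix.smul_mulVec, Pi.smul_apply, smul_eq_mul]
  ring

lemma mHat_eq_sum (Y : Fin n → ℝ) (h' : Fin d → ℝ) :
    mHat K X Y x h' = ∑ i, effKernel K X (X i) x h' * Y i := by
  simp only [mHat, effKernel, Matrix.mulVec, dotProduct, weightMatrix, Matrix.mul_diagonal]
  simp only [Matrix.mul_apply, Matrix.transpose_apply, designMatrix, Matrix.of_apply]

lemma hasDerivAt_wt_update (hh : ∀ i, h i ≠ 0) (j : Fin d) {u : Fin d → ℝ}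
    (hK : DifferentiableAt ℝ K ((u j - x j) / h j)) :
    HasDerivAt (fun t => wt K none x (Function.update h j t) u)
      ((h j)⁻¹ * wt K (some j) x h u) (h j) := by
  have h1 : ∀ t, wt K none x (Function.update h j t) u =
      (K ((u j - x j) / t) / t) * ∏ i ∈ Finset.univ.erase j, K ((u i - x i) / h i) / h i := by
    intro t
    rw [wt, ← Finset.mul_prod_erase _ _ (Finset.mem_univ j)]
    simp only [kfac, Function.update_self, reduceCtorEq, if_false]
    congr 1
    refine Finset.prod_congr rfl fun i hi => ?_
    rw [Function.update_of_ne (Finset.ne_of_mem_erase hi)]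
  have h2 : wt K (some j) x h u = (kerD K ((u j - x j) / h j) / h j) *
      ∏ i ∈ Finset.univ.erase j, K ((u i - x i) / h i) / h i := by
    rw [wt, ← Finset.mul_prod_erase _ _ (Finset.mem_univ j)]
    simp only [kfac, if_true]
    congr 1
    refine Finset.prod_congr rfl fun i hi => ?_
    have : j ≠ i := (Finset.ne_of_mem_erase hi).symm
    simp [this]
  simp_rw [h1]
  refine ((hasDerivAt_scaled (hh j) hK).mul_const _).congr_deriv ?_
  rw [h2]; ring

lemma effD_const_mul {p : Type*} [Fintype p] [DecidableEq p] (z : p) (ρ : Fin n → p → ℝ)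
    (w q : Fin n → ℝ) (c : ℝ) (i : Fin n) :
    effD z ρ w (fun i => c * q i) i = c * effD z ρ w q i := by
  have h1 : wGram ρ (fun i => c * q i) = c • wGram ρ q := by
    ext k l
    simp only [wGram, Matrix.of_apply, Matrix.smul_apply, smul_eq_mul, Finset.mul_sum]
    exact Finset.sum_congr rfl fun i _ => by ring
  simp only [effD, iceptDeriv, h1, Matrix.smul_mulVec, Matrix.mulVec_smul, smul_dotProduct,
    smul_eq_mul]
  ring

/-- The derivative of the effective kernel in the bandwidth `j`, up to the factor `n⁻¹ h_j⁻¹`. -/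
def effDeriv (K : ℝ → ℝ) (X : Fin n → Fin d → ℝ) (x h : Fin d → ℝ) (j : Fin d) (i : Fin n) : ℝ :=
  effD 0 (fun i => vrow x h (X i)) (fun i => wt K none x h (X i))
    (fun i => wt K (some j) x h (X i)) i

lemma hasDerivAt_effKernel (hh : ∀ i, h i ≠ 0)
    (hdet : IsUnit (wGram (fun i => vrow x h (X i)) fun i => wt K none x h (X i)).det) (j : Fin d)
    (hK : ∀ i, DifferentiableAt ℝ K ((X i j - x j) / h j)) (i : Fin n) :
    HasDerivAt (fun t => effKernel K X (X i) x (Function.update h j t))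
      ((n : ℝ)⁻¹ * (h j)⁻¹ * effDeriv K X x h j i) (h j) := by
  simp_rw [effKernel_eq_effW hh]
  have h1 := hasDerivAt_effW (0 : Fin (d + 1)) (fun i => vrow x h (X i))
    (fun t i => wt K none x (Function.update h j t) (X i)) _ (h j)
    (fun i => hasDerivAt_wt_update hh j (hK i)) (by simpa [Function.update_eq_self] using hdet) i
  refine h1.congr_deriv ?_
  rw [effD_const_mul, Function.update_eq_self, effDeriv]
  ring

lemma Z_eq (hh : ∀ i, h i ≠ 0)
    (hdet : IsUnit (wGram (fun i => vrow x h (X i)) fun i => wt K none x h (X i)).det) (j : Fin d)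
    (hK : ∀ i, DifferentiableAt ℝ K ((X i j - x j) / h j)) (Y : Fin n → ℝ) :
    Z K X Y x h j = (h j)⁻¹ * ((n : ℝ)⁻¹ * ∑ i, effDeriv K X x h j i * Y i) := by
  rw [Z, bandwidthDeriv]
  simp_rw [mHat_eq_sum]
  rw [(HasDerivAt.fun_sum fun i _ =>
    (hasDerivAt_effKernel hh hdet j hK i).mul_const (Y i)).deriv, Finset.mul_sum, Finset.mul_sum]
  exact Finset.sum_congr rfl fun i _ => by ring

lemma threshold_eq (hh : ∀ i, 0 < h i)
    (hdet : IsUnit (wGram (fun i => vrow x h (X i)) fun i => wt K none x h (X i)).det) (j : Fin d)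
    (hK : ∀ i, DifferentiableAt ℝ K ((X i j - x j) / h j)) (σ : ℝ) :
    threshold K σ X x h j = (h j)⁻¹ * ((n : ℝ)⁻¹ *
      (√(σ ^ 2 * ∑ i, effDeriv K X x h j i ^ 2) * √(2 * Real.log n))) := by
  rw [threshold, s]
  simp_rw [bandwidthDeriv]
  have h1 : ∀ i, deriv (fun t => effKernel K X (X i) x (Function.update h j t)) (h j) =
      (n : ℝ)⁻¹ * (h j)⁻¹ * effDeriv K X x h j i := fun i =>
    (hasDerivAt_effKernel (fun i => (hh i).ne') hdet j hK i).deriv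
  simp_rw [h1]
  have h2 : σ ^ 2 * ∑ i, ((n : ℝ)⁻¹ * (h j)⁻¹ * effDeriv K X x h j i) ^ 2 =
      ((n : ℝ)⁻¹ * (h j)⁻¹) ^ 2 * (σ ^ 2 * ∑ i, effDeriv K X x h j i ^ 2) := by
    simp only [mul_pow, Finset.mul_sum]
    exact Finset.sum_congr rfl fun i _ => by ring
  have h3 : (0 : ℝ) ≤ (n : ℝ)⁻¹ * (h j)⁻¹ := by
    have := hh j
    positivity
  rw [h2, Real.sqrt_mul (sq_nonneg _), Real.sqrt_sq h3]
  ring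

end Rescaling

/-! ### The tests and the estimate on a good sample -/

/-- The constants of the problem: the support `S` and size `B` of the kernel, its second moment `ν`
and squared norms `κ`, `κ'`, the noise level `σ`, the bound `M` on the derivatives of the regression
function and the lower bound `a` on its relevant second derivatives. -/
structure Consts where
  (S B ν κ κ' σ M a : ℝ)

namespace Consts

/-- Lower bound for the second moments of the weights, in units of `κ ^ d / ∏ h`. -/
def cL (c : Consts) : ℝ := min 1 (c.κ' / c.κ)

/-- Upper bound for the second moments of the weights, in units of `κ ^ d / ∏ h`. -/
def cU (c : Consts) : ℝ := max 1 (c.κ' / c.κ)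

/-- Bound for the `L¹` norms of the factors of the weights. -/
def G (c : Consts) : ℝ := 2 * c.S ^ 2 * c.B

/-- Bound for the inverse of the population Gram matrix. -/
def ι (c : Consts) : ℝ := max 1 |c.ν|⁻¹

/-- Bound for the derivative of the population Gram matrix. -/
def CQ (c : Consts) : ℝ := 2 * |c.ν| + 1

/-- Size of the sampling fluctuations, in units of `rate`. -/
def Cη (c : Consts) : ℝ := 2 * c.S ^ 2 * √c.cU

/-- Constant of the perturbation bounds. -/
def Cθ (c : Consts) : ℝ := 4 * c.ι * (c.ι * c.CQ + 1)

/-- The order of magnitude of the standard deviation of the estimate, up to a logarithm. -/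
def rate (c : Consts) (n : ℕ) {d : ℕ} (h : Fin d → ℝ) : ℝ :=
  √(c.κ ^ d * Real.log n / (n * ∏ i, h i))

/-- Bound for the bias of the estimate. -/
def bias (c : Consts) (r : ℕ) {d : ℕ} (h : Fin d → ℝ) : ℝ :=
  c.M * (c.S * relSum r h) ^ 2 * c.G ^ r

lemma cL_le_one (c : Consts) : c.cL ≤ 1 := min_le_left _ _

lemma one_le_cU (c : Consts) : 1 ≤ c.cU := le_max_left _ _

lemma one_le_ι (c : Consts) : 1 ≤ c.ι := le_max_left _ _

lemma one_le_CQ (c : Consts) : 1 ≤ c.CQ := by simp [CQ]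

lemma Cθ_pos (c : Consts) : 0 < c.Cθ := by
  have := c.one_le_ι
  have := c.one_le_CQ
  unfold Cθ
  positivity

end Consts

/-- The constants `c` are those of the kernel `K`. -/
structure Consts.Valid (c : Consts) (K : ℝ → ℝ) : Prop where
  bounds : KernelBounds K c.S c.B
  moments : KernelMoments K c.ν c.κ c.κ'
  σ_pos : 0 < c.σ
  M_nonneg : 0 ≤ c.M
  a_pos : 0 < c.a

namespace Consts.Valid

variable {c : Consts} {K : ℝ → ℝ}

lemma S_pos (hc : c.Valid K) : 0 < c.S := lt_of_lt_of_le one_pos hc.bounds.one_le_S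

lemma ratio_pos (hc : c.Valid K) : 0 < c.κ' / c.κ := div_pos hc.moments.κ'_pos hc.moments.κ_pos

lemma cL_pos (hc : c.Valid K) : 0 < c.cL := lt_min one_pos hc.ratio_pos

lemma one_le_G (hc : c.Valid K) : 1 ≤ c.G := by
  have := hc.bounds.one_le_S
  have := hc.bounds.one_le_B
  unfold Consts.G
  nlinarith [one_le_pow₀ (n := 2) hc.bounds.one_le_S]

lemma Cη_pos (hc : c.Valid K) : 0 < c.Cη := by
  have := hc.S_pos
  have := c.one_le_cU
  unfold Consts.Cη
  have : 0 < √c.cU := Real.sqrt_pos.mpr (by linarith)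
  positivity

lemma one_le_ι_mul (hc : c.Valid K) (d : ℕ) (k : Fin (d + 1)) :
    1 ≤ c.ι * |(Fin.cons 1 (fun _ => c.ν) : Fin (d + 1) → ℝ) k| := by
  refine Fin.cases ?_ (fun i => ?_) k
  · simpa using c.one_le_ι
  · rw [Fin.cons_succ]
    have h1 : 0 < |c.ν| := abs_pos.mpr hc.moments.ν_ne
    calc (1 : ℝ) = |c.ν|⁻¹ * |c.ν| := (inv_mul_cancel₀ h1.ne').symm
      _ ≤ c.ι * |c.ν| := mul_le_mul_of_nonneg_right (le_max_right _ _) h1.le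

end Consts.Valid

section Good

variable {n d : ℕ}

/-- The weighted averages `n⁻¹ ∑ ρ_k w φ`. -/
def bvec (K : ℝ → ℝ) (X : Fin n → Fin d → ℝ) (x h : Fin d → ℝ) (φ : (Fin d → ℝ) → ℝ)
    (J : Option (Fin d)) (k : Fin (d + 1)) : ℝ :=
  (n : ℝ)⁻¹ * ∑ i, vrow x h (X i) k * wt K J x h (X i) * φ (X i)

/-- The expectation of `bvec`. -/
def popVec (K : ℝ → ℝ) (x h : Fin d → ℝ) (φ : (Fin d → ℝ) → ℝ)
    (J : Option (Fin d)) (k : Fin (d + 1)) : ℝ :=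
  ∫ u, vrow x h u k * wt K J x h u * φ u ∂uniformCube d

/-- The effective kernel at the design points. -/
def effK (K : ℝ → ℝ) (X : Fin n → Fin d → ℝ) (x h : Fin d → ℝ) (i : Fin n) : ℝ :=
  effW 0 (fun i => vrow x h (X i)) (fun i => wt K none x h (X i)) i

/-- The local averages at the bandwidths `h` are close to their expectations, the noise terms are
within their standard deviations up to a logarithm, and the kernel is differentiable where it is
evaluated. -/
structure GoodAt (c : Consts) (K : ℝ → ℝ) (r : ℕ) (x h : Fin d → ℝ) (φ : (Fin d → ℝ) → ℝ)
    (X : Fin n → Fin d → ℝ) (ξ : Fin n → ℝ) : Prop where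
  gram : ∀ J k l, |wGram (fun i => vrow x h (X i)) (fun i => wt K J x h (X i)) k l -
    popGram c.ν J k l| ≤ c.Cη * c.rate n h
  vec : ∀ J k, |bvec K X x h φ J k - popVec K x h φ J k| ≤ c.bias r h * (c.Cη * c.rate n h)
  sq : ∀ J, |(n : ℝ)⁻¹ * ∑ i, wt K J x h (X i) ^ 2 - ∫ u, wt K J x h u ^ 2 ∂uniformCube d| ≤
    (∫ u, wt K J x h u ^ 2 ∂uniformCube d) / 2
  noise_deriv : ∀ j, |∑ i, effDeriv K X x h j i * ξ i| ≤
    √(2 * Real.log n) / 2 * √(c.σ ^ 2 * ∑ i, effDeriv K X x h j i ^ 2)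
  noise : |∑ i, effK K X x h i * ξ i| ≤
    √(2 * Real.log n) / 2 * √(c.σ ^ 2 * ∑ i, effK K X x h i ^ 2)
  diff : ∀ i j, DifferentiableAt ℝ K ((X i j - x j) / h j)

/-- Conditions on the bandwidths `h` under which the asymptotic approximations hold. -/
structure Small (c : Consts) (n r : ℕ) (x h : Fin d → ℝ) : Prop where
  window : InWindow c.S x h
  two_le : 2 ≤ n
  bernstein : 16 * c.B ^ (2 * d) * Real.log n ≤ n * (∏ i, h i) * (c.cL * c.κ ^ d)
  fluct : (d + 1) * (8 * c.Cθ * c.S * c.Cη * (1 + 3 * c.cU / c.cL) * c.rate n h) ≤ 1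
  bias : 16 * c.Cθ * c.Cη * (r + 2) * c.bias r h ≤ c.σ * √c.cL / 2
  curv : 2 * c.M * c.S ^ 3 * c.G ^ r * relSum r h ≤ |c.ν| * c.a

variable {c : Consts} {K : ℝ → ℝ} {r : ℕ} {x h : Fin d → ℝ} {φ : (Fin d → ℝ) → ℝ}
  {X : Fin n → Fin d → ℝ} {ξ : Fin n → ℝ}

lemma rate_nonneg : 0 ≤ c.rate n h := Real.sqrt_nonneg _

lemma bias_nonneg (hc : c.Valid K) : 0 ≤ c.bias r h := by
  have := hc.M_nonneg
  have := hc.one_le_G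
  unfold Consts.bias
  positivity

lemma Small.log_pos (hs : Small c n r x h) : 0 < Real.log n :=
  Real.log_pos (by exact_mod_cast (by have := hs.two_le; omega : 1 < n))

lemma Small.prod_pos (hs : Small c n r x h) : 0 < ∏ i, h i :=
  Finset.prod_pos fun i _ => (hs.window i).1

lemma Small.mul_rate_le (hc : c.Valid K) (hs : Small c n r x h) :
    Fintype.card (Fin (d + 1)) * c.ι * (c.Cη * c.rate n h) ≤ 1 / 2 := by
  have h1 := hs.fluct
  have hι := c.one_le_ι
  have hQ := c.one_le_CQ
  have hS := hc.bounds.one_le_S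
  have hη := hc.Cη_pos
  have hr : 0 ≤ c.rate n h := rate_nonneg
  have hL := hc.cL_pos
  have hU := c.one_le_cU
  have hq : 0 ≤ 3 * c.cU / c.cL := by positivity
  have h2 : c.ι ≤ c.Cθ * c.S := by
    have h3 : c.ι ≤ c.Cθ := by
      unfold Consts.Cθ
      have : 0 ≤ c.ι * c.CQ := by positivity
      nlinarith
    nlinarith [c.Cθ_pos]
  have h4 : (d + 1) * (c.ι * (c.Cη * c.rate n h)) * 8 ≤
      (d + 1) * (8 * c.Cθ * c.S * c.Cη * (1 + 3 * c.cU / c.cL) * c.rate n h) := by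
    have h5 : c.ι * (c.Cη * c.rate n h) ≤ c.Cθ * c.S * (c.Cη * c.rate n h) := by gcongr
    have h6 : c.Cθ * c.S * (c.Cη * c.rate n h) * 1 ≤
        c.Cθ * c.S * (c.Cη * c.rate n h) * (1 + 3 * c.cU / c.cL) := by
      have := c.Cθ_pos
      gcongr
      linarith
    calc _ = (d + 1) * (8 * (c.ι * (c.Cη * c.rate n h))) := by ring
      _ ≤ (d + 1) * (8 * (c.Cθ * c.S * (c.Cη * c.rate n h) * (1 + 3 * c.cU / c.cL))) := by
        rw [mul_one] at h6
        have h7 := h5.trans h6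
        exact mul_le_mul_of_nonneg_left (mul_le_mul_of_nonneg_left h7 (by norm_num)) (by positivity)
      _ = _ := by ring
  simp only [Fintype.card_fin]
  push_cast
  nlinarith

/-- The relevant coordinates, together with the intercept. -/
def relSet (d r : ℕ) : Finset (Fin (d + 1)) := Finset.univ.filter fun k => (k : ℕ) ≤ r

lemma card_relSet_le (d r : ℕ) : ((relSet d r).card : ℝ) ≤ r + 1 := by
  have : (relSet d r).card ≤ (Finset.range (r + 1)).card :=
    Finset.card_le_card_of_injOn (fun k => (k : ℕ)) (fun k hk => by
      simp only [relSet, Finset.coe_filter, Finset.mem_univ, true_and, Set.mem_ofPred_eq] at hk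
      simpa using Nat.lt_succ_of_le hk) (fun a _ b _ hab => Fin.ext hab)
  rw [Finset.card_range] at this
  exact_mod_cast this

variable {m : (Fin d → ℝ) → ℝ}

lemma abs_popVec_le (hc : c.Valid K) (hw : InWindow c.S x h) (hm : HasBoundedDerivs m c.M)
    (J : Option (Fin d)) (k : Fin (d + 1)) :
    |popVec K x h (remainder m r c.S x h) J k| ≤ c.bias r h ∧
      (k ∉ relSet d r → popVec K x h (remainder m r c.S x h) J k = 0) ∧
      ((∃ j : Fin d, r ≤ (j : ℕ) ∧ J = some j) →
        popVec K x h (remainder m r c.S x h) J k = 0) := by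
  have hfc := hm.isFirstCoords_remainder (r := r) hc.M_nonneg hc.bounds.one_le_S hw
  have h1 := abs_integral_vrow_wt_mul_le hc.bounds hc.moments hw hfc J k
  refine ⟨h1.1, fun hk => h1.2 (Or.inl ?_), fun hJ => h1.2 (Or.inr hJ)⟩
  simp only [relSet, Finset.mem_filter, Finset.mem_univ, true_and, not_le] at hk
  have hk0 : k ≠ 0 := fun h0 => by simp [h0] at hk
  obtain ⟨i, rfl⟩ := Fin.exists_succ_eq.mpr hk0
  refine ⟨i, ?_, rfl⟩
  rw [Fin.val_succ] at hk
  omega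

lemma popGram_none_close (hg : GoodAt c K r x h φ X ξ) (k l : Fin (d + 1)) :
    |wGram (fun i => vrow x h (X i)) (fun i => wt K none x h (X i)) k l -
      Matrix.diagonal (Fin.cons 1 fun _ => c.ν) k l| ≤ c.Cη * c.rate n h := hg.gram none k l

lemma GoodAt.isUnit_det (hc : c.Valid K) (hs : Small c n r x h) (hg : GoodAt c K r x h φ X ξ) :
    IsUnit (wGram (fun i => vrow x h (X i)) fun i => wt K none x h (X i)).det :=
  isUnit_det_of_near_diagonal (by linarith [c.one_le_ι]) (hc.one_le_ι_mul d)
    (popGram_none_close hg) (hs.mul_rate_le hc)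

/-- The conditional mean of the derivative statistic. -/
lemma GoodAt.abs_mean_effDeriv_sub_le (hc : c.Valid K) (hs : Small c n r x h)
    (hm : HasBoundedDerivs m c.M) (hg : GoodAt c K r x h (remainder m r c.S x h) X ξ) (j : Fin d) :
    |(n : ℝ)⁻¹ * ∑ i, effDeriv K X x h j i * remainder m r c.S x h (X i) -
        popVec K x h (remainder m r c.S x h) (some j) 0| ≤
      2 * c.Cθ * (r + 2) * (c.bias r h * (c.Cη * c.rate n h)) := by
  have hη0 : 0 ≤ c.Cη * c.rate n h := mul_nonneg hc.Cη_pos.le rate_nonneg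
  have hb0 : 0 ≤ c.bias r h := bias_nonneg hc
  simp only [effDeriv]
  rw [sum_effD_mul]
  refine (abs_effD_mean_sub_le (j := j.succ) (q₀ := 2 * c.ν) (C := c.CQ) (R := relSet d r)
    (b₀ := popVec K x h (remainder m r c.S x h) none)
    (c₀ := popVec K x h (remainder m r c.S x h) (some j))
    (ϱ := c.bias r h) (Fin.succ_ne_zero j) c.one_le_ι hη0 hb0
    (hc.one_le_ι_mul d) rfl ?_ (popGram_none_close hg) (hg.gram (some j)) (hs.mul_rate_le hc)
    (hg.vec none) (fun k => (abs_popVec_le hc hs.window hm none k).1)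
    (fun k => (abs_popVec_le hc hs.window hm none k).2.1)
    (hg.vec (some j)) (fun k => (abs_popVec_le hc hs.window hm (some j) k).1)
    (fun k => (abs_popVec_le hc hs.window hm (some j) k).2.1)).trans ?_
  · rw [abs_mul, abs_two, Consts.CQ]; linarith
  · have h1 := card_relSet_le d r
    have h2 := c.Cθ_pos
    have h3 : 8 * c.ι * (c.ι * c.CQ + 1) = 2 * c.Cθ := by unfold Consts.Cθ; ring
    have h4 : ((relSet d r).card : ℝ) + 1 ≤ r + 2 := by linarith
    rw [h3]
    exact mul_le_mul_of_nonneg_right (mul_le_mul_of_nonneg_left h4 (by positivity))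
      (mul_nonneg hb0 hη0)

/-- The sum of squares of the derivative of the effective kernel. -/
lemma GoodAt.sum_sq_effDeriv (hc : c.Valid K) (hs : Small c n r x h)
    (hg : GoodAt c K r x h φ X ξ) (j : Fin d) :
    c.cL / 8 * (c.κ ^ d / ∏ i, h i) ≤ (n : ℝ)⁻¹ * ∑ i, effDeriv K X x h j i ^ 2 ∧
      (n : ℝ)⁻¹ * ∑ i, effDeriv K X x h j i ^ 2 ≤ 4 * c.cU * (c.κ ^ d / ∏ i, h i) := by
  have hn : 0 < (n : ℝ)⁻¹ := by have := hs.two_le; positivity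
  have hη0 : 0 ≤ c.Cη * c.rate n h := mul_nonneg hc.Cη_pos.le rate_nonneg
  set e := c.κ ^ d / ∏ i, h i with he
  have he0 : 0 < e := div_pos (pow_pos hc.moments.κ_pos d) hs.prod_pos
  set ζ := Fintype.card (Fin (d + 1)) * (4 * c.ι * (c.ι * c.CQ + 1) * (c.Cη * c.rate n h) * c.S)
    with hζ
  have hpert := sum_sq_perturb (ζ := ζ) (A := effDeriv K X x h j)
    (q := fun i => wt K (some j) x h (X i)) (w := fun i => wt K none x h (X i)) fun i => by
      refine abs_effD_sub_le (j := j.succ) (q₀ := 2 * c.ν) (C := c.CQ) (Fin.succ_ne_zero j)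
        hc.bounds.one_le_S c.one_le_ι hη0 (hc.one_le_ι_mul d) rfl ?_ c.one_le_CQ
        (popGram_none_close hg) (hg.gram (some j)) (hs.mul_rate_le hc) i rfl ?_
      · rw [abs_mul, abs_two, Consts.CQ]; linarith
      · rintro (hw | hw) k
        · exact abs_vrow_le hc.bounds hs.window hw k
        · exact abs_vrow_le hc.bounds hs.window hw k
  have hL := hc.cL_pos
  have hU := c.one_le_cU
  have hζT : ζ * (2 * (1 + 3 * c.cU / c.cL)) * 4 ≤ 4 := by
    have h1 := hs.fluct
    have : ζ * (2 * (1 + 3 * c.cU / c.cL)) * 4 =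
      (d + 1) * (8 * c.Cθ * c.S * c.Cη * (1 + 3 * c.cU / c.cL) * c.rate n h) := by
      rw [hζ, Consts.Cθ]; simp only [Fintype.card_fin]; push_cast; ring
    linarith
  have hζ0 : 0 ≤ ζ := by
    have := hc.S_pos
    have := c.one_le_ι
    have := c.one_le_CQ
    rw [hζ]; positivity
  have hq0 : 0 ≤ 3 * c.cU / c.cL := by positivity
  have hζsq : ζ ^ 2 * (1 + 3 * c.cU / c.cL) ≤ 1 / 8 := by
    have h1 : ζ * (1 + 3 * c.cU / c.cL) ≤ 1 / 8 := by
      have h1 := hs.fluct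
      have : ζ * (1 + 3 * c.cU / c.cL) * 2 =
        (d + 1) * (8 * c.Cθ * c.S * c.Cη * (1 + 3 * c.cU / c.cL) * c.rate n h) / 4 := by
        rw [hζ, Consts.Cθ]; simp only [Fintype.card_fin]; push_cast; ring
      linarith
    have h2 : ζ ≤ 1 := by nlinarith
    nlinarith
  -- second moments of the two families of weights
  have hq := hg.sq (some j)
  have hw := hg.sq none
  have mq := integral_wt_sq hc.bounds hc.moments hs.window (some j)
  have mw := integral_wt_sq hc.bounds hc.moments hs.window none
  rw [← he] at mq mw
  change c.cL * e ≤ _ ∧ _ ≤ c.cU * e at mq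
  change c.cL * e ≤ _ ∧ _ ≤ c.cU * e at mw
  rw [abs_le] at hq hw
  set SQ := (n : ℝ)⁻¹ * ∑ i, wt K (some j) x h (X i) ^ 2 with hSQ
  set SW := (n : ℝ)⁻¹ * ∑ i, wt K none x h (X i) ^ 2 with hSW
  set SA := (n : ℝ)⁻¹ * ∑ i, effDeriv K X x h j i ^ 2 with hSA
  have hp1 : SQ / 2 - 2 * ζ ^ 2 * (SQ + SW) ≤ SA := by
    have := mul_le_mul_of_nonneg_left hpert.1 hn.le
    rw [hSQ, hSW, hSA]; linarith
  have hp2 : SA ≤ 2 * SQ + 4 * ζ ^ 2 * (SQ + SW) := by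
    have := mul_le_mul_of_nonneg_left hpert.2 hn.le
    rw [hSQ, hSW, hSA]; linarith
  have hSQ1 : c.cL / 2 * e ≤ SQ := by linarith [mq.1, hq.1]
  have hSQ2 : SQ ≤ 3 / 2 * c.cU * e := by linarith [mq.2, hq.2]
  have hSW2 : SW ≤ 3 / 2 * c.cU * e := by linarith [mw.2, hw.2]
  have hSW3 : SW ≤ 3 * c.cU / c.cL * SQ := by
    have h1 : 3 * c.cU / c.cL * (c.cL / 2 * e) = 3 / 2 * c.cU * e := by field_simp
    have h2 := mul_le_mul_of_nonneg_left hSQ1 hq0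
    linarith
  have hSQ0 : 0 ≤ SQ := le_trans (by positivity) hSQ1
  have hz : ζ ^ 2 * (SQ + SW) ≤ SQ / 8 := by
    have h1 := mul_le_mul_of_nonneg_left hSW3 (sq_nonneg ζ)
    have h2 := mul_le_mul_of_nonneg_right hζsq hSQ0
    nlinarith
  constructor
  · linarith
  · nlinarith [mul_nonneg (by linarith : 0 ≤ c.cU) he0.le]

lemma GoodAt.threshold_bounds (hc : c.Valid K) (hs : Small c n r x h)
    (hg : GoodAt c K r x h φ X ξ) (j : Fin d) :
    c.σ * √c.cL / 2 * c.rate n h ≤ h j * threshold K c.σ X x h j ∧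
      h j * threshold K c.σ X x h j ≤ 3 * c.σ * √c.cU * c.rate n h ∧
      h j * threshold K c.σ X x h j = (n : ℝ)⁻¹ *
        (√(c.σ ^ 2 * ∑ i, effDeriv K X x h j i ^ 2) * √(2 * Real.log n)) := by
  have hn : (0 : ℝ) < n := by have := hs.two_le; positivity
  have hlog := hs.log_pos
  have hσ := hc.σ_pos
  have heq := threshold_eq (fun i => (hs.window i).1) (hg.isUnit_det hc hs) j
    (fun i => hg.diff i j) c.σ
  have heq' : h j * threshold K c.σ X x h j = (n : ℝ)⁻¹ *
      (√(c.σ ^ 2 * ∑ i, effDeriv K X x h j i ^ 2) * √(2 * Real.log n)) := by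
    rw [heq, mul_inv_cancel_left₀ (hs.window j).1.ne']
  obtain ⟨h1, h2⟩ := hg.sum_sq_effDeriv hc hs j
  have hA0 : 0 ≤ ∑ i, effDeriv K X x h j i ^ 2 := Finset.sum_nonneg fun i _ => sq_nonneg _
  set T := h j * threshold K c.σ X x h j with hT
  have hT0 : 0 ≤ T := by rw [heq']; positivity
  have hrate0 : 0 ≤ c.rate n h := rate_nonneg
  have hratesq : c.rate n h ^ 2 = (c.κ ^ d / ∏ i, h i) * (Real.log n / n) := by
    have := hs.prod_pos
    have := hc.moments.κ_pos
    rw [Consts.rate, Real.sq_sqrt (by positivity)]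
    field_simp
  have hTsq : T ^ 2 = 2 * c.σ ^ 2 * (((n : ℝ)⁻¹ * ∑ i, effDeriv K X x h j i ^ 2) *
      (Real.log n / n)) := by
    rw [heq', mul_pow, mul_pow, Real.sq_sqrt (by positivity), Real.sq_sqrt (by positivity)]
    field_simp
  have hLn : 0 ≤ Real.log n / n := by positivity
  have hL := hc.cL_pos
  have hU := c.one_le_cU
  refine ⟨?_, ?_, heq'⟩
  · refine (abs_le_of_sq_le_sq' ?_ hT0).2
    have e1 : (c.σ * √c.cL / 2 * c.rate n h) ^ 2 = 2 * c.σ ^ 2 *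
        ((c.cL / 8 * (c.κ ^ d / ∏ i, h i)) * (Real.log n / n)) := by
      rw [mul_pow, div_pow, mul_pow, Real.sq_sqrt hL.le, hratesq]; ring
    rw [hTsq, e1]
    gcongr
  · refine (abs_le_of_sq_le_sq' ?_ (by positivity)).2
    have e1 : (3 * c.σ * √c.cU * c.rate n h) ^ 2 = (9 / 8) * (2 * c.σ ^ 2 *
        ((4 * c.cU * (c.κ ^ d / ∏ i, h i)) * (Real.log n / n))) := by
      rw [mul_pow, mul_pow, mul_pow, Real.sq_sqrt (by linarith), hratesq]; ring
    have e2 : T ^ 2 ≤ 2 * c.σ ^ 2 *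
        ((4 * c.cU * (c.κ ^ d / ∏ i, h i)) * (Real.log n / n)) := by
      rw [hTsq]; gcongr
    rw [e1]
    have : 0 ≤ T ^ 2 := sq_nonneg T
    linarith

/-- The coefficients of the affine part of `m`, in rescaled coordinates. -/
def affineCoeff (m : (Fin d → ℝ) → ℝ) (r : ℕ) (x h : Fin d → ℝ) : Fin (d + 1) → ℝ :=
  Fin.cons (m x) fun j => if (j : ℕ) < r then partialDeriv m ![j] x * h j else 0

lemma eq_affineCoeff_add (hc : c.Valid K) (hs : Small c n r x h) (hdep : DependsOnFirst r m)
    {u : Fin d → ℝ} (hu : ∀ j, |u j - x j| < c.S * h j) :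
    m u = vrow x h u ⬝ᵥ affineCoeff m r x h + remainder m r c.S x h u := by
  rw [eq_affine_add_remainder hc.bounds.one_le_S hs.window hdep hu, dotProduct, Fin.sum_univ_succ]
  simp only [vrow, affineCoeff, Fin.cons_zero, Fin.cons_succ, one_mul]
  congr 2
  refine Finset.sum_congr rfl fun j _ => ?_
  have := (hs.window j).1.ne'
  split_ifs
  · field_simp
  · simp

lemma effDeriv_eq_zero (hc : c.Valid K) (hs : Small c n r x h) (j : Fin d) {i : Fin n}
    (hi : ¬ ∀ j, |X i j - x j| < c.S * h j) : effDeriv K X x h j i = 0 := by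
  have hw : ∀ J, wt K J x h (X i) = 0 := fun J => by
    by_contra hne
    exact hi (abs_lt_of_wt_ne_zero hc.bounds hs.window hne)
  simp [effDeriv, effD, hw]

lemma effK_eq_zero (hc : c.Valid K) (hs : Small c n r x h) {i : Fin n}
    (hi : ¬ ∀ j, |X i j - x j| < c.S * h j) : effK K X x h i = 0 := by
  have hw : wt K none x h (X i) = 0 := by
    by_contra hne
    exact hi (abs_lt_of_wt_ne_zero hc.bounds hs.window hne)
  simp [effK, effW, hw]

/-- The statistic `Z_j` is within its threshold of its leading term. -/
lemma GoodAt.abs_Z_sub_le (hc : c.Valid K) (hs : Small c n r x h) (hm : HasBoundedDerivs m c.M)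
    (hdep : DependsOnFirst r m) (hg : GoodAt c K r x h (remainder m r c.S x h) X ξ) (j : Fin d) :
    |h j * Z K X (fun i => m (X i) + ξ i) x h j -
        popVec K x h (remainder m r c.S x h) (some j) 0| ≤
      h j * threshold K c.σ X x h j / 2 + c.σ * √c.cL / 2 / 8 * c.rate n h := by
  have hh := (hs.window j).1
  obtain ⟨-, -, hT⟩ := hg.threshold_bounds hc hs j
  have hZ := Z_eq (fun i => (hs.window i).1.ne') (hg.isUnit_det hc hs) j
    (fun i => hg.diff i j) (fun i => m (X i) + ξ i)
  have hsum : ∑ i, effDeriv K X x h j i * (m (X i) + ξ i) =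
      ∑ i, effDeriv K X x h j i * remainder m r c.S x h (X i) +
        ∑ i, effDeriv K X x h j i * ξ i := by
    have h0 := sum_effD_linear 0 (fun i => vrow x h (X i)) (fun i => wt K none x h (X i))
      (fun i => wt K (some j) x h (X i)) (hg.isUnit_det hc hs) (affineCoeff m r x h)
    rw [← sub_eq_zero, ← h0, ← Finset.sum_add_distrib, ← Finset.sum_sub_distrib]
    refine Finset.sum_congr rfl fun i _ => ?_
    by_cases hi : ∀ j, |X i j - x j| < c.S * h j
    · rw [eq_affineCoeff_add hc hs hdep hi, effDeriv]; ring
    · have := effDeriv_eq_zero hc hs j hi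
      rw [this]
      rw [effDeriv] at this
      rw [this]; ring
  have hZ' : h j * Z K X (fun i => m (X i) + ξ i) x h j =
      (n : ℝ)⁻¹ * ∑ i, effDeriv K X x h j i * remainder m r c.S x h (X i) +
        (n : ℝ)⁻¹ * ∑ i, effDeriv K X x h j i * ξ i := by
    rw [hZ, mul_inv_cancel_left₀ hh.ne', hsum]; ring
  have h1 := hg.abs_mean_effDeriv_sub_le hc hs hm j
  have h2 : |(n : ℝ)⁻¹ * ∑ i, effDeriv K X x h j i * ξ i| ≤
      h j * threshold K c.σ X x h j / 2 := by
    rw [abs_mul, abs_of_nonneg (by positivity : (0 : ℝ) ≤ (n : ℝ)⁻¹), hT]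
    calc _ ≤ (n : ℝ)⁻¹ * (√(2 * Real.log n) / 2 *
        √(c.σ ^ 2 * ∑ i, effDeriv K X x h j i ^ 2)) := by gcongr; exact hg.noise_deriv j
      _ = _ := by ring
  have h3 : 2 * c.Cθ * (r + 2) * (c.bias r h * (c.Cη * c.rate n h)) ≤
      c.σ * √c.cL / 2 / 8 * c.rate n h := by
    have := mul_le_mul_of_nonneg_right hs.bias (rate_nonneg (c := c) (n := n) (h := h))
    linarith
  rw [hZ', add_sub_right_comm]
  exact (abs_add_le _ _).trans (by linarith)

/-- The test of an irrelevant covariate is negative. -/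
lemma GoodAt.abs_Z_le_of_irrelevant (hc : c.Valid K) (hs : Small c n r x h)
    (hm : HasBoundedDerivs m c.M) (hdep : DependsOnFirst r m)
    (hg : GoodAt c K r x h (remainder m r c.S x h) X ξ) {j : Fin d} (hj : r ≤ (j : ℕ)) :
    |Z K X (fun i => m (X i) + ξ i) x h j| ≤ threshold K c.σ X x h j := by
  have hh := (hs.window j).1
  have h1 := hg.abs_Z_sub_le hc hs hm hdep j
  rw [(abs_popVec_le hc hs.window hm (some j) 0).2.2 ⟨j, hj, rfl⟩, sub_zero, abs_mul,
    abs_of_pos hh] at h1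
  have h2 := (hg.threshold_bounds hc hs j).1
  have h3 : 0 ≤ c.σ * √c.cL / 2 * c.rate n h := by
    have := hc.σ_pos
    have := rate_nonneg (c := c) (n := n) (h := h)
    positivity
  refine le_of_mul_le_mul_left ?_ hh
  linarith

lemma abs_popVec_some_sub_le (hc : c.Valid K) (hs : Small c n r x h)
    (hm : HasBoundedDerivs m c.M) {j : Fin d} (hj : (j : ℕ) < r) :
    |popVec K x h (remainder m r c.S x h) (some j) 0 -
      c.ν * (h j ^ 2 * partialDeriv m ![j, j] x)| ≤ |c.ν| * c.a / 2 * h j ^ 2 := by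
  have h1 := hm.abs_integral_wt_remainder_sub_le hc.M_nonneg hc.bounds hc.moments hs.window hj
  have h2 : popVec K x h (remainder m r c.S x h) (some j) 0 =
      ∫ u, wt K (some j) x h u * remainder m r c.S x h u ∂uniformCube d := by
    simp [popVec, vrow]
  rw [h2]
  refine h1.trans ?_
  have h3 := mul_le_mul_of_nonneg_right hs.curv (sq_nonneg (h j))
  have h4 : c.M * (c.S * relSum r h) * (c.S * h j) ^ 2 * (2 * c.S ^ 2 * c.B) ^ r =
      (2 * c.M * c.S ^ 3 * c.G ^ r * relSum r h * h j ^ 2) / 2 := by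
    unfold Consts.G; ring
  linarith

/-- The test of a relevant covariate is positive if the bandwidth is large. -/
lemma GoodAt.lt_abs_Z (hc : c.Valid K) (hs : Small c n r x h)
    (hm : HasBoundedDerivs m c.M) (hdep : DependsOnFirst r m)
    (hg : GoodAt c K r x h (remainder m r c.S x h) X ξ) {j : Fin d} (hj : (j : ℕ) < r)
    (ha : c.a ≤ |partialDeriv m ![j, j] x|)
    (hbig : 12 * c.σ * √c.cU * c.rate n h < |c.ν| * c.a * h j ^ 2) :
    threshold K c.σ X x h j < |Z K X (fun i => m (X i) + ξ i) x h j| := by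
  have hh := (hs.window j).1
  have h1 := hg.abs_Z_sub_le hc hs hm hdep j
  have h2 := abs_popVec_some_sub_le hc hs hm hj
  obtain ⟨hT1, hT2, -⟩ := hg.threshold_bounds hc hs j
  have h3 : |c.ν| * c.a * h j ^ 2 ≤ |c.ν * (h j ^ 2 * partialDeriv m ![j, j] x)| := by
    rw [abs_mul, abs_mul, abs_of_nonneg (sq_nonneg (h j))]
    have := mul_le_mul_of_nonneg_left ha (mul_nonneg (abs_nonneg c.ν) (sq_nonneg (h j)))
    linarith
  have h4 : 0 ≤ c.σ * √c.cL / 2 * c.rate n h := by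
    have := hc.σ_pos
    have := rate_nonneg (c := c) (n := n) (h := h)
    positivity
  have h5 := abs_sub_abs_le_abs_sub (c.ν * (h j ^ 2 * partialDeriv m ![j, j] x))
    (popVec K x h (remainder m r c.S x h) (some j) 0)
  rw [abs_sub_comm] at h5
  have h6 := abs_sub_abs_le_abs_sub (popVec K x h (remainder m r c.S x h) (some j) 0)
    (h j * Z K X (fun i => m (X i) + ξ i) x h j)
  rw [abs_sub_comm (popVec K x h (remainder m r c.S x h) (some j) 0), abs_mul (h j),
    abs_of_pos hh] at h6
  refine lt_of_mul_lt_mul_left ?_ hh.le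
  linarith

/-- The test of a relevant covariate is negative if the bandwidth is small. -/
lemma GoodAt.abs_Z_le_of_small (hc : c.Valid K) (hs : Small c n r x h)
    (hm : HasBoundedDerivs m c.M) (hdep : DependsOnFirst r m)
    (hg : GoodAt c K r x h (remainder m r c.S x h) X ξ) {j : Fin d} (hj : (j : ℕ) < r)
    (hsmall : |c.ν| * (c.M + c.a) * h j ^ 2 ≤ c.σ * √c.cL / 8 * c.rate n h) :
    |Z K X (fun i => m (X i) + ξ i) x h j| ≤ threshold K c.σ X x h j := by
  have hh := (hs.window j).1
  have h1 := hg.abs_Z_sub_le hc hs hm hdep j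
  have h2 := abs_popVec_some_sub_le hc hs hm hj
  obtain ⟨hT1, hT2, -⟩ := hg.threshold_bounds hc hs j
  have hx : x ∈ openCube d :=
    boxSlice_subset hc.bounds.one_le_S hs.window (self_mem_boxSlice (r := 0) hc.bounds.one_le_S
      hs.window)
  have h3 : |c.ν * (h j ^ 2 * partialDeriv m ![j, j] x)| ≤ |c.ν| * c.M * h j ^ 2 := by
    rw [abs_mul, abs_mul, abs_of_nonneg (sq_nonneg (h j))]
    have := mul_le_mul_of_nonneg_left (hm.bound 2 (by norm_num) (by norm_num) ![j, j] x hx)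
      (mul_nonneg (abs_nonneg c.ν) (sq_nonneg (h j)))
    linarith
  have h4 : 0 ≤ c.σ * √c.cL / 2 * c.rate n h := by
    have := hc.σ_pos
    have := rate_nonneg (c := c) (n := n) (h := h)
    positivity
  have h5 := abs_sub_abs_le_abs_sub (popVec K x h (remainder m r c.S x h) (some j) 0)
    (c.ν * (h j ^ 2 * partialDeriv m ![j, j] x))
  have h6 := abs_sub_abs_le_abs_sub (h j * Z K X (fun i => m (X i) + ξ i) x h j)
    (popVec K x h (remainder m r c.S x h) (some j) 0)
  rw [abs_mul (h j), abs_of_pos hh] at h6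
  have h7 : 0 ≤ |c.ν| * c.a * h j ^ 2 := by
    have := hc.a_pos
    positivity
  refine le_of_mul_le_mul_left ?_ hh
  linarith

/-- The error of the local linear estimate at the bandwidths `h`. -/
lemma GoodAt.abs_mHat_sub_le (hc : c.Valid K) (hs : Small c n r x h)
    (hm : HasBoundedDerivs m c.M) (hdep : DependsOnFirst r m) (hrd : r ≤ d)
    (hg : GoodAt c K r x h (remainder m r c.S x h) X ξ) :
    |mHat K X (fun i => m (X i) + ξ i) x h - m x| ≤
      3 * c.bias r h + 4 * c.S * c.σ * √c.cU * c.rate n h := by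
  have hn : (0 : ℝ) < n := by have := hs.two_le; positivity
  have hη0 : 0 ≤ c.Cη * c.rate n h := mul_nonneg hc.Cη_pos.le rate_nonneg
  have hb0 : 0 ≤ c.bias r h := bias_nonneg hc
  have hσ := hc.σ_pos
  have hS := hc.bounds.one_le_S
  have hrate0 : 0 ≤ c.rate n h := rate_nonneg
  have hdet := hg.isUnit_det hc hs
  have hsum : mHat K X (fun i => m (X i) + ξ i) x h - m x =
      ∑ i, effK K X x h i * remainder m r c.S x h (X i) + ∑ i, effK K X x h i * ξ i := by
    have h0 := sum_effW_linear 0 (fun i => vrow x h (X i)) (fun i => wt K none x h (X i))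
      hdet (affineCoeff m r x h)
    rw [mHat_eq_sum]
    have hz : affineCoeff m r x h 0 = m x := rfl
    rw [← hz, ← h0, ← Finset.sum_add_distrib, ← Finset.sum_sub_distrib]
    refine Finset.sum_congr rfl fun i _ => ?_
    rw [effKernel_eq_effW (fun i => (hs.window i).1.ne')]
    by_cases hi : ∀ j, |X i j - x j| < c.S * h j
    · rw [eq_affineCoeff_add hc hs hdep hi, effK]; ring
    · have := effK_eq_zero hc hs hi
      rw [effK] at this ⊢
      rw [this]; ring
  have h1 : |∑ i, effK K X x h i * remainder m r c.S x h (X i)| ≤ 3 * c.bias r h := by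
    simp only [effK]
    rw [sum_effW_mul]
    have e1 := abs_icept_dotProduct_sub_le (z := (0 : Fin (d + 1)))
      (D := Fin.cons 1 fun _ => c.ν) (ϱ := c.bias r h) (R := relSet d r) c.one_le_ι hη0 hb0
      (hc.one_le_ι_mul d) rfl (popGram_none_close hg) (hs.mul_rate_le hc)
      (hg.vec none) (fun k => (abs_popVec_le hc hs.window hm none k).1)
      (fun k => (abs_popVec_le hc hs.window hm none k).2.1)
    have e2 := (abs_popVec_le (r := r) hc hs.window hm none 0).1
    have e3 := hs.mul_rate_le hc
    have e4 := card_relSet_le d r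
    have e5 : 2 * (c.ι * (relSet d r).card + 1) * (c.bias r h * (c.Cη * c.rate n h)) ≤
        2 * c.bias r h := by
      have e6 : (c.ι * (relSet d r).card + 1) * (c.Cη * c.rate n h) ≤ 1 := by
        have hι := c.one_le_ι
        have hrd' : (r : ℝ) ≤ d := by exact_mod_cast hrd
        simp only [Fintype.card_fin] at e3
        push_cast at e3
        have e7 : (c.ι * (relSet d r).card) * (c.Cη * c.rate n h) ≤
            ((d + 1) * c.ι) * (c.Cη * c.rate n h) := by
          refine mul_le_mul_of_nonneg_right ?_ hη0
          nlinarith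
        have e8 : 1 * (c.Cη * c.rate n h) ≤ ((d + 1) * c.ι) * (c.Cη * c.rate n h) := by
          refine mul_le_mul_of_nonneg_right ?_ hη0
          have : (0 : ℝ) ≤ d := by positivity
          nlinarith
        linarith
      nlinarith
    have e6 := abs_sub_abs_le_abs_sub (icept 0 (fun i => vrow x h (X i))
      (fun i => wt K none x h (X i)) ⬝ᵥ bvec K X x h (remainder m r c.S x h) none)
      (popVec K x h (remainder m r c.S x h) none 0)
    change |icept 0 (fun i => vrow x h (X i)) (fun i => wt K none x h (X i)) ⬝ᵥ
      bvec K X x h (remainder m r c.S x h) none| ≤ _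
    linarith
  -- the noise term
  have h2 : ∀ i, |effK K X x h i| ≤ (n : ℝ)⁻¹ * (2 * c.S * |wt K none x h (X i)|) := by
    intro i
    rw [effK, effW, abs_mul, abs_of_nonneg (by positivity : (0 : ℝ) ≤ (n : ℝ)⁻¹), abs_mul]
    refine mul_le_mul_of_nonneg_left ?_ (by positivity)
    by_cases hw : wt K none x h (X i) = 0
    · simp [hw]
    · refine mul_le_mul_of_nonneg_right ?_ (abs_nonneg _)
      have e1 := abs_icept_dotProduct_row_le (z := (0 : Fin (d + 1)))
        (D := Fin.cons 1 fun _ => c.ν) (S := c.S) c.one_le_ι hη0 (hc.one_le_ι_mul d) rfl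
        (popGram_none_close hg) (hs.mul_rate_le hc) (v := vrow x h (X i)) rfl
        (abs_vrow_le hc.bounds hs.window hw)
      have e2 := hs.mul_rate_le hc
      have e3 : Fintype.card (Fin (d + 1)) * (2 * c.ι * (c.Cη * c.rate n h) * c.S) ≤ c.S := by
        have := mul_le_mul_of_nonneg_right e2 (by linarith : 0 ≤ 2 * c.S)
        linarith
      have e4 := abs_sub_abs_le_abs_sub (icept 0 (fun i => vrow x h (X i))
        (fun i => wt K none x h (X i)) ⬝ᵥ vrow x h (X i)) 1
      rw [abs_one] at e4
      linarith
  set e := c.κ ^ d / ∏ i, h i with he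
  have hκ := hc.moments.κ_pos
  have hp := hs.prod_pos
  have he0 : 0 < e := by positivity
  have h3 : (n : ℝ)⁻¹ * ∑ i, wt K none x h (X i) ^ 2 ≤ 3 / 2 * c.cU * e := by
    have e1 := (abs_le.mp (hg.sq none)).2
    have e2 := (integral_wt_sq hc.bounds hc.moments hs.window none).2
    change _ ≤ c.cU * e at e2
    linarith
  have h4 : ∑ i, effK K X x h i ^ 2 ≤ (n : ℝ)⁻¹ * (4 * c.S ^ 2 * (3 / 2 * c.cU * e)) := by
    calc ∑ i, effK K X x h i ^ 2
        ≤ ∑ i, ((n : ℝ)⁻¹ * (2 * c.S * |wt K none x h (X i)|)) ^ 2 :=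
          Finset.sum_le_sum fun i _ => by
            rw [← sq_abs (effK K X x h i)]
            exact pow_le_pow_left₀ (abs_nonneg _) (h2 i) 2
      _ = (n : ℝ)⁻¹ * (4 * c.S ^ 2 * ((n : ℝ)⁻¹ * ∑ i, wt K none x h (X i) ^ 2)) := by
          simp only [mul_pow, sq_abs, Finset.mul_sum]
          exact Finset.sum_congr rfl fun i _ => by ring
      _ ≤ _ := by gcongr
  have hlog := hs.log_pos
  have hU := c.one_le_cU
  have h5 : |∑ i, effK K X x h i * ξ i| ≤ 4 * c.S * c.σ * √c.cU * c.rate n h := by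
    refine hg.noise.trans ?_
    refine (abs_le_of_sq_le_sq' ?_ (by positivity)).2
    have hratesq : c.rate n h ^ 2 = e * (Real.log n / n) := by
      rw [Consts.rate, Real.sq_sqrt (by positivity), he]
      field_simp
    have hK0 : 0 ≤ ∑ i, effK K X x h i ^ 2 := Finset.sum_nonneg fun i _ => sq_nonneg _
    rw [mul_pow, div_pow, Real.sq_sqrt (by positivity), Real.sq_sqrt (by positivity), mul_pow,
      mul_pow, mul_pow, mul_pow, Real.sq_sqrt (by linarith), hratesq]
    calc 2 * Real.log n / 2 ^ 2 * (c.σ ^ 2 * ∑ i, effK K X x h i ^ 2)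
        ≤ 2 * Real.log n / 2 ^ 2 *
          (c.σ ^ 2 * ((n : ℝ)⁻¹ * (4 * c.S ^ 2 * (3 / 2 * c.cU * e)))) := by gcongr
      _ = 3 * (c.S ^ 2 * c.σ ^ 2 * c.cU * (e * (Real.log n / n))) := by field_simp; ring
      _ ≤ 16 * (c.S ^ 2 * c.σ ^ 2 * c.cU * (e * (Real.log n / n))) := by
          refine mul_le_mul_of_nonneg_right (by norm_num) (by positivity)
      _ = _ := by ring
  rw [hsum]
  exact (abs_add_le _ _).trans (add_le_add h1 h5)

end Good

/-! ### The probability of a good sample -/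

/-- The law of `n` independent uniform design points in the cube. -/
def designLaw (n d : ℕ) : Measure (Fin n → Fin d → ℝ) := Measure.pi fun _ => uniformCube d

instance (n d : ℕ) : IsProbabilityMeasure (designLaw n d) := by
  unfold designLaw; infer_instance

/-- The joint law of the design and the noise. -/
def dataLaw (n d : ℕ) (σ : ℝ≥0) : Measure ((Fin n → Fin d → ℝ) × (Fin n → ℝ)) :=
  (designLaw n d).prod (Measure.pi fun _ => gaussianReal 0 (σ ^ 2))

lemma dataLaw_fst {n d : ℕ} (σ : ℝ≥0) (p : (Fin n → Fin d → ℝ) → Prop) :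
    dataLaw n d σ {ω | p ω.1} = designLaw n d {X | p X} := by
  have : {ω : (Fin n → Fin d → ℝ) × (Fin n → ℝ) | p ω.1} = {X | p X} ×ˢ Set.univ := by
    ext ω; simp
  rw [this, dataLaw, Measure.prod_prod]
  simp

section Measurability

variable {E p : Type*} [MeasurableSpace E] {n : ℕ}

lemma measurable_wGram {ρ : E → Fin n → p → ℝ} {w : E → Fin n → ℝ}
    (hρ : ∀ i k, Measurable fun u => ρ u i k) (hw : ∀ i, Measurable fun u => w u i) (k l : p) :
    Measurable fun u => wGram (ρ u) (w u) k l := by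
  simp only [wGram, Matrix.of_apply]
  exact (Finset.measurable_sum _ fun i _ => ((hρ i k).mul (hρ i l)).mul (hw i)).const_mul _

lemma measurable_mulVec [Fintype p] {A : E → Matrix p p ℝ} {v : E → p → ℝ}
    (hA : ∀ k l, Measurable fun u => A u k l) (hv : ∀ k, Measurable fun u => v u k) (k : p) :
    Measurable fun u => (A u *ᵥ v u) k := by
  simp only [Matrix.mulVec, dotProduct]
  exact Finset.measurable_sum _ fun l _ => (hA k l).mul (hv l)

variable [Fintype p] [DecidableEq p]

lemma measurable_det {A : E → Matrix p p ℝ} (hA : ∀ k l, Measurable fun u => A u k l) :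
    Measurable fun u => (A u).det := by
  simp only [Matrix.det_apply]
  exact Finset.measurable_sum _ fun σ _ =>
    (Finset.measurable_prod _ fun i _ => hA _ _).const_smul _

lemma measurable_inv_apply {A : E → Matrix p p ℝ} (hA : ∀ k l, Measurable fun u => A u k l)
    (k l : p) : Measurable fun u => (A u)⁻¹ k l := by
  simp only [Matrix.inv_def, Ring.inverse_eq_inv', Matrix.smul_apply, smul_eq_mul,
    Matrix.adjugate_apply]
  refine (measurable_det hA).inv.mul (measurable_det fun a b => ?_)
  simp only [Matrix.updateRow_apply]
  split_ifs
  exacts [measurable_const, hA a b]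

variable {z : p} {ρ : E → Fin n → p → ℝ} {w q : E → Fin n → ℝ}

lemma measurable_icept (hρ : ∀ i k, Measurable fun u => ρ u i k)
    (hw : ∀ i, Measurable fun u => w u i) (k : p) :
    Measurable fun u => icept z (ρ u) (w u) k :=
  measurable_mulVec (v := fun _ => Pi.single z 1) (measurable_inv_apply (measurable_wGram hρ hw))
    (fun _ => measurable_const) k

lemma measurable_effW (hρ : ∀ i k, Measurable fun u => ρ u i k)
    (hw : ∀ i, Measurable fun u => w u i) (i : Fin n) :
    Measurable fun u => effW z (ρ u) (w u) i := by
  simp only [effW, dotProduct]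
  exact ((Finset.measurable_sum _ fun k _ =>
    (measurable_icept hρ hw k).mul (hρ i k)).mul (hw i)).const_mul _

lemma measurable_effD (hρ : ∀ i k, Measurable fun u => ρ u i k)
    (hw : ∀ i, Measurable fun u => w u i) (hq : ∀ i, Measurable fun u => q u i) (i : Fin n) :
    Measurable fun u => effD z (ρ u) (w u) (q u) i := by
  simp only [effD, dotProduct]
  refine ((Finset.measurable_sum _ fun k _ =>
    (measurable_icept hρ hw k).mul (hρ i k)).mul (hq i)).sub
    ((Finset.measurable_sum _ fun k _ => ?_).mul (hw i))
  refine Measurable.mul ?_ (hρ i k)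
  exact measurable_mulVec (measurable_inv_apply (measurable_wGram hρ hw))
    (measurable_mulVec (measurable_wGram hρ hq) (measurable_icept hρ hw)) k

end Measurability

variable {n d r : ℕ} {c : Consts} {K : ℝ → ℝ} {x h : Fin d → ℝ} {φ : (Fin d → ℝ) → ℝ}

lemma measurable_effDeriv (hc : c.Valid K) (j : Fin d) (i : Fin n) :
    Measurable fun X : Fin n → Fin d → ℝ => effDeriv K X x h j i := by
  unfold effDeriv
  exact measurable_effD (fun i k => (measurable_vrow x h k).comp (measurable_pi_apply i))
    (fun i => (measurable_wt hc.bounds _ x h).comp (measurable_pi_apply i))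
    (fun i => (measurable_wt hc.bounds _ x h).comp (measurable_pi_apply i)) i

lemma measurable_effK (hc : c.Valid K) (i : Fin n) :
    Measurable fun X : Fin n → Fin d → ℝ => effK K X x h i := by
  unfold effK
  exact measurable_effW (fun i k => (measurable_vrow x h k).comp (measurable_pi_apply i))
    (fun i => (measurable_wt hc.bounds _ x h).comp (measurable_pi_apply i)) i

/-- Weighted averages concentrate at the scale `rate`. -/
lemma designLaw_avg_gt_le (hc : c.Valid K) (hs : Small c n r x h) (J : Option (Fin d))
    {g : (Fin d → ℝ) → ℝ} {D : ℝ} (hg : Measurable g)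
    (hD : ∀ u, wt K J x h u ≠ 0 → |g u| ≤ D * c.S ^ 2) (hD0 : 0 ≤ D) :
    designLaw n d {X | D * (c.Cη * c.rate n h) <
      |(n : ℝ)⁻¹ * ∑ i, g (X i) * wt K J x h (X i) -
        ∫ u, g u * wt K J x h u ∂uniformCube d|} ≤ ENNReal.ofReal (2 / n) := by
  have hp := hs.prod_pos
  have hn : (0 : ℝ) < n := by have := hs.two_le; positivity
  have hκ := hc.moments.κ_pos
  have hS := hc.bounds.one_le_S
  have hB := hc.bounds.one_le_B
  have hlog := hs.log_pos
  have hU := c.one_le_cU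
  set F := D * c.S ^ 2 * (c.B ^ d / ∏ i, h i) with hF
  set V := D ^ 2 * c.S ^ 4 * (c.cU * (c.κ ^ d / ∏ i, h i)) with hV
  have hF0 : 0 ≤ F := by positivity
  have hwm := measurable_wt hc.bounds J x h
  have hfF : ∀ u, |g u * wt K J x h u| ≤ F := fun u => by
    by_cases hu : wt K J x h u = 0
    · rw [hu, mul_zero, abs_zero]; exact hF0
    · rw [abs_mul]
      exact mul_le_mul (hD u hu) (abs_wt_le hc.bounds hs.window J u) (abs_nonneg _) (by positivity)
  have hfV : ∫ u, (g u * wt K J x h u) ^ 2 ∂uniformCube d ≤ V := by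
    have h1 : ∫ u, (g u * wt K J x h u) ^ 2 ∂uniformCube d ≤
        ∫ u, D ^ 2 * c.S ^ 4 * wt K J x h u ^ 2 ∂uniformCube d := by
      refine integral_mono ?_ ?_ fun u => ?_
      · refine Integrable.of_bound ((hg.mul hwm).pow_const 2).aestronglyMeasurable (F ^ 2)
          (Eventually.of_forall fun u => ?_)
        rw [Real.norm_eq_abs, abs_pow]
        exact pow_le_pow_left₀ (abs_nonneg _) (hfF u) 2
      · refine (Integrable.of_bound (hwm.pow_const 2).aestronglyMeasurable
          ((c.B ^ d / ∏ i, h i) ^ 2) (Eventually.of_forall fun u => ?_)).const_mul _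
        rw [Real.norm_eq_abs, abs_pow]
        exact pow_le_pow_left₀ (abs_nonneg _) (abs_wt_le hc.bounds hs.window J u) 2
      · simp only
        by_cases hu : wt K J x h u = 0
        · simp [hu]
        · rw [mul_pow, ← sq_abs (g u)]
          have := pow_le_pow_left₀ (abs_nonneg _) (hD u hu) 2
          have h2 : (D * c.S ^ 2) ^ 2 = D ^ 2 * c.S ^ 4 := by ring
          rw [h2] at this
          exact mul_le_mul_of_nonneg_right this (sq_nonneg _)
    rw [integral_const_mul] at h1
    refine h1.trans ?_
    exact mul_le_mul_of_nonneg_left (integral_wt_sq hc.bounds hc.moments hs.window J).2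
      (by positivity)
  have hFV : 4 * F ^ 2 * Real.log n ≤ n * V := by
    have h1 := hs.bernstein
    have h2 : 4 * c.B ^ (2 * d) * Real.log n ≤ n * (∏ i, h i) * (c.cU * c.κ ^ d) := by
      have h3 : 0 ≤ c.B ^ (2 * d) * Real.log n := by positivity
      have h4 : n * (∏ i, h i) * (c.cL * c.κ ^ d) ≤ n * (∏ i, h i) * (c.cU * c.κ ^ d) := by
        have := c.cL_le_one
        gcongr
        linarith
      linarith
    have h3 := mul_le_mul_of_nonneg_left h2
      (by positivity : 0 ≤ D ^ 2 * c.S ^ 4 / (∏ i, h i) ^ 2)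
    calc 4 * F ^ 2 * Real.log n =
        D ^ 2 * c.S ^ 4 / (∏ i, h i) ^ 2 * (4 * c.B ^ (2 * d) * Real.log n) := by
          rw [hF, pow_mul']; field_simp
      _ ≤ _ := h3
      _ = n * V := by rw [hV]; field_simp
  have hkey := measurePi_abs_avg_sub_gt_le (uniformCube d) (hg.mul hwm) hfF hfV hs.two_le hFV
  have hval : 2 * √(V * Real.log n / n) = D * (c.Cη * c.rate n h) := by
    have : V * Real.log n / n = (D * c.S ^ 2) ^ 2 *
        (c.cU * (c.κ ^ d * Real.log n / (n * ∏ i, h i))) := by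
      rw [hV]; field_simp
    rw [this, Real.sqrt_mul (sq_nonneg _), Real.sqrt_sq (by positivity),
      Real.sqrt_mul (by linarith), Consts.Cη, Consts.rate]
    ring
  rw [← hval]
  exact hkey

/-- The averages of the squared weights concentrate. -/
lemma designLaw_sq_gt_le (hc : c.Valid K) (hs : Small c n r x h) (J : Option (Fin d)) :
    designLaw n d {X | (∫ u, wt K J x h u ^ 2 ∂uniformCube d) / 2 <
      |(n : ℝ)⁻¹ * ∑ i, wt K J x h (X i) ^ 2 - ∫ u, wt K J x h u ^ 2 ∂uniformCube d|} ≤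
      ENNReal.ofReal (2 / n) := by
  have hp := hs.prod_pos
  have hn : (0 : ℝ) < n := by have := hs.two_le; positivity
  have hκ := hc.moments.κ_pos
  have hB := hc.bounds.one_le_B
  have hlog := hs.log_pos
  have hwm := measurable_wt hc.bounds J x h
  set I := ∫ u, wt K J x h u ^ 2 ∂uniformCube d with hI
  set F := (c.B ^ d / ∏ i, h i) ^ 2 with hF
  have hF0 : 0 ≤ F := sq_nonneg _
  have hI0 : 0 ≤ I := integral_nonneg fun u => sq_nonneg _
  have hfF : ∀ u, |wt K J x h u ^ 2| ≤ F := fun u => by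
    rw [abs_pow]
    exact pow_le_pow_left₀ (abs_nonneg _) (abs_wt_le hc.bounds hs.window J u) 2
  have hkeyI : 16 * F * Real.log n ≤ n * I := by
    have h1 := mul_le_mul_of_nonneg_left hs.bernstein (by positivity : 0 ≤ ((∏ i, h i) ^ 2)⁻¹)
    have h2 : c.cL * (c.κ ^ d / ∏ i, h i) ≤ I :=
      (integral_wt_sq hc.bounds hc.moments hs.window J).1
    calc 16 * F * Real.log n = ((∏ i, h i) ^ 2)⁻¹ * (16 * c.B ^ (2 * d) * Real.log n) := by
          rw [hF, pow_mul']; field_simp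
      _ ≤ _ := h1
      _ = n * (c.cL * (c.κ ^ d / ∏ i, h i)) := by field_simp
      _ ≤ n * I := by gcongr
  have hfV : ∫ u, (wt K J x h u ^ 2) ^ 2 ∂uniformCube d ≤ F * I := by
    rw [hI, ← integral_const_mul]
    refine integral_mono ?_ ?_ fun u => ?_
    · refine Integrable.of_bound ((hwm.pow_const 2).pow_const 2).aestronglyMeasurable (F ^ 2)
        (Eventually.of_forall fun u => ?_)
      rw [Real.norm_eq_abs, abs_pow]
      exact pow_le_pow_left₀ (abs_nonneg _) (hfF u) 2
    · exact (Integrable.of_bound (hwm.pow_const 2).aestronglyMeasurable F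
        (Eventually.of_forall fun u => by simpa using hfF u)).const_mul _
    · simp only
      rw [sq (wt K J x h u ^ 2)]
      exact mul_le_mul_of_nonneg_right ((le_abs_self _).trans (hfF u)) (sq_nonneg _)
  have hFV : 4 * F ^ 2 * Real.log n ≤ n * (F * I) := by
    have := mul_le_mul_of_nonneg_left hkeyI hF0
    have : 0 ≤ F ^ 2 * Real.log n := by positivity
    linarith
  refine (measure_mono fun X hX => ?_).trans (measurePi_abs_avg_sub_gt_le (uniformCube d)
    (hwm.pow_const 2) hfF hfV hs.two_le hFV)
  rw [Set.mem_ofPred_eq] at hX ⊢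
  refine lt_of_le_of_lt ?_ hX
  have : F * I * Real.log n / n ≤ (I / 4) ^ 2 := by
    rw [div_le_iff₀ hn]
    have := mul_le_mul_of_nonneg_right hkeyI hI0
    linarith
  have := (Real.sqrt_le_sqrt this).trans_eq (Real.sqrt_sq (by positivity))
  linarith

/-- The kernel is almost surely differentiable at the rescaled design points. -/
lemma designLaw_not_differentiableAt {L : ℝ≥0} (hL : LipschitzWith L K) {j : Fin d}
    (hj : h j ≠ 0) (i : Fin n) :
    designLaw n d {X | ¬ DifferentiableAt ℝ K ((X i j - x j) / h j)} = 0 := by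
  have h0 : volume {v : ℝ | ¬ DifferentiableAt ℝ K v} = 0 := hL.ae_differentiableAt_real
  have h1 : volume {v : ℝ | ¬ DifferentiableAt ℝ K ((v - x j) / h j)} = 0 := by
    have hsub : {v : ℝ | ¬ DifferentiableAt ℝ K ((v - x j) / h j)} ⊆
        (fun v => h j * v + x j) '' {v : ℝ | ¬ DifferentiableAt ℝ K v} := fun v hv =>
      ⟨(v - x j) / h j, hv, by field_simp; ring⟩
    refine measure_mono_null hsub (addHaar_image_eq_zero_of_differentiableOn_of_addHaar_eq_zero _
      (by fun_prop) h0)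
  have hm : MeasurableSet {v : ℝ | ¬ DifferentiableAt ℝ K ((v - x j) / h j)} :=
    (measurableSet_of_differentiableAt ℝ K).compl.preimage
      (by fun_prop : Measurable fun v : ℝ => (v - x j) / h j)
  have h2 : unitMeasure {v : ℝ | ¬ DifferentiableAt ℝ K ((v - x j) / h j)} = 0 :=
    Measure.absolutelyContinuous_of_le Measure.restrict_le_self h1
  have h3 : MeasurePreserving (fun X : Fin n → Fin d → ℝ => X i j) (designLaw n d) unitMeasure := by
    have e1 := measurePreserving_eval (fun _ : Fin n => uniformCube d) i
    have e2 := measurePreserving_eval (fun _ : Fin d => unitMeasure) j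
    rw [← uniformCube_eq_pi] at e2
    exact e2.comp e1
  have := h3.measure_preimage hm.nullMeasurableSet
  rw [h2] at this
  exact this

/-- The sample is good at the bandwidths `h` with high probability. -/
lemma dataLaw_not_goodAt_le (hc : c.Valid K) {L : ℝ≥0} (hL : LipschitzWith L K) {σ : ℝ≥0}
    (hσ : 0 < σ) (hcσ : c.σ = σ) (hs : Small c n r x h) {m : (Fin d → ℝ) → ℝ}
    (hm : HasBoundedDerivs m c.M) :
    dataLaw n d σ {ω | ¬ GoodAt c K r x h (remainder m r c.S x h) ω.1 ω.2} ≤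
      ENNReal.ofReal (10 * (d + 1) ^ 3 * (n : ℝ) ^ (-(1 / 4) : ℝ)) := by
  set φ := remainder m r c.S x h with hφ
  have hfc := hm.isFirstCoords_remainder (r := r) hc.M_nonneg hc.bounds.one_le_S hs.window
  rw [← hφ] at hfc
  have hn1 : (1 : ℝ) ≤ n := by have := hs.two_le; exact_mod_cast (by omega : 1 ≤ n)
  have hS := hc.bounds.one_le_S
  set q := ENNReal.ofReal (2 * (n : ℝ) ^ (-(1 / 4) : ℝ)) with hq
  have hq' : ENNReal.ofReal (2 / n) ≤ q := by
    refine ENNReal.ofReal_le_ofReal ?_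
    rw [div_eq_mul_inv, ← Real.rpow_neg_one]
    exact mul_le_mul_of_nonneg_left (Real.rpow_le_rpow_of_exponent_le hn1 (by norm_num))
      (by norm_num)
  have hb : c.M * (c.S * relSum r h) ^ 2 ≤ c.bias r h := by
    have := one_le_pow₀ hc.one_le_G (n := r)
    have := hc.M_nonneg
    exact le_mul_of_one_le_right (by positivity) ‹_›
  have hb0 : 0 ≤ c.bias r h := bias_nonneg hc
  set Λ := dataLaw n d σ
  have hgram : ∀ J k l, Λ {ω | ¬ |wGram (fun i => vrow x h (ω.1 i))
      (fun i => wt K J x h (ω.1 i)) k l - popGram c.ν J k l| ≤ c.Cη * c.rate n h} ≤ q := by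
    intro J k l
    refine ((dataLaw_fst σ fun X => ¬ |wGram (fun i => vrow x h (X i))
      (fun i => wt K J x h (X i)) k l - popGram c.ν J k l| ≤ c.Cη * c.rate n h).trans_le
      (le_trans ?_ (designLaw_avg_gt_le hc hs J (D := 1)
      (g := fun u => vrow x h u k * vrow x h u l)
      ((measurable_vrow x h k).mul (measurable_vrow x h l)) (fun u hu => ?_) zero_le_one))).trans hq'
    · rw [integral_vrow_vrow_wt hc.bounds hc.moments hs.window J k l]
      simp only [not_le, one_mul]
      exact le_rfl
    · rw [abs_mul, one_mul, sq]
      exact mul_le_mul (abs_vrow_le hc.bounds hs.window hu k) (abs_vrow_le hc.bounds hs.window hu l)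
        (abs_nonneg _) (by linarith)
  have hvec : ∀ J k, Λ {ω | ¬ |bvec K ω.1 x h φ J k - popVec K x h φ J k| ≤
      c.bias r h * (c.Cη * c.rate n h)} ≤ q := by
    intro J k
    refine ((dataLaw_fst σ fun X => ¬ |bvec K X x h φ J k - popVec K x h φ J k| ≤
      c.bias r h * (c.Cη * c.rate n h)).trans_le
      (le_trans ?_ (designLaw_avg_gt_le hc hs J (D := c.bias r h)
      (g := fun u => vrow x h u k * φ u)
      ((measurable_vrow x h k).mul hfc.measurable) (fun u hu => ?_) hb0))).trans hq'
    · simp only [not_le, bvec, popVec, mul_right_comm (vrow x h _ k) (wt K J x h _) _]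
      exact le_rfl
    · rw [abs_mul]
      have h1 := abs_vrow_le hc.bounds hs.window hu k
      have h2 := (hfc.bound u).trans hb
      calc |vrow x h u k| * |φ u| ≤ c.S * c.bias r h :=
            mul_le_mul h1 h2 (abs_nonneg _) (by linarith)
        _ = c.bias r h * (c.S * 1) := by ring
        _ ≤ c.bias r h * c.S ^ 2 := by
          rw [sq]
          exact mul_le_mul_of_nonneg_left (mul_le_mul_of_nonneg_left hS (by linarith)) hb0
  have hsq : ∀ J, Λ {ω | ¬ |(n : ℝ)⁻¹ * ∑ i, wt K J x h (ω.1 i) ^ 2 -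
      ∫ u, wt K J x h u ^ 2 ∂uniformCube d| ≤ (∫ u, wt K J x h u ^ 2 ∂uniformCube d) / 2} ≤ q := by
    intro J
    refine ((dataLaw_fst σ fun X => ¬ |(n : ℝ)⁻¹ * ∑ i, wt K J x h (X i) ^ 2 -
      ∫ u, wt K J x h u ^ 2 ∂uniformCube d| ≤
      (∫ u, wt K J x h u ^ 2 ∂uniformCube d) / 2).trans_le
      (le_trans ?_ (designLaw_sq_gt_le hc hs J))).trans hq'
    simp only [not_le]
    exact le_rfl
  have hn' : 1 ≤ n := by have := hs.two_le; omega
  have hnd : ∀ j, Λ {ω | ¬ |∑ i, effDeriv K ω.1 x h j i * ω.2 i| ≤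
      √(2 * Real.log n) / 2 * √(c.σ ^ 2 * ∑ i, effDeriv K ω.1 x h j i ^ 2)} ≤ q := by
    intro j
    simp only [not_le, hcσ]
    exact measure_prod_noise_gt_le (a := fun X i => effDeriv K X x h j i) (designLaw n d) σ hσ hn'
      (measurable_effDeriv hc j)
  have hne : Λ {ω | ¬ |∑ i, effK K ω.1 x h i * ω.2 i| ≤
      √(2 * Real.log n) / 2 * √(c.σ ^ 2 * ∑ i, effK K ω.1 x h i ^ 2)} ≤ q := by
    simp only [not_le, hcσ]
    exact measure_prod_noise_gt_le (a := fun X i => effK K X x h i) (designLaw n d) σ hσ hn'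
      (measurable_effK hc)
  have hdf : ∀ i : Fin n, ∀ j, Λ {ω | ¬ DifferentiableAt ℝ K ((ω.1 i j - x j) / h j)} = 0 := by
    intro i j
    exact (dataLaw_fst σ fun X => ¬ DifferentiableAt ℝ K ((X i j - x j) / h j)).trans
      (designLaw_not_differentiableAt hL (hs.window j).1.ne' i)
  have union : ∀ {ι : Type} [Fintype ι] (s : ι → Set ((Fin n → Fin d → ℝ) × (Fin n → ℝ))) (t : ℝ≥0∞),
      (∀ i, Λ (s i) ≤ t) → Λ (⋃ i, s i) ≤ Fintype.card ι * t := by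
    intro ι _ s t hst
    refine (measure_iUnion_fintype_le Λ s).trans ((Finset.sum_le_sum fun i _ => hst i).trans_eq ?_)
    simp
  set E1 : Option (Fin d) × Fin (d + 1) × Fin (d + 1) → Set ((Fin n → Fin d → ℝ) × (Fin n → ℝ)) :=
    fun v => {ω | ¬ |wGram (fun i => vrow x h (ω.1 i)) (fun i => wt K v.1 x h (ω.1 i)) v.2.1 v.2.2 -
      popGram c.ν v.1 v.2.1 v.2.2| ≤ c.Cη * c.rate n h} with hE1
  set E2 : Option (Fin d) × Fin (d + 1) → Set ((Fin n → Fin d → ℝ) × (Fin n → ℝ)) :=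
    fun v => {ω | ¬ |bvec K ω.1 x h φ v.1 v.2 - popVec K x h φ v.1 v.2| ≤
      c.bias r h * (c.Cη * c.rate n h)} with hE2
  set E5 : Fin n × Fin d → Set ((Fin n → Fin d → ℝ) × (Fin n → ℝ)) :=
    fun v => {ω | ¬ DifferentiableAt ℝ K ((ω.1 v.1 v.2 - x v.2) / h v.2)} with hE5
  have u1 := union E1 q fun v => hgram v.1 v.2.1 v.2.2
  have u2 := union E2 q fun v => hvec v.1 v.2
  have u3 := union _ q hsq
  have u4 := union _ q hnd
  have u5 := union E5 0 fun v => (hdf v.1 v.2).le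
  have hsub : {ω | ¬ GoodAt c K r x h φ ω.1 ω.2} ⊆ (⋃ v, E1 v) ∪ ((⋃ v, E2 v) ∪ ((⋃ J,
      {ω | ¬ |(n : ℝ)⁻¹ * ∑ i, wt K J x h (ω.1 i) ^ 2 - ∫ u, wt K J x h u ^ 2 ∂uniformCube d| ≤
        (∫ u, wt K J x h u ^ 2 ∂uniformCube d) / 2}) ∪ ((⋃ j,
      {ω | ¬ |∑ i, effDeriv K ω.1 x h j i * ω.2 i| ≤
        √(2 * Real.log n) / 2 * √(c.σ ^ 2 * ∑ i, effDeriv K ω.1 x h j i ^ 2)}) ∪ ((⋃ v, E5 v) ∪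
      {ω | ¬ |∑ i, effK K ω.1 x h i * ω.2 i| ≤
        √(2 * Real.log n) / 2 * √(c.σ ^ 2 * ∑ i, effK K ω.1 x h i ^ 2)})))) := by
    intro ω hω
    by_contra hcon
    simp only [hE1, hE2, hE5, Set.mem_union, Set.mem_iUnion, Set.mem_ofPred_eq, not_or, not_exists,
      not_not, Prod.forall] at hcon
    obtain ⟨c1, c2, c3, c4, c5, c6⟩ := hcon
    exact hω ⟨c1, c2, c3, c4, c6, c5⟩
  refine (measure_mono hsub).trans (((measure_union_le _ _).trans (add_le_add u1
    ((measure_union_le _ _).trans (add_le_add u2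
      ((measure_union_le _ _).trans (add_le_add u3 ((measure_union_le _ _).trans (add_le_add u4
      ((measure_union_le _ _).trans (add_le_add u5 hne)))))))))).trans ?_)
  · have hq2 : q = ENNReal.ofReal (2 * (n : ℝ) ^ (-(1 / 4) : ℝ)) := rfl
    simp only [Fintype.card_prod, Fintype.card_option, Fintype.card_fin]
    rw [mul_zero, zero_add]
    have e1 : ((((d + 1) * ((d + 1) * (d + 1)) : ℕ) : ℝ≥0∞) * q + ((((d + 1) * (d + 1) : ℕ) : ℝ≥0∞) * q +
        (((d + 1 : ℕ) : ℝ≥0∞) * q + ((d : ℝ≥0∞) * q + q)))) =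
        (((d + 1) * ((d + 1) * (d + 1)) + (d + 1) * (d + 1) + (d + 1) + d + 1 : ℕ) : ℝ≥0∞) * q := by
      push_cast; ring
    rw [e1]
    have e2 : (d + 1) * ((d + 1) * (d + 1)) + (d + 1) * (d + 1) + (d + 1) + d + 1 ≤
        5 * (d + 1) ^ 3 := by nlinarith [sq_nonneg d, pow_nonneg (Nat.zero_le d) 3]
    calc _ ≤ ((5 * (d + 1) ^ 3 : ℕ) : ℝ≥0∞) * q := by gcongr
      _ = ENNReal.ofReal ((5 * (d + 1) ^ 3 : ℕ) : ℝ) * q := by rw [ENNReal.ofReal_natCast]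
      _ = _ := by
        rw [hq2, ← ENNReal.ofReal_mul (by positivity)]
        congr 1
        push_cast; ring

/-! ### Bandwidths along the path of the algorithm -/

/-- The number of shrinkages by the factor `β` that brings a bandwidth below the fraction `y⁻¹` of
its initial value. -/
def shrinkCount (β y : ℝ) : ℕ := ⌈Real.log y / Real.log β⁻¹⌉₊

section ShrinkCount

variable {β y : ℝ}

lemma log_inv_pos (h0 : 0 < β) (h1 : β < 1) : 0 < Real.log β⁻¹ :=
  Real.log_pos ((one_lt_inv₀ h0).mpr h1)

lemma pow_eq_exp (h0 : 0 < β) (k : ℕ) : β ^ k = Real.exp (-(k * Real.log β⁻¹)) := by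
  rw [Real.log_inv, mul_neg, neg_neg, ← Real.log_pow, Real.exp_log (pow_pos h0 k)]

lemma pow_shrinkCount_le (h0 : 0 < β) (h1 : β < 1) (hy : 0 < y) :
    β ^ shrinkCount β y ≤ y⁻¹ := by
  have hL := log_inv_pos h0 h1
  rw [pow_eq_exp h0, ← Real.exp_log (inv_pos.mpr hy), Real.exp_le_exp, Real.log_inv y, neg_le_neg_iff,
    ← div_le_iff₀ hL]
  exact Nat.le_ceil _

lemma inv_le_pow_of_lt_shrinkCount (h0 : 0 < β) (h1 : β < 1) (hy : 0 < y) {k : ℕ}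
    (hk : k < shrinkCount β y) : y⁻¹ ≤ β ^ k := by
  have hL := log_inv_pos h0 h1
  rw [pow_eq_exp h0, ← Real.exp_log (inv_pos.mpr hy), Real.exp_le_exp, Real.log_inv y, neg_le_neg_iff,
    ← le_div_iff₀ hL]
  exact (Nat.lt_ceil.mp hk).le

lemma mul_inv_le_pow (h0 : 0 < β) (h1 : β < 1) (hy : 1 ≤ y) {k : ℕ}
    (hk : k ≤ shrinkCount β y) : β * y⁻¹ ≤ β ^ k := by
  rcases Nat.eq_zero_or_pos k with rfl | hpos
  · rw [pow_zero]
    have := inv_le_one_of_one_le₀ hy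
    nlinarith [inv_nonneg.mpr (zero_le_one.trans hy)]
  · obtain ⟨l, rfl⟩ := Nat.exists_eq_succ_of_ne_zero hpos.ne'
    rw [pow_succ, mul_comm]
    exact mul_le_mul_of_nonneg_right
      (inv_le_pow_of_lt_shrinkCount h0 h1 (by linarith) (Nat.lt_of_succ_le hk)) h0.le

lemma shrinkCount_mono (h0 : 0 < β) (h1 : β < 1) {y' : ℝ} (hy : 0 < y) (hyy : y ≤ y') :
    shrinkCount β y ≤ shrinkCount β y' :=
  Nat.ceil_le_ceil (div_le_div_of_nonneg_right (Real.log_le_log hy hyy) (log_inv_pos h0 h1).le)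

lemma shrinkCount_le (h0 : 0 < β) (h1 : β < 1) (hy : 1 ≤ y) :
    (shrinkCount β y : ℝ) ≤ Real.log y / Real.log β⁻¹ + 1 :=
  (Nat.ceil_lt_add_one (div_nonneg (Real.log_nonneg hy) (log_inv_pos h0 h1).le)).le

end ShrinkCount

section Regime

variable {d r A T : ℕ} {β b₀ : ℝ} {k : Fin d → ℕ}

lemma bw_pos (hβ : 0 < β) (hb : 0 < b₀) (j : Fin d) : 0 < bw β b₀ k j :=
  mul_pos (pow_pos hβ _) hb

lemma bw_le (hβ : 0 < β) (hβ1 : β < 1) (hb : 0 < b₀) (j : Fin d) : bw β b₀ k j ≤ b₀ :=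
  mul_le_of_le_one_left hb.le (pow_le_one₀ hβ.le hβ1.le)

lemma prod_bw : ∏ j, bw β b₀ k j = β ^ (∑ j, k j) * b₀ ^ d := by
  simp [bw, Finset.prod_mul_distrib, Finset.prod_pow_eq_pow_sum]

lemma card_filter_val_lt_le : ((Finset.univ.filter fun j : Fin d => (j : ℕ) < r).card : ℝ) ≤ r := by
  rw [Fin.card_filter_val_lt]
  exact_mod_cast min_le_right _ _

lemma relSum_le {h : Fin d → ℝ} {t : ℝ} (ht : 0 ≤ t) (hh : ∀ j : Fin d, (j : ℕ) < r → h j ≤ t) :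
    relSum r h ≤ r * t := by
  rw [relSum, ← Finset.sum_filter]
  refine (Finset.sum_le_card_nsmul _ _ t fun j hj => hh j (Finset.mem_filter.mp hj).2).trans ?_
  rw [nsmul_eq_mul]
  exact mul_le_mul_of_nonneg_right card_filter_val_lt_le ht

lemma IsConfig.sum_eq (hk : IsConfig r T k) :
    ∑ j, k j = ∑ j ∈ Finset.univ.filter (fun j : Fin d => (j : ℕ) < r), k j := by
  rw [Finset.sum_filter]
  refine Finset.sum_congr rfl fun j _ => ?_
  split_ifs with hj
  · rfl
  · exact (hk j).2 (not_lt.mp hj)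

lemma IsConfig.sum_le (hk : IsConfig r T k) {t : ℕ} (ht : ∀ j, k j ≤ t) : ∑ j, k j ≤ r * t := by
  rw [hk.sum_eq]
  refine (Finset.sum_le_card_nsmul _ _ t fun j _ => ht j).trans ?_
  rw [Fin.card_filter_val_lt, smul_eq_mul]
  exact Nat.mul_le_mul_right t (min_le_right _ _)

lemma IsConfig.le_sum (hk : IsConfig r T k) (hrd : r ≤ d)
    (hA : ∀ j : Fin d, (j : ℕ) < r → A ≤ k j) : r * A ≤ ∑ j, k j := by
  rw [hk.sum_eq]
  have := Finset.card_nsmul_le_sum (Finset.univ.filter fun j : Fin d => (j : ℕ) < r) k A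
    fun j hj => hA j (Finset.mem_filter.mp hj).2
  rwa [Fin.card_filter_val_lt, min_eq_right hrd, smul_eq_mul] at this

/-- The part of the squared rate that does not depend on the path of the algorithm. -/
def Consts.baseRate (c : Consts) (n d : ℕ) (b₀ : ℝ) : ℝ := c.κ ^ d * Real.log n / b₀ ^ d

lemma rate_bw_sq {c : Consts} (hκ : 0 < c.κ) (hβ : 0 < β) (hb : 0 < b₀) {n : ℕ} :
    c.rate n (bw β b₀ k) ^ 2 = c.baseRate n d b₀ / (n * β ^ (∑ j, k j)) := by
  have hlog : 0 ≤ Real.log n := Real.log_natCast_nonneg n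
  rw [Consts.rate, prod_bw, Real.sq_sqrt (by positivity), Consts.baseRate]
  rw [div_div]
  congr 1
  ring

/-- Conditions on the sample size, the dimension and the initial bandwidth `b₀` under which the
algorithm behaves as it should. Here `R` bounds the number of relevant covariates, and `θ` is the
precision with which the exponents of the final bandwidths are controlled. The fields up to `fluct`
give `Small` at all bandwidths on the path, `shrink` and `halt` decide the tests of the relevant
covariates, and `error` is the bound on the final error. -/
structure LargeSample (c : Consts) (β δ θ ε : ℝ) (R n d : ℕ) (b₀ : ℝ) : Prop where
  two_le : 2 ≤ n
  b₀_pos : 0 < b₀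
  b₀_le : b₀ ≤ 1
  window : c.S * b₀ < δ
  bias : 16 * c.Cθ * c.Cη * (R + 2) * (c.M * (c.S * (R * b₀)) ^ 2 * c.G ^ R) ≤ c.σ * √c.cL / 2
  curv : 2 * c.M * c.S ^ 3 * c.G ^ R * (R * b₀) ≤ |c.ν| * c.a
  bernstein : 16 * c.B ^ (2 * d) * Real.log n ≤
    β ^ R * (n : ℝ) ^ (2 / (4 + R : ℝ)) * b₀ ^ d * (c.cL * c.κ ^ d)
  fluct : ((d + 1) * (8 * c.Cθ * c.S * c.Cη * (1 + 3 * c.cU / c.cL))) ^ 2 * c.baseRate n d b₀ ≤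
    β ^ R * (n : ℝ) ^ (2 / (4 + R : ℝ))
  shrink : (12 * c.σ * √c.cU) ^ 2 * c.baseRate n d b₀ <
    (|c.ν| * c.a * b₀ ^ 2) ^ 2 * (β ^ R * (n : ℝ) ^ θ)
  halt : (|c.ν| * (c.M + c.a)) ^ 2 ≤ (c.σ * √c.cL / 8) ^ 2 * c.baseRate n d b₀ * (n : ℝ) ^ θ
  error : 18 * (c.M * (c.S * R) ^ 2 * c.G ^ R) ^ 2 +
    2 * (4 * c.S * c.σ * √c.cU) ^ 2 * c.baseRate n d b₀ * (β ^ R)⁻¹ ≤ (n : ℝ) ^ (ε / 2)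

/-- Relevant bandwidths are shrunk at least this often: to about `n ^ (-(1 - θ) / (4 + r))`. -/
def minCount (β θ : ℝ) (r n : ℕ) : ℕ := shrinkCount β ((n : ℝ) ^ ((1 - θ) / (4 + r)))

/-- Relevant bandwidths are shrunk at most this often: to about `n ^ (-1 / (4 + r) - θ)`. The margin
`θ` is not divided by `4 + r` here, so that it outweighs the one in `minCount` for all `r`. -/
def maxCount (β θ : ℝ) (r n : ℕ) : ℕ := shrinkCount β ((n : ℝ) ^ (1 / (4 + r) + θ))

variable {c : Consts} {K : ℝ → ℝ} {δ θ ε : ℝ} {R n : ℕ} {x : Fin d → ℝ}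

lemma minCount_le_maxCount (hβ : 0 < β) (hβ1 : β < 1) (hθ : 0 < θ) (hn : 1 ≤ n) :
    minCount β θ r n ≤ maxCount β θ r n := by
  have hn1 : (1 : ℝ) ≤ n := by exact_mod_cast hn
  refine shrinkCount_mono hβ hβ1 (by positivity) (Real.rpow_le_rpow_of_exponent_le hn1 ?_)
  have : (1 - θ) / (4 + r) ≤ 1 / (4 + r) := by gcongr; linarith
  linarith

/-- Along the path of the algorithm, the product of the sample size and the relative volume of the
window is at least of the order of a positive power of `n`. -/
lemma IsConfig.rpow_le_mul (hβ : 0 < β) (hβ1 : β < 1) (hθ : 0 < θ) (hrR : r ≤ R) (hn : 1 ≤ n)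
    (hk : IsConfig r (maxCount β θ r n) k) :
    β ^ R * (n : ℝ) ^ (4 / (4 + r) - R * θ : ℝ) ≤ n * β ^ (∑ j, k j) := by
  have hn1 : (1 : ℝ) ≤ n := by exact_mod_cast hn
  have hn0 : (0 : ℝ) < n := by linarith
  set y := (n : ℝ) ^ (1 / (4 + r) + θ : ℝ) with hy
  have hy0 : 0 < y := by positivity
  have hy1 : 1 ≤ y := Real.one_le_rpow hn1 (by positivity)
  have h1 : β ^ (r * maxCount β θ r n) ≤ β ^ (∑ j, k j) :=
    pow_le_pow_of_le_one hβ.le hβ1.le (hk.sum_le fun j => (hk j).1)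
  have h2 : (β * y⁻¹) ^ r ≤ β ^ (r * maxCount β θ r n) := by
    rw [mul_comm r, pow_mul]
    exact pow_le_pow_left₀ (by positivity) (mul_inv_le_pow hβ hβ1 hy1 le_rfl) r
  have h3 : β ^ R ≤ β ^ r := pow_le_pow_of_le_one hβ.le hβ1.le hrR
  have h4 : (n : ℝ) ^ (4 / (4 + r) - R * θ : ℝ) ≤ n * (y⁻¹) ^ r := by
    have e1 : n * (y⁻¹) ^ r = (n : ℝ) ^ (1 - (1 / (4 + r) + θ) * r : ℝ) := by
      rw [Real.rpow_sub hn0, Real.rpow_one, Real.rpow_mul_natCast hn0.le, ← hy, inv_pow,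
        div_eq_mul_inv]
    rw [e1]
    refine Real.rpow_le_rpow_of_exponent_le hn1 ?_
    have e2 : (1 : ℝ) - 1 / (4 + r) * r = 4 / (4 + r) := by field_simp; ring
    have e3 : (r : ℝ) * θ ≤ R * θ := by
      have : (r : ℝ) ≤ R := by exact_mod_cast hrR
      gcongr
    linarith
  calc β ^ R * (n : ℝ) ^ (4 / (4 + r) - R * θ : ℝ) ≤ β ^ r * (n * (y⁻¹) ^ r) := by gcongr
    _ = n * (β * y⁻¹) ^ r := by ring
    _ ≤ n * β ^ (∑ j, k j) := mul_le_mul_of_nonneg_left (h2.trans h1) hn0.le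

lemma baseRate_nonneg (hκ : 0 < c.κ) (hb : 0 < b₀) : 0 ≤ c.baseRate n d b₀ := by
  have hlog : 0 ≤ Real.log n := Real.log_natCast_nonneg n
  unfold Consts.baseRate
  positivity

/-- The asymptotic approximations hold along the path of the algorithm. -/
lemma LargeSample.small (hc : c.Valid K) (hβ : 0 < β) (hβ1 : β < 1) (hθ : 0 < θ)
    (hθR : R * θ ≤ 2 / (4 + R : ℝ)) (hrR : r ≤ R)
    (hx : ∀ j, δ ≤ x j ∧ x j ≤ 1 - δ) (hl : LargeSample c β δ θ ε R n d b₀)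
    (hk : IsConfig r (maxCount β θ r n) k) : Small c n r x (bw β b₀ k) := by
  have hb := hl.b₀_pos
  have hS := hc.S_pos
  have hκ := hc.moments.κ_pos
  have hn := hl.two_le
  have hn1 : (1 : ℝ) ≤ n := by exact_mod_cast (by omega : 1 ≤ n)
  have hn0 : (0 : ℝ) < n := by linarith
  have hM := hc.M_nonneg
  have hG := hc.one_le_G
  have hL := hc.cL_pos
  have hU := c.one_le_cU
  have hη := hc.Cη_pos
  have hCθ := c.Cθ_pos
  have hrR' : (r : ℝ) ≤ R := by exact_mod_cast hrR
  have hrel : relSum r (bw β b₀ k) ≤ R * b₀ :=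
    (relSum_le hb.le fun j _ => bw_le hβ hβ1 hb j).trans (by gcongr)
  have hrel0 : 0 ≤ relSum r (bw β b₀ k) := relSum_nonneg fun j => (bw_pos hβ hb j).le
  have hGR : c.G ^ r ≤ c.G ^ R := pow_le_pow_right₀ hG hrR
  have hpow : β ^ R * (n : ℝ) ^ (2 / (4 + R) : ℝ) ≤ n * β ^ (∑ j, k j) := by
    refine le_trans ?_ (hk.rpow_le_mul hβ hβ1 hθ hrR (by omega))
    refine mul_le_mul_of_nonneg_left (Real.rpow_le_rpow_of_exponent_le hn1 ?_) (by positivity)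
    have : (4 : ℝ) / (4 + R) ≤ 4 / (4 + r) := by gcongr
    have e : (4 : ℝ) / (4 + R) = 2 / (4 + R) + 2 / (4 + R) := by ring
    linarith
  refine ⟨fun j => ?_, hl.two_le, ?_, ?_, ?_, ?_⟩
  · have h1 := mul_le_mul_of_nonneg_left (bw_le (k := k) hβ hβ1 hb j) hS.le
    have h2 := hl.window
    exact ⟨bw_pos hβ hb j, by linarith [(hx j).1], by linarith [(hx j).2]⟩
  · refine hl.bernstein.trans ?_
    rw [prod_bw, ← mul_assoc (n : ℝ)]
    gcongr
  · have hr0 : 0 ≤ c.rate n (bw β b₀ k) := Real.sqrt_nonneg _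
    rw [← mul_assoc]
    refine le_of_sq_le_sq ?_ zero_le_one
    rw [mul_pow, rate_bw_sq hκ hβ hb, ← mul_div_assoc, one_pow]
    exact (div_le_one (by positivity)).mpr (hl.fluct.trans hpow)
  · refine le_trans ?_ hl.bias
    unfold Consts.bias
    gcongr
  · refine le_trans ?_ hl.curv
    gcongr

/-- The test of a relevant covariate is positive as long as its bandwidth is among the smallest
ones and has not been shrunk `minCount` times. -/
lemma LargeSample.rate_lt (hc : c.Valid K) (hβ : 0 < β) (hβ1 : β < 1)
    (hrR : r ≤ R) (hl : LargeSample c β δ θ ε R n d b₀) (hk : IsConfig r T k) {j : Fin d}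
    (hj : k j < minCount β θ r n) (hi : ∀ i, k i ≤ k j + 1) :
    12 * c.σ * √c.cU * c.rate n (bw β b₀ k) < |c.ν| * c.a * bw β b₀ k j ^ 2 := by
  have hb := hl.b₀_pos
  have hκ := hc.moments.κ_pos
  have hn := hl.two_le
  have hn0 : (0 : ℝ) < n := by exact_mod_cast (by omega : 0 < n)
  have ha := hc.a_pos
  have hν : 0 < |c.ν| := abs_pos.mpr hc.moments.ν_ne
  have hg := baseRate_nonneg (n := n) (d := d) hκ hb
  refine lt_of_pow_lt_pow_left₀ 2 (by positivity) ?_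
  rw [mul_pow, rate_bw_sq hκ hβ hb, ← mul_div_assoc, div_lt_iff₀ (by positivity)]
  refine hl.shrink.trans_le ?_
  have h1 : ((n : ℝ) ^ ((1 - θ) / (4 + r) : ℝ))⁻¹ ≤ β ^ k j :=
    inv_le_pow_of_lt_shrinkCount hβ hβ1 (by positivity) hj
  have h2 : β ^ (r * (k j + 1)) ≤ β ^ (∑ i, k i) :=
    pow_le_pow_of_le_one hβ.le hβ1.le (hk.sum_le hi)
  have h3 : β ^ R * (n : ℝ) ^ θ ≤ (β ^ k j) ^ 4 * (n * β ^ (r * (k j + 1))) := by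
    have e1 : (n : ℝ) ^ θ = n * (((n : ℝ) ^ ((1 - θ) / (4 + r) : ℝ))⁻¹) ^ (4 + r) := by
      rw [inv_pow, ← Real.rpow_mul_natCast hn0.le, ← div_eq_mul_inv]
      nth_rewrite 2 [← Real.rpow_one (n : ℝ)]
      rw [← Real.rpow_sub hn0]
      congr 1
      push_cast
      field_simp
      ring
    have e2 : β ^ R ≤ β ^ r := pow_le_pow_of_le_one hβ.le hβ1.le hrR
    have e3 : (((n : ℝ) ^ ((1 - θ) / (4 + r) : ℝ))⁻¹) ^ (4 + r) ≤ (β ^ k j) ^ (4 + r) :=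
      pow_le_pow_left₀ (by positivity) h1 _
    calc β ^ R * (n : ℝ) ^ θ ≤ β ^ r * (n * (β ^ k j) ^ (4 + r)) := by rw [e1]; gcongr
      _ = _ := by rw [pow_add, mul_comm r (k j + 1), pow_mul, pow_succ β (k j), mul_pow]; ring
  calc (|c.ν| * c.a * b₀ ^ 2) ^ 2 * (β ^ R * (n : ℝ) ^ θ)
      ≤ (|c.ν| * c.a * b₀ ^ 2) ^ 2 * ((β ^ k j) ^ 4 * (n * β ^ (∑ i, k i))) := by
        refine mul_le_mul_of_nonneg_left (h3.trans ?_) (by positivity)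
        gcongr
    _ = _ := by rw [bw]; ring

/-- The test of a relevant covariate is negative after `maxCount` shrinkages of its bandwidth, once
all the relevant bandwidths have been shrunk `minCount` times. -/
lemma LargeSample.sq_le_rate (hc : c.Valid K) (hβ : 0 < β) (hβ1 : β < 1) (hθ : 0 < θ)
    (hrd : r ≤ d) (hl : LargeSample c β δ θ ε R n d b₀) (hk : IsConfig r T k) {j : Fin d}
    (hj : k j = maxCount β θ r n) (hi : ∀ i : Fin d, (i : ℕ) < r → minCount β θ r n ≤ k i) :
    |c.ν| * (c.M + c.a) * bw β b₀ k j ^ 2 ≤ c.σ * √c.cL / 8 * c.rate n (bw β b₀ k) := by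
  have hb := hl.b₀_pos
  have hb1 := hl.b₀_le
  have hκ := hc.moments.κ_pos
  have hn := hl.two_le
  have hn1 : (1 : ℝ) ≤ n := by exact_mod_cast (by omega : 1 ≤ n)
  have hn0 : (0 : ℝ) < n := by linarith
  have hσ := hc.σ_pos
  have hg := baseRate_nonneg (n := n) (d := d) hκ hb
  have hr0 : 0 ≤ c.rate n (bw β b₀ k) := Real.sqrt_nonneg _
  refine le_of_sq_le_sq ?_ (by positivity)
  rw [mul_pow _ (bw β b₀ k j ^ 2), mul_pow _ (c.rate n _), rate_bw_sq hκ hβ hb, ← mul_div_assoc,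
    le_div_iff₀ (by positivity)]
  set y := (n : ℝ) ^ (1 / (4 + r) + θ : ℝ) with hy
  set z := (n : ℝ) ^ ((1 - θ) / (4 + r) : ℝ) with hz
  have hy0 : 0 < y := by positivity
  have hz0 : 0 < z := by positivity
  have h1 : bw β b₀ k j ≤ y⁻¹ := by
    have : β ^ k j ≤ y⁻¹ := by rw [hj]; exact pow_shrinkCount_le hβ hβ1 hy0
    calc bw β b₀ k j ≤ y⁻¹ * 1 := mul_le_mul this hb1 hb.le (by positivity)
      _ = y⁻¹ := mul_one _
  have h2 : β ^ (∑ i, k i) ≤ (z⁻¹) ^ r := by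
    calc β ^ (∑ i, k i) ≤ β ^ (r * minCount β θ r n) :=
          pow_le_pow_of_le_one hβ.le hβ1.le (hk.le_sum hrd hi)
      _ = (β ^ minCount β θ r n) ^ r := by rw [mul_comm, pow_mul]
      _ ≤ (z⁻¹) ^ r := pow_le_pow_left₀ (by positivity) (pow_shrinkCount_le hβ hβ1 hz0) r
  have h3 : (y⁻¹) ^ 4 * (n * (z⁻¹) ^ r) * (n : ℝ) ^ θ ≤ 1 := by
    have e1 : (y⁻¹) ^ 4 * (n * (z⁻¹) ^ r) * (n : ℝ) ^ θ = (n : ℝ) ^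
        (-((1 / (4 + r) + θ) * (4 : ℕ)) + (1 + -((1 - θ) / (4 + r) * r)) + θ : ℝ) := by
      rw [Real.rpow_add hn0, Real.rpow_add hn0, Real.rpow_add hn0, Real.rpow_one,
        Real.rpow_neg hn0.le, Real.rpow_neg hn0.le, Real.rpow_mul_natCast hn0.le,
        Real.rpow_mul_natCast hn0.le, inv_pow, inv_pow]
    rw [e1]
    refine Real.rpow_le_one_of_one_le_of_nonpos hn1 ?_
    have e2 : (-((1 / (4 + r) + θ) * (4 : ℕ)) + (1 + -((1 - θ) / (4 + r) * r)) + θ : ℝ) =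
        -(θ * (3 - r / (4 + r))) := by
      push_cast; field_simp; ring
    have e3 : (r : ℝ) / (4 + r) ≤ 1 := (div_le_one (by positivity)).mpr (by linarith)
    rw [e2]
    nlinarith
  have h4 : (bw β b₀ k j ^ 2) ^ 2 * (n * β ^ (∑ i, k i)) * (n : ℝ) ^ θ ≤ 1 := by
    have e1 : (bw β b₀ k j ^ 2) ^ 2 ≤ (y⁻¹) ^ 4 := by
      rw [← pow_mul]
      exact pow_le_pow_left₀ (bw_pos hβ hb j).le h1 4
    refine le_trans ?_ h3
    gcongr
  have h5 : 0 ≤ (bw β b₀ k j ^ 2) ^ 2 * (n * β ^ (∑ i, k i)) := by positivity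
  calc (|c.ν| * (c.M + c.a)) ^ 2 * (bw β b₀ k j ^ 2) ^ 2 * (n * β ^ (∑ i, k i))
      = (|c.ν| * (c.M + c.a)) ^ 2 * ((bw β b₀ k j ^ 2) ^ 2 * (n * β ^ (∑ i, k i))) := by ring
    _ ≤ ((c.σ * √c.cL / 8) ^ 2 * c.baseRate n d b₀ * (n : ℝ) ^ θ) *
        ((bw β b₀ k j ^ 2) ^ 2 * (n * β ^ (∑ i, k i))) := mul_le_mul_of_nonneg_right hl.halt h5
    _ = ((c.σ * √c.cL / 8) ^ 2 * c.baseRate n d b₀) *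
        ((bw β b₀ k j ^ 2) ^ 2 * (n * β ^ (∑ i, k i)) * (n : ℝ) ^ θ) := by ring
    _ ≤ (c.σ * √c.cL / 8) ^ 2 * c.baseRate n d b₀ := mul_le_of_le_one_right (by positivity) h4

/-- The error bound at the final bandwidths. -/
lemma LargeSample.sq_error_le (hc : c.Valid K) (hβ : 0 < β) (hβ1 : β < 1) (hθ : 0 < θ)
    (hθε : θ ≤ ε / 2) (hRε : R * θ ≤ ε / 2) (hrR : r ≤ R)
    (hl : LargeSample c β δ θ ε R n d b₀) (hk : IsConfig r (maxCount β θ r n) k)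
    (hi : ∀ i : Fin d, (i : ℕ) < r → minCount β θ r n ≤ k i) :
    (3 * c.bias r (bw β b₀ k) + 4 * c.S * c.σ * √c.cU * c.rate n (bw β b₀ k)) ^ 2 ≤
      (n : ℝ) ^ (-(4 / (4 + (r : ℝ))) + ε) := by
  have hb := hl.b₀_pos
  have hb1 := hl.b₀_le
  have hκ := hc.moments.κ_pos
  have hn := hl.two_le
  have hn1 : (1 : ℝ) ≤ n := by exact_mod_cast (by omega : 1 ≤ n)
  have hn0 : (0 : ℝ) < n := by linarith
  have hS := hc.S_pos
  have hM := hc.M_nonneg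
  have hG := hc.one_le_G
  have hg := baseRate_nonneg (n := n) (d := d) hκ hb
  have hrR' : (r : ℝ) ≤ R := by exact_mod_cast hrR
  set z := (n : ℝ) ^ ((1 - θ) / (4 + r) : ℝ) with hz
  have hz0 : 0 < z := by positivity
  have hrel : relSum r (bw β b₀ k) ≤ R * z⁻¹ := by
    refine (relSum_le (by positivity : 0 ≤ z⁻¹) fun j hj => ?_).trans (by gcongr)
    have : β ^ k j ≤ z⁻¹ :=
      (pow_le_pow_of_le_one hβ.le hβ1.le (hi j hj)).trans (pow_shrinkCount_le hβ hβ1 hz0)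
    calc bw β b₀ k j ≤ z⁻¹ * 1 := mul_le_mul this hb1 hb.le (by positivity)
      _ = z⁻¹ := mul_one _
  have hrel0 : 0 ≤ relSum r (bw β b₀ k) := relSum_nonneg fun j => (bw_pos hβ hb j).le
  have hbias : c.bias r (bw β b₀ k) ≤ c.M * (c.S * R) ^ 2 * c.G ^ R * (z⁻¹) ^ 2 := by
    calc c.bias r (bw β b₀ k) ≤ c.M * (c.S * (R * z⁻¹)) ^ 2 * c.G ^ R := by
          unfold Consts.bias
          gcongr
      _ = _ := by ring
  have hbias0 : 0 ≤ c.bias r (bw β b₀ k) := bias_nonneg hc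
  have h1 : ((z⁻¹) ^ 2) ^ 2 ≤ (n : ℝ) ^ (-(4 / (4 + (r : ℝ))) + ε / 2) := by
    have e1 : ((z⁻¹) ^ 2) ^ 2 = (n : ℝ) ^ (-((1 - θ) / (4 + r) * (4 : ℕ)) : ℝ) := by
      rw [Real.rpow_neg hn0.le, Real.rpow_mul_natCast hn0.le, ← pow_mul, inv_pow]
    rw [e1]
    refine Real.rpow_le_rpow_of_exponent_le hn1 ?_
    have e2 : -((1 - θ) / (4 + r) * (4 : ℕ)) = -(4 / (4 + (r : ℝ))) + θ * (4 / (4 + r)) := by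
      push_cast; field_simp; ring
    have e3 : (4 : ℝ) / (4 + r) ≤ 1 := (div_le_one (by positivity)).mpr (by linarith [r.cast_nonneg (α := ℝ)])
    rw [e2]
    nlinarith
  have h2 : c.rate n (bw β b₀ k) ^ 2 ≤
      c.baseRate n d b₀ * (β ^ R)⁻¹ * (n : ℝ) ^ (-(4 / (4 + (r : ℝ))) + ε / 2) := by
    rw [rate_bw_sq hκ hβ hb]
    have e1 := hk.rpow_le_mul hβ hβ1 hθ hrR (by omega : 1 ≤ n)
    calc c.baseRate n d b₀ / (n * β ^ (∑ j, k j)) ≤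
          c.baseRate n d b₀ / (β ^ R * (n : ℝ) ^ (4 / (4 + r) - R * θ : ℝ)) := by gcongr
      _ = c.baseRate n d b₀ * (β ^ R)⁻¹ * (n : ℝ) ^ (-(4 / (4 + r) - R * θ) : ℝ) := by
          rw [Real.rpow_neg hn0.le]; field_simp
      _ ≤ _ := by
          refine mul_le_mul_of_nonneg_left (Real.rpow_le_rpow_of_exponent_le hn1 ?_) (by positivity)
          linarith
  have h3 : (n : ℝ) ^ (-(4 / (4 + (r : ℝ))) + ε) =
      (n : ℝ) ^ (ε / 2) * (n : ℝ) ^ (-(4 / (4 + (r : ℝ))) + ε / 2) := by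
    rw [← Real.rpow_add hn0]; congr 1; ring
  rw [h3]
  set N := (n : ℝ) ^ (-(4 / (4 + (r : ℝ))) + ε / 2) with hN
  have hN0 : 0 ≤ N := by positivity
  calc (3 * c.bias r (bw β b₀ k) + 4 * c.S * c.σ * √c.cU * c.rate n (bw β b₀ k)) ^ 2
      ≤ 18 * c.bias r (bw β b₀ k) ^ 2 +
        2 * (4 * c.S * c.σ * √c.cU) ^ 2 * c.rate n (bw β b₀ k) ^ 2 := by
        nlinarith [sq_nonneg (3 * c.bias r (bw β b₀ k) -
          4 * c.S * c.σ * √c.cU * c.rate n (bw β b₀ k))]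
    _ ≤ 18 * ((c.M * (c.S * R) ^ 2 * c.G ^ R) ^ 2 * N) +
        2 * (4 * c.S * c.σ * √c.cU) ^ 2 * (c.baseRate n d b₀ * (β ^ R)⁻¹ * N) := by
        have e1 : c.bias r (bw β b₀ k) ^ 2 ≤ (c.M * (c.S * R) ^ 2 * c.G ^ R) ^ 2 * N := by
          refine (pow_le_pow_left₀ hbias0 hbias 2).trans ?_
          rw [mul_pow]
          exact mul_le_mul_of_nonneg_left h1 (sq_nonneg _)
        gcongr
    _ = (18 * (c.M * (c.S * R) ^ 2 * c.G ^ R) ^ 2 +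
        2 * (4 * c.S * c.σ * √c.cU) ^ 2 * c.baseRate n d b₀ * (β ^ R)⁻¹) * N := by ring
    _ ≤ _ := mul_le_mul_of_nonneg_right hl.error hN0

/-- The rodeo estimate has a small error if the sample is good at all bandwidths on the possible
paths of the algorithm. -/
lemma LargeSample.sq_estimate_sub_le (hc : c.Valid K) (hβ : 0 < β) (hβ1 : β < 1) (hθ : 0 < θ)
    (hθR : R * θ ≤ 2 / (4 + R : ℝ)) (hθε : θ ≤ ε / 2) (hRε : R * θ ≤ ε / 2) (hrR : r ≤ R)
    (hrd : r ≤ d) (hx : ∀ j, δ ≤ x j ∧ x j ≤ 1 - δ) {c₀ : ℝ}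
    (hl : LargeSample c β δ θ ε R n d (h₀ c₀ n)) {m : (Fin d → ℝ) → ℝ}
    (hm : HasBoundedDerivs m c.M) (hdep : DependsOnFirst r m)
    (ha : ∀ j : Fin d, (j : ℕ) < r → c.a ≤ |partialDeriv m ![j, j] x|)
    {X : Fin n → Fin d → ℝ} {ξ : Fin n → ℝ}
    (hg : ∀ k, IsConfig r (maxCount β θ r n) k →
      GoodAt c K r x (bw β (h₀ c₀ n) k) (remainder m r c.S x (bw β (h₀ c₀ n) k)) X ξ)
    (mode : Mode) :
    (estimate mode K β c₀ c.σ X (fun i => m (X i) + ξ i) x - m x) ^ 2 ≤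
      (n : ℝ) ^ (-(4 / (4 + (r : ℝ))) + ε) := by
  have hs := fun k (hk : IsConfig r (maxCount β θ r n) k) =>
    hl.small hc hβ hβ1 hθ hθR hrR hx hk
  have hn1 : 1 ≤ n := by have := hl.two_le; omega
  have htests : GoodTests r (minCount β θ r n) (maxCount β θ r n) β (h₀ c₀ n)
      (fun h j => threshold K c.σ X x h j < |Z K X (fun i => m (X i) + ξ i) x h j|) := by
    refine ⟨fun k hk j hj => ?_, fun k hk j hj hjA hi => ?_, fun k hk j hj hjT hi => ?_⟩
    · exact not_lt.mpr ((hg k hk).abs_Z_le_of_irrelevant hc (hs k hk) hm hdep hj)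
    · exact (hg k hk).lt_abs_Z hc (hs k hk) hm hdep hj (ha j hj)
        (hl.rate_lt hc hβ hβ1 hrR hk hjA hi)
    · exact not_lt.mpr ((hg k hk).abs_Z_le_of_small hc (hs k hk) hm hdep hj
        (hl.sq_le_rate hc hβ hβ1 hθ hrd hk hjT hi))
  obtain ⟨k, hk, hkA, hfin⟩ := exists_config_of_goodTests
    (minCount_le_maxCount hβ hβ1 hθ hn1) htests mode
  have hstar : hStar mode K β c₀ c.σ X (fun i => m (X i) + ξ i) x = bw β (h₀ c₀ n) k := hfin
  rw [estimate, hstar]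
  refine le_trans ?_ (hl.sq_error_le hc hβ hβ1 hθ hθε hRε hrR hk hkA)
  exact sq_le_sq' (by
    have := (abs_le.mp ((hg k hk).abs_mHat_sub_le hc (hs k hk) hm hdep hrd)).1
    linarith) (le_of_abs_le ((hg k hk).abs_mHat_sub_le hc (hs k hk) hm hdep hrd))

end Regime

/-! ### Sequences that grow slower than all powers -/

/-- `f n` is eventually smaller than every positive power of `n`. -/
def Subpoly (f : ℕ → ℝ) : Prop := ∀ s : ℝ, 0 < s → ∀ᶠ n : ℕ in atTop, |f n| ≤ (n : ℝ) ^ s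

namespace Subpoly

variable {f g : ℕ → ℝ}

lemma of_le (hg : Subpoly g) (h : ∀ᶠ n in atTop, |f n| ≤ |g n|) : Subpoly f := fun s hs => by
  filter_upwards [hg s hs, h] with n h1 h2 using h2.trans h1

lemma mul (hf : Subpoly f) (hg : Subpoly g) : Subpoly fun n => f n * g n := fun s hs => by
  filter_upwards [hf (s / 2) (by positivity), hg (s / 2) (by positivity), eventually_gt_atTop 0]
    with n h1 h2 hn
  have hn0 : (0 : ℝ) < n := by exact_mod_cast hn
  rw [abs_mul, ← add_halves s, Real.rpow_add hn0]
  gcongr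

lemma const (y : ℝ) : Subpoly fun _ => y := fun _ hs =>
  ((tendsto_rpow_atTop hs).comp tendsto_natCast_atTop_atTop).eventually_ge_atTop |y|

lemma pow (hf : Subpoly f) (k : ℕ) : Subpoly fun n => f n ^ k := by
  induction k with
  | zero => simpa using const 1
  | succ k ih => simpa [pow_succ] using ih.mul hf

lemma add (hf : Subpoly f) (hg : Subpoly g) : Subpoly fun n => f n + g n := fun s hs => by
  filter_upwards [hf (s / 2) (by positivity), hg (s / 2) (by positivity),
    const 2 (s / 2) (by positivity), eventually_gt_atTop 0] with n h1 h2 h3 hn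
  have hn0 : (0 : ℝ) < n := by exact_mod_cast hn
  rw [abs_two] at h3
  calc |f n + g n| ≤ |f n| + |g n| := abs_add_le _ _
    _ ≤ 2 * (n : ℝ) ^ (s / 2) := by linarith
    _ ≤ (n : ℝ) ^ (s / 2) * (n : ℝ) ^ (s / 2) := by gcongr
    _ = (n : ℝ) ^ s := by rw [← Real.rpow_add hn0, add_halves]

lemma log : Subpoly fun n => Real.log n := fun s hs => by
  have h := ((isLittleO_log_rpow_atTop hs).comp_tendsto tendsto_natCast_atTop_atTop).bound one_pos
  filter_upwards [h] with n hn
  simp only [Function.comp_apply, one_mul, Real.norm_eq_abs] at hn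
  rwa [abs_of_nonneg (by positivity : (0 : ℝ) ≤ (n : ℝ) ^ s)] at hn

lemma eventually_lt (hf : Subpoly f) {s : ℝ} (hs : 0 < s) :
    ∀ᶠ n : ℕ in atTop, f n < (n : ℝ) ^ s := by
  filter_upwards [hf (s / 2) (by positivity), eventually_gt_atTop 1] with n h1 hn
  refine (le_abs_self _).trans_lt (h1.trans_lt ?_)
  exact Real.rpow_lt_rpow_of_exponent_lt (by exact_mod_cast hn) (by linarith)

end Subpoly

lemma tendsto_log_natCast : Tendsto (fun n : ℕ => Real.log n) atTop atTop :=
  Real.tendsto_log_atTop.comp tendsto_natCast_atTop_atTop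

lemma tendsto_log_log_natCast : Tendsto (fun n : ℕ => Real.log (Real.log n)) atTop atTop :=
  Real.tendsto_log_atTop.comp tendsto_log_natCast

section Dimension

variable {d : ℕ → ℕ}

lemma exists_dim_mul_le
    (hd : (fun n => (d n : ℝ)) =O[atTop] fun n : ℕ => Real.log n / Real.log (Real.log n)) :
    ∃ C : ℝ, 0 < C ∧ ∀ᶠ n : ℕ in atTop, d n * Real.log (Real.log n) ≤ C * Real.log n := by
  obtain ⟨C, hC, h⟩ := hd.exists_pos
  refine ⟨C, hC, ?_⟩
  filter_upwards [h.bound, tendsto_log_natCast.eventually_gt_atTop 0,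
    tendsto_log_log_natCast.eventually_gt_atTop 0] with n h1 h2 h3
  rw [Real.norm_of_nonneg (Nat.cast_nonneg _), Real.norm_of_nonneg (by positivity),
    ← mul_div_assoc, le_div_iff₀ h3] at h1
  exact h1

lemma Subpoly.pow_dim
    (hd : (fun n => (d n : ℝ)) =O[atTop] fun n : ℕ => Real.log n / Real.log (Real.log n))
    {y : ℕ → ℝ} (hy1 : ∀ᶠ n in atTop, 1 ≤ y n)
    (hy : Tendsto (fun n : ℕ => Real.log (y n) / Real.log (Real.log n)) atTop (nhds 0)) :
    Subpoly fun n => y n ^ d n := fun s hs => by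
  obtain ⟨C, hC, h⟩ := exists_dim_mul_le hd
  filter_upwards [h, hy1, hy.eventually_le_const (by positivity : 0 < s / C),
    tendsto_log_log_natCast.eventually_gt_atTop 0, eventually_gt_atTop 0] with n h1 h2 h3 h4 hn
  have hn0 : (0 : ℝ) < n := by exact_mod_cast hn
  have hy0 : 0 < y n := by linarith
  rw [abs_of_pos (by positivity), ← Real.exp_log (pow_pos hy0 (d n)), Real.log_pow,
    Real.rpow_def_of_pos hn0, Real.exp_le_exp]
  rw [div_le_iff₀ h4] at h3
  calc d n * Real.log (y n) ≤ d n * (s / C * Real.log (Real.log n)) := by gcongr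
    _ = s / C * (d n * Real.log (Real.log n)) := by ring
    _ ≤ s / C * (C * Real.log n) := by gcongr
    _ = Real.log n * s := by field_simp

lemma Subpoly.const_pow_dim
    (hd : (fun n => (d n : ℝ)) =O[atTop] fun n : ℕ => Real.log n / Real.log (Real.log n))
    (y : ℝ) : Subpoly fun n => y ^ d n := by
  refine (Subpoly.pow_dim hd (y := fun _ => max 1 |y|) (Eventually.of_forall fun _ => le_max_left _ _)
    (tendsto_log_log_natCast.const_div_atTop _)).of_le (Eventually.of_forall fun n => ?_)
  rw [abs_pow, abs_pow]
  exact pow_le_pow_left₀ (abs_nonneg _) ((le_max_right _ _).trans (le_abs_self _)) _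

lemma Subpoly.dim
    (hd : (fun n => (d n : ℝ)) =O[atTop] fun n : ℕ => Real.log n / Real.log (Real.log n)) :
    Subpoly fun n => (d n : ℝ) := by
  obtain ⟨C, hC, h⟩ := exists_dim_mul_le hd
  refine ((Subpoly.const C).mul Subpoly.log).of_le ?_
  filter_upwards [h, tendsto_log_natCast.eventually_gt_atTop 0,
    tendsto_log_log_natCast.eventually_ge_atTop 1] with n h1 h2 h3
  rw [abs_of_nonneg (by positivity), abs_of_nonneg (by positivity)]
  nlinarith [(d n).cast_nonneg (α := ℝ)]

variable {c₀ : ℝ}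

lemma tendsto_h₀ : Tendsto (fun n => h₀ c₀ n) atTop (nhds 0) :=
  tendsto_log_log_natCast.const_div_atTop _

lemma eventually_h₀_pos (hc₀ : 0 < c₀) : ∀ᶠ n in atTop, 0 < h₀ c₀ n := by
  filter_upwards [tendsto_log_log_natCast.eventually_gt_atTop 0] with n hn using div_pos hc₀ hn

lemma Subpoly.inv_h₀ : Subpoly fun n => (h₀ c₀ n)⁻¹ := by
  refine (Subpoly.log.mul (Subpoly.const c₀⁻¹)).of_le ?_
  filter_upwards [tendsto_log_natCast.eventually_gt_atTop 0,
    tendsto_log_log_natCast.eventually_gt_atTop 0] with n h1 h2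
  rw [h₀, inv_div, div_eq_mul_inv, abs_mul, abs_mul, abs_of_pos h1, abs_of_pos h2]
  have := Real.log_le_self h1.le
  gcongr

lemma Subpoly.inv_h₀_pow_dim
    (hd : (fun n => (d n : ℝ)) =O[atTop] fun n : ℕ => Real.log n / Real.log (Real.log n))
    (hc₀ : 0 < c₀) : Subpoly fun n => (h₀ c₀ n)⁻¹ ^ d n := by
  refine Subpoly.pow_dim hd ?_ ?_
  · filter_upwards [eventually_h₀_pos hc₀, tendsto_h₀.eventually_le_const one_pos] with n h1 h2
      using (one_le_inv₀ h1).mpr h2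
  · have h1 : Tendsto (fun n : ℕ => Real.log (Real.log (Real.log n)) / Real.log (Real.log n) -
        Real.log c₀ / Real.log (Real.log n)) atTop (nhds (0 - 0)) :=
      (Real.isLittleO_log_id_atTop.tendsto_div_nhds_zero.comp tendsto_log_log_natCast).sub
        (tendsto_log_log_natCast.const_div_atTop _)
    rw [sub_zero] at h1
    refine h1.congr' ?_
    filter_upwards [tendsto_log_log_natCast.eventually_gt_atTop 0] with n hn
    rw [h₀, inv_div, Real.log_div hn.ne' hc₀.ne', sub_div]

lemma Subpoly.baseRate
    (hd : (fun n => (d n : ℝ)) =O[atTop] fun n : ℕ => Real.log n / Real.log (Real.log n))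
    (hc₀ : 0 < c₀) (c : Consts) : Subpoly fun n => c.baseRate n (d n) (h₀ c₀ n) := by
  refine (((Subpoly.const_pow_dim hd c.κ).mul Subpoly.log).mul
    (Subpoly.inv_h₀_pow_dim hd hc₀)).of_le (Eventually.of_forall fun n => le_of_eq ?_)
  rw [Consts.baseRate, inv_pow, div_eq_mul_inv]

lemma eventually_largeSample {c : Consts} {K : ℝ → ℝ} (hc : c.Valid K)
    (hd : (fun n => (d n : ℝ)) =O[atTop] fun n : ℕ => Real.log n / Real.log (Real.log n))
    (hc₀ : 0 < c₀) {β δ θ ε : ℝ} (hβ : 0 < β) (hδ : 0 < δ) (hθ : 0 < θ) (hε : 0 < ε) (R : ℕ) :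
    ∀ᶠ n in atTop, LargeSample c β δ θ ε R n (d n) (h₀ c₀ n) := by
  have hσ := hc.σ_pos
  have ha := hc.a_pos
  have hL := hc.cL_pos
  have hκ := hc.moments.κ_pos
  have hν : 0 < |c.ν| := abs_pos.mpr hc.moments.ν_ne
  have hτ : (0 : ℝ) < 2 / (4 + R) := by positivity
  have hbR : 0 < β ^ R := pow_pos hβ R
  have hbase := Subpoly.baseRate hd hc₀ c
  have small : ∀ {f : ℝ → ℝ} {t : ℝ}, Continuous f → f 0 < t → ∀ᶠ n in atTop, f (h₀ c₀ n) ≤ t :=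
    fun {f t} hf ht => ((hf.tendsto 0).comp tendsto_h₀).eventually_le_const ht
  have e_window := ((continuous_const_mul c.S).tendsto 0 |>.comp
    (tendsto_h₀ (c₀ := c₀))).eventually_lt_const (u := δ) (by simpa using hδ)
  have e_bias := small (t := c.σ * √c.cL / 2) (f := fun b => 16 * c.Cθ * c.Cη * (R + 2) *
    (c.M * (c.S * (R * b)) ^ 2 * c.G ^ R)) (by fun_prop) (by
      have : 0 < √c.cL := Real.sqrt_pos.mpr hL
      simp only [mul_zero, zero_pow two_ne_zero, zero_mul]
      positivity)
  have e_curv := small (t := |c.ν| * c.a) (f := fun b => 2 * c.M * c.S ^ 3 * c.G ^ R * (R * b))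
    (by fun_prop) (by simp only [mul_zero]; positivity)
  have e_bern := ((((((Subpoly.const 16).mul (Subpoly.const_pow_dim hd (c.B ^ 2))).mul
    Subpoly.log).mul (Subpoly.inv_h₀_pow_dim hd hc₀)).mul (Subpoly.const_pow_dim hd c.κ⁻¹)).mul
    (Subpoly.const ((β ^ R)⁻¹ * c.cL⁻¹))).eventually_lt hτ
  have e_fluct := (((((Subpoly.dim hd).add (Subpoly.const 1)).mul (Subpoly.const
    (8 * c.Cθ * c.S * c.Cη * (1 + 3 * c.cU / c.cL)))).pow 2 |>.mul hbase).mul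
    (Subpoly.const (β ^ R)⁻¹)).eventually_lt hτ
  have e_shrink := (((Subpoly.const ((12 * c.σ * √c.cU) ^ 2)).mul hbase).mul
    ((Subpoly.inv_h₀ (c₀ := c₀)).pow 4 |>.mul
      (Subpoly.const ((|c.ν| * c.a) ^ 2 * β ^ R)⁻¹))).eventually_lt hθ
  have e_stop := ((Subpoly.const ((|c.ν| * (c.M + c.a)) ^ 2 * ((c.σ * √c.cL / 8) ^ 2)⁻¹)).mul
    (Subpoly.const_pow_dim hd c.κ⁻¹)).eventually_lt hθ
  have e_error := ((Subpoly.const (18 * (c.M * (c.S * R) ^ 2 * c.G ^ R) ^ 2)).add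
    (((Subpoly.const (2 * (4 * c.S * c.σ * √c.cU) ^ 2)).mul hbase).mul
      (Subpoly.const (β ^ R)⁻¹))).eventually_lt (half_pos hε)
  filter_upwards [eventually_ge_atTop 2, eventually_h₀_pos hc₀,
    (tendsto_h₀ (c₀ := c₀)).eventually_le_const one_pos, e_window, e_bias, e_curv, e_bern, e_fluct,
    e_shrink, e_stop, e_error, tendsto_log_natCast.eventually_ge_atTop 1]
    with n h1 h2 h3 h4 h5 h6 h7 h8 h9 h10 h11 h12
  have hn0 : (0 : ℝ) < n := by exact_mod_cast (by omega : 0 < n)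
  refine ⟨h1, h2, h3, h4, h5, h6, ?_, ?_, ?_, ?_, h11.le⟩
  · have hX : 0 < β ^ R * h₀ c₀ n ^ d n * (c.cL * c.κ ^ d n) := by positivity
    have := mul_le_mul_of_nonneg_left h7.le hX.le
    refine (le_of_eq ?_).trans (this.trans (le_of_eq ?_))
    · rw [inv_pow, inv_pow, pow_mul]
      field_simp
    · ring
  · have := mul_le_mul_of_nonneg_left h8.le hbR.le
    refine (le_of_eq ?_).trans this
    field_simp
  · have hX : 0 < (|c.ν| * c.a * h₀ c₀ n ^ 2) ^ 2 * β ^ R := by positivity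
    have := mul_lt_mul_of_pos_left h9 hX
    refine (le_of_eq ?_).trans_lt (this.trans_eq ?_)
    · field_simp
    · ring
  · have hY : 0 < (c.σ * √c.cL / 8) ^ 2 := by
      have : 0 < √c.cL := Real.sqrt_pos.mpr hL
      positivity
    have hle : c.κ ^ d n ≤ c.baseRate n (d n) (h₀ c₀ n) := by
      rw [Consts.baseRate, le_div_iff₀ (by positivity)]
      have : h₀ c₀ n ^ d n ≤ 1 := pow_le_one₀ h2.le h3
      gcongr
      linarith
    have := mul_le_mul_of_nonneg_left h10.le (by positivity : 0 ≤ (c.σ * √c.cL / 8) ^ 2 * c.κ ^ d n)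
    calc (|c.ν| * (c.M + c.a)) ^ 2 = (c.σ * √c.cL / 8) ^ 2 * c.κ ^ d n *
        ((|c.ν| * (c.M + c.a)) ^ 2 * ((c.σ * √c.cL / 8) ^ 2)⁻¹ * c.κ⁻¹ ^ d n) := by
          rw [inv_pow]; generalize (c.σ * √c.cL / 8) ^ 2 = w at hY; field_simp
      _ ≤ _ := this
      _ ≤ _ := by gcongr

/-- The number of possible paths is too small to matter in a union bound. -/
lemma eventually_union_bound_le
    (hd : (fun n => (d n : ℝ)) =O[atTop] fun n : ℕ => Real.log n / Real.log (Real.log n))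
    {β θ : ℝ} (hβ : 0 < β) (hβ1 : β < 1) (hθ : 0 < θ) (R : ℕ) {η : ℝ} (hη : 0 < η) :
    ∀ᶠ n : ℕ in atTop, ∀ r ≤ R, ((maxCount β θ r n : ℝ) + 1) ^ r *
      (10 * (d n + 1) ^ 3 * (n : ℝ) ^ (-(1 / 4) : ℝ)) ≤ η := by
  have hL := log_inv_pos hβ hβ1
  have h1 := (((((Subpoly.const ((1 + θ) / Real.log β⁻¹)).mul Subpoly.log).add
    (Subpoly.const 2)).pow R).mul ((Subpoly.const 10).mul
    (((Subpoly.dim hd).add (Subpoly.const 1)).pow 3))).eventually_lt (by norm_num : (0 : ℝ) < 1 / 8)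
  have h2 : Tendsto (fun n : ℕ => (n : ℝ) ^ (-(1 / 8) : ℝ)) atTop (nhds 0) :=
    (tendsto_rpow_neg_atTop (by norm_num)).comp tendsto_natCast_atTop_atTop
  filter_upwards [h1, h2.eventually_le_const hη, eventually_gt_atTop 0] with n h1 h2 hn r hr
  have hn1 : (1 : ℝ) ≤ n := by exact_mod_cast hn
  have hn0 : (0 : ℝ) < n := by linarith
  have hlog := Real.log_nonneg hn1
  have e1 : (maxCount β θ r n : ℝ) + 1 ≤ (1 + θ) / Real.log β⁻¹ * Real.log n + 2 := by
    have := shrinkCount_le hβ hβ1 (y := (n : ℝ) ^ (1 / (4 + r) + θ : ℝ))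
      (Real.one_le_rpow hn1 (by positivity))
    rw [Real.log_rpow hn0] at this
    have e2 : (1 / (4 + r) + θ : ℝ) * Real.log n ≤ (1 + θ) * Real.log n := by
      have : (1 : ℝ) / (4 + r) ≤ 1 := (div_le_one (by positivity)).mpr
        (by linarith [r.cast_nonneg (α := ℝ)])
      gcongr
    have e3 := div_le_div_of_nonneg_right e2 hL.le
    rw [div_mul_eq_mul_div]
    rw [maxCount]
    linarith
  have e2 : ((maxCount β θ r n : ℝ) + 1) ^ r ≤
      ((1 + θ) / Real.log β⁻¹ * Real.log n + 2) ^ R :=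
    (pow_le_pow_left₀ (by positivity) e1 r).trans (pow_le_pow_right₀ (by
      have : 0 ≤ (1 + θ) / Real.log β⁻¹ * Real.log n := by positivity
      linarith) hr)
  calc ((maxCount β θ r n : ℝ) + 1) ^ r * (10 * (d n + 1) ^ 3 * (n : ℝ) ^ (-(1 / 4) : ℝ))
      ≤ ((1 + θ) / Real.log β⁻¹ * Real.log n + 2) ^ R *
        (10 * (d n + 1) ^ 3 * (n : ℝ) ^ (-(1 / 4) : ℝ)) := by gcongr
    _ = (((1 + θ) / Real.log β⁻¹ * Real.log n + 2) ^ R * (10 * (d n + 1) ^ 3)) *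
        (n : ℝ) ^ (-(1 / 4) : ℝ) := by ring
    _ ≤ (n : ℝ) ^ (1 / 8 : ℝ) * (n : ℝ) ^ (-(1 / 4) : ℝ) := by gcongr
    _ = (n : ℝ) ^ (-(1 / 8) : ℝ) := by rw [← Real.rpow_add hn0]; norm_num
    _ ≤ η := h2

end Dimension

/-! ### Union bound over the paths -/

lemma IsSample.hasLaw {Ω : Type*} [MeasurableSpace Ω] {P : Measure Ω} [IsProbabilityMeasure P]
    {n d : ℕ} {σ : ℝ≥0} {X : Fin n → Ω → Fin d → ℝ} {ξ : Fin n → Ω → ℝ}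
    (h : IsSample P σ X ξ) :
    HasLaw (fun ω => ((fun i => X i ω), fun i => ξ i ω)) (dataLaw n d σ) P :=
  (indepFun_iff_hasLaw_prodMk_prod (h.indep_X.hasLaw_pi h.law_X)
    (h.indep_noise.hasLaw_pi h.law_noise)).mp h.indep

lemma HasBoundedDerivs.mono {d : ℕ} {m : (Fin d → ℝ) → ℝ} {M M' : ℝ} (hm : HasBoundedDerivs m M)
    (h : M ≤ M') : HasBoundedDerivs m M' :=
  ⟨hm.contDiffOn, hm.differentiableOn, fun k h1 h4 i y hy => (hm.bound k h1 h4 i y hy).trans h⟩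

/-- With high probability, the sample is good at all bandwidths on the possible paths. -/
lemma IsSample.measure_not_goodAt_le {Ω : Type*} [MeasurableSpace Ω] {P : Measure Ω}
    [IsProbabilityMeasure P] {n d r T : ℕ} {σ : ℝ≥0} {X : Fin n → Ω → Fin d → ℝ}
    {ξ : Fin n → Ω → ℝ} (h : IsSample P σ X ξ) {c : Consts} {K : ℝ → ℝ} (hc : c.Valid K)
    {L : ℝ≥0} (hL : LipschitzWith L K) (hσ : 0 < σ) (hcσ : c.σ = σ) {m : (Fin d → ℝ) → ℝ}
    (hm : HasBoundedDerivs m c.M) {x : Fin d → ℝ} {β b₀ : ℝ}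
    (hs : ∀ k, IsConfig r T k → Small c n r x (bw β b₀ k)) :
    P {ω | ¬ ∀ k, IsConfig r T k → GoodAt c K r x (bw β b₀ k)
      (remainder m r c.S x (bw β b₀ k)) (fun i => X i ω) (fun i => ξ i ω)} ≤
      ENNReal.ofReal (((T : ℝ) + 1) ^ r * (10 * (d + 1) ^ 3 * (n : ℝ) ^ (-(1 / 4) : ℝ))) := by
  set cfg : (Fin r → Fin (T + 1)) → Fin d → ℕ := fun v j =>
    if hj : (j : ℕ) < r then (v ⟨j, hj⟩ : ℕ) else 0 with hcfg
  have hcfg1 : ∀ v, IsConfig r T (cfg v) := fun v j => by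
    simp only [hcfg]
    split_ifs with hj
    · exact ⟨Nat.lt_succ_iff.mp (v ⟨j, hj⟩).2, fun hr => absurd hj (not_lt.mpr hr)⟩
    · exact ⟨Nat.zero_le _, fun _ => rfl⟩
  have hcfg2 : ∀ k : Fin d → ℕ, IsConfig r T k → ∃ v, cfg v = k := fun k hk => by
    refine ⟨fun i => if hi : (i : ℕ) < d then ⟨k ⟨i, hi⟩, Nat.lt_succ_of_le (hk _).1⟩ else 0, ?_⟩
    funext j
    by_cases hj : (j : ℕ) < r
    · simp [hcfg, hj]
    · simpa [hcfg, hj] using ((hk j).2 (not_lt.mp hj)).symm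
  set bad : (Fin r → Fin (T + 1)) → Set ((Fin n → Fin d → ℝ) × (Fin n → ℝ)) := fun v =>
    {ω | ¬ GoodAt c K r x (bw β b₀ (cfg v)) (remainder m r c.S x (bw β b₀ (cfg v))) ω.1 ω.2}
    with hbad
  have hlaw := h.hasLaw
  have h1 : {ω | ¬ ∀ k, IsConfig r T k → GoodAt c K r x (bw β b₀ k)
      (remainder m r c.S x (bw β b₀ k)) (fun i => X i ω) (fun i => ξ i ω)} ⊆
      (fun ω => ((fun i => X i ω), fun i => ξ i ω)) ⁻¹' ⋃ v, bad v := by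
    intro ω hω
    simp only [Set.mem_ofPred_eq, not_forall] at hω
    obtain ⟨k, hk, hnot⟩ := hω
    obtain ⟨v, rfl⟩ := hcfg2 k hk
    exact Set.mem_iUnion.mpr ⟨v, hnot⟩
  calc _ ≤ _ := measure_mono h1
    _ ≤ P.map (fun ω => ((fun i => X i ω), fun i => ξ i ω)) (⋃ v, bad v) :=
        Measure.le_map_apply hlaw.aemeasurable _
    _ = dataLaw n d σ (⋃ v, bad v) := by rw [hlaw.map_eq]
    _ ≤ ∑ v, dataLaw n d σ (bad v) := measure_iUnion_fintype_le _ _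
    _ ≤ ∑ _v : Fin r → Fin (T + 1),
        ENNReal.ofReal (10 * (d + 1) ^ 3 * (n : ℝ) ^ (-(1 / 4) : ℝ)) :=
        Finset.sum_le_sum fun v _ =>
          dataLaw_not_goodAt_le hc hL hσ hcσ (hs _ (hcfg1 v)) hm
    _ = _ := by
        rw [Finset.sum_const, Finset.card_univ, Fintype.card_fun, Fintype.card_fin,
          Fintype.card_fin, nsmul_eq_mul, ← ENNReal.ofReal_natCast, ← ENNReal.ofReal_mul
          (by positivity)]
        congr 2
        push_cast
        ring

end

end Rodeo

theorem corollary5p2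
    -- tuning constants, noise level and kernel
    (mode : Rodeo.Mode) (β c₀ : ℝ) (hβ0 : 0 < β) (hβ1 : β < 1) (hc₀ : 0 < c₀)
    (σ : ℝ≥0) (hσ : 0 < σ) (K : ℝ → ℝ) (hK : Rodeo.IsKernel K)
    -- dimension and number of relevant variables
    (d r : ℕ → ℕ) (hrd : ∀ n, r n ≤ d n)
    (hr : (fun n => (r n : ℝ)) =O[atTop] fun _ => (1 : ℝ))
    (hd : (fun n => (d n : ℝ)) =O[atTop] fun n : ℕ => Real.log n / Real.log (Real.log n))
    -- target points, uniformly interior to the cube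
    (x : ∀ n, Fin (d n) → ℝ) (δ : ℝ) (hδ : 0 < δ) (hx : ∀ n j, δ ≤ x n j ∧ x n j ≤ 1 - δ)
    -- regression functions
    (m : ∀ n, (Fin (d n) → ℝ) → ℝ) (hsparse : ∀ n, Rodeo.DependsOnFirst (r n) (m n))
    (M : ℝ) (hm : ∀ n, Rodeo.HasBoundedDerivs (m n) M)
    (a : ℝ) (ha : 0 < a)
    (hmin : ∀ᶠ n in atTop, ∀ j : Fin (d n), (j : ℕ) < r n →
      a ≤ |Rodeo.partialDeriv (m n) ![j, j] (x n)|)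
    -- the data, a triangular array
    {Ω : ℕ → Type*} [∀ n, MeasurableSpace (Ω n)] (P : ∀ n, Measure (Ω n))
    [∀ n, IsProbabilityMeasure (P n)]
    (X : ∀ n, Fin n → Ω n → Fin (d n) → ℝ) (ξ : ∀ n, Fin n → Ω n → ℝ)
    (hsample : ∀ n, Rodeo.IsSample (P n) σ (X n) (ξ n))
    (Y : ∀ n, Fin n → Ω n → ℝ) (hY : ∀ n i ω, Y n i ω = m n (X n i ω) + ξ n i ω)
    (ε : ℝ) (hε : 0 < ε) :
    Rodeo.IsBigOP P
      (fun n ω =>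
        (Rodeo.estimate mode K β c₀ σ (fun i => X n i ω) (fun i => Y n i ω) (x n)
          - m n (x n)) ^ 2)
      (fun n => (n : ℝ) ^ (-(4 / (4 + (r n : ℝ))) + ε)) := by
  obtain ⟨S, B, hb⟩ := hK.exists_bounds
  obtain ⟨ν, κ, κ', hmom⟩ := hK.exists_moments
  obtain ⟨L, hL⟩ := hK.lipschitz
  set c : Rodeo.Consts := ⟨S, B, ν, κ, κ', σ, |M|, a⟩ with hcdef
  have hc : c.Valid K := ⟨hb, hmom, hσ, abs_nonneg M, ha⟩
  obtain ⟨R₀, hR₀⟩ := hr.bound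
  set R := ⌈R₀⌉₊ with hR
  -- precision of the final bandwidths, in powers of the sample size
  set θ : ℝ := min (ε / 2) (2 / (4 + R)) / (R + 1) with hθdef
  have hmin0 : 0 < min (ε / 2) (2 / (4 + R : ℝ)) := lt_min (by positivity) (by positivity)
  have hθ : 0 < θ := by positivity
  have hθ' : (R + 1) * θ = min (ε / 2) (2 / (4 + R : ℝ)) := by rw [hθdef]; field_simp
  have hRθ : (0 : ℝ) ≤ R * θ := by positivity
  have hθε : θ ≤ ε / 2 := by linarith [min_le_left (ε / 2) (2 / (4 + R : ℝ))]
  have hRε : R * θ ≤ ε / 2 := by linarith [min_le_left (ε / 2) (2 / (4 + R : ℝ))]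
  have hθR : R * θ ≤ 2 / (4 + R : ℝ) := by linarith [min_le_right (ε / 2) (2 / (4 + R : ℝ))]
  intro η hη
  refine ⟨1, one_pos, ?_⟩
  have hη' : 0 < (min η 1).toReal :=
    ENNReal.toReal_pos (lt_min hη one_pos).ne' (ne_top_of_le_ne_top ENNReal.one_ne_top
      (min_le_right _ _))
  filter_upwards [hR₀, hmin, Rodeo.eventually_largeSample (ε := ε) hc hd hc₀ hβ0 hδ hθ hε R,
    Rodeo.eventually_union_bound_le hd hβ0 hβ1 hθ R hη'] with n h1 h2 h3 h4
  have hrR : r n ≤ R := by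
    have : (r n : ℝ) ≤ R₀ := by simpa using h1
    exact_mod_cast this.trans (Nat.le_ceil R₀)
  have hmn : Rodeo.HasBoundedDerivs (m n) c.M := (hm n).mono (le_abs_self M)
  refine le_trans (measure_mono ?_) (((hsample n).measure_not_goodAt_le (β := β)
    (b₀ := Rodeo.h₀ c₀ n) (T := Rodeo.maxCount β θ (r n) n) hc hL hσ rfl hmn fun k hk =>
    h3.small hc hβ0 hβ1 hθ hθR hrR (hx n) hk).trans ((ENNReal.ofReal_le_ofReal
    (h4 (r n) hrR)).trans ?_))
  · intro ω hω hgood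
    rw [Set.mem_ofPred_eq, one_mul, abs_of_nonneg (sq_nonneg _)] at hω
    simp only [hY] at hω
    exact absurd (h3.sq_estimate_sub_le hc hβ0 hβ1 hθ hθR hθε hRε hrR (hrd n) (hx n) hmn
      (hsparse n) h2 hgood mode) (not_le.mpr hω)
  · rw [ENNReal.ofReal_toReal (ne_top_of_le_ne_top ENNReal.one_ne_top (min_le_right _ _))]
    exact min_le_left _ _
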